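/- Fix a real number $p\ge 1$ and let $A_p=\mathbb E[P_1^p]$, where $P_1$ is a Poisson random variable with parameter $1$ (the fractional Bell number). Consider $R||\sum_j w_jC_j^p$: there are $n\ge 0$ jobs and $m\ge 1$ machines, job $j$ has weight $w_j\ge 0$ and takes time $p_{ij}\in\mathbb Z_{\ge 0}$ on machine $i$. A schedule assigns to each job a machine and a start time $\ge 0$ such that of two jobs on the same machine one is completed before the other starts; its cost is $\sum_j w_jC_j^p$, where $C_j$ is the completion time of $j$. Let $T=\sum_{i,j}p_{ij}$ be the planning horizon. (1) There is a randomized $2^pA_p$-approximation algorithm with running time polynomial in $n$, $m$ and $T$ (in the real-number model of computation with unit-cost arithmetic operations and comparisons on real numbers, powers $k^p$ of natural numbers $k$ as a primitive, and coins with computed biases). That is, there are a program and a constant $d$ such that, on every instance, the program always halts within $(n+m+T+2)^d$ steps, always outputs a feasible schedule, and the expected cost of this schedule is at most $2^pA_p$ times the cost of any feasible schedule. (2) Consider, for an instance, the strong time-indexed linear program $$\min\sum_{i}\sum_j\sum_{t=0}^{T}w_j(t+p_{ij})^p\,x_{ijt}$$ subject to $\sum_{i}\sum_{t}x_{ijt}=1$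 for every job $j$; $\ \sum_j\sum_{\tau=\max(0,\,t-p_{ij}+1)}^{t}x_{ij\tau}\le 1$ for every machine $i$ and every integer $t\ge 0$ (with $x_{ij\tau}=0$ for $\tau>T$); and $x_{ijt}\ge 0$. It has an optimal solution, and its optimal value is at most the cost of every feasible schedule. For a feasible point $x$, let each job $j$, independently of the other jobs, be tentatively assigned to a pair $(i,t_j)$ of a machine and a start time, where $(i,t)$ has probability $x_{ijt}$; then run, on each machine and without idle time, the jobs assigned to it in the order of their tentative completion times $t_j+p_{ij}$, ties being broken according to any fixed order of the jobs. The resulting schedule is always feasible, and its expected cost is at most $$2^pA_p\sum_{i}\sum_j\sum_{t=0}^{T}w_j(t+p_{ij})^p\,x_{ijt}.$$ In particular, if $x$ is an optimal solution of the linear program, then the expected cost is at most $2^pA_p$ times the cost of any feasible schedule. -/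

import Mathlib

open scoped ENNReal NNReal

noncomputable section

namespace UnrelatedScheduling

/-- The fractional Bell number: the `q`-th moment of a Poisson random variable with parameter 1. -/
def fractionalBell (q : ℝ) : ℝ :=
  ∫ k : ℕ, (k : ℝ) ^ q ∂(ProbabilityTheory.poissonMeasure 1)

/-! ## The scheduling problem -/

/-- An instance with `n` jobs and `m` unrelated machines: `proc i j` is the processing time of job
`j` on machine `i`, and `weight j` is the weight of job `j`. -/
structure Instance (n m : ℕ) where
  proc : Fin m → Fin n → ℕ
  weight : Fin n → ℝ
  weight_nonneg : ∀ j, 0 ≤ weight j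

/-- A schedule: the machine and the (real) start time of each job. -/
structure Schedule (n m : ℕ) where
  machine : Fin n → Fin m
  start : Fin n → ℝ

namespace Instance

variable {n m : ℕ}

/-- The planning horizon `∑ i, ∑ j, p i j`. -/
def horizon (I : Instance n m) : ℕ := ∑ i, ∑ j, I.proc i j

/-- The processing time of job `j` on the machine to which `S` assigns it. -/
def duration (I : Instance n m) (S : Schedule n m) (j : Fin n) : ℝ :=
  (I.proc (S.machine j) j : ℝ)

/-- The completion time of job `j`. -/
def completion (I : Instance n m) (S : Schedule n m) (j : Fin n) : ℝ :=
  S.start j + I.duration S j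

/-- Start times are nonnegative, and of two jobs on one machine, one is completed before the other
one starts. -/
def Feasible (I : Instance n m) (S : Schedule n m) : Prop :=
  (∀ j, 0 ≤ S.start j) ∧
  ∀ j k, j ≠ k → S.machine j = S.machine k →
    I.completion S j ≤ S.start k ∨ I.completion S k ≤ S.start j

/-- The objective `∑ j, w j * (C j) ^ p`. -/
def cost (I : Instance n m) (p : ℝ) (S : Schedule n m) : ℝ :=
  ∑ j, I.weight j * (I.completion S j) ^ p

/-! ## The strong time-indexed linear program

`x i j t` is the extent to which job `j` starts on machine `i` at time `t`, for
`t = 0, …, I.horizon`. -/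

/-- The fractional points indexed by machines, jobs and start times up to the horizon. -/
abbrev Point (I : Instance n m) : Type := Fin m → Fin n → Fin (I.horizon + 1) → ℝ

/-- The constraints: every job is started exactly once, at every time `t` at most one job is in
execution on machine `i` (a job started at `τ` is in execution during `τ ≤ t < τ + p i j`), and the
variables are nonnegative. -/
def LPFeasible (I : Instance n m) (x : I.Point) : Prop :=
  (∀ j, ∑ i, ∑ t, x i j t = 1) ∧
  (∀ i, ∀ t : ℕ,
    ∑ j, ∑ τ : Fin (I.horizon + 1),
      (if (τ : ℕ) ≤ t ∧ t < (τ : ℕ) + I.proc i j then x i j τ else 0) ≤ 1) ∧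
  (∀ i j t, 0 ≤ x i j t)

/-- The objective of the linear program. -/
def lpCost (I : Instance n m) (p : ℝ) (x : I.Point) : ℝ :=
  ∑ i, ∑ j, ∑ t : Fin (I.horizon + 1),
    I.weight j * ((t : ℝ) + (I.proc i j : ℝ)) ^ p * x i j t

/-- `x` is an optimal solution of the linear program. -/
def LPOptimal (I : Instance n m) (p : ℝ) (x : I.Point) : Prop :=
  I.LPFeasible x ∧ ∀ y, I.LPFeasible y → I.lpCost p x ≤ I.lpCost p y

/-! ## Rounding -/

/-- A tentative assignment: a machine and a tentative start time for each job. -/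
abbrev Tentative (I : Instance n m) : Type := Fin n → Fin m × Fin (I.horizon + 1)

/-- The tentative completion time `t j + p i j` of job `j`. -/
def tentativeCompletion (I : Instance n m) (a : I.Tentative) (j : Fin n) : ℕ :=
  ((a j).2 : ℕ) + I.proc (a j).1 j

/-- Job `k` precedes job `j`: earlier tentative completion time, ties being broken according to the
permutation `tie` of the jobs. -/
def Precedes (I : Instance n m) (tie : Equiv.Perm (Fin n)) (a : I.Tentative) (k j : Fin n) : Prop :=
  I.tentativeCompletion a k < I.tentativeCompletion a j ∨
    (I.tentativeCompletion a k = I.tentativeCompletion a j ∧ tie k < tie j)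

open Classical in
/-- The schedule which runs on every machine, without idle time, the jobs tentatively assigned to
this machine in the order of their tentative completion times. -/
def listSchedule (I : Instance n m) (tie : Equiv.Perm (Fin n)) (a : I.Tentative) :
    Schedule n m where
  machine j := (a j).1
  start j := ∑ k, if (a k).1 = (a j).1 ∧ I.Precedes tie a k j then (I.proc (a k).1 k : ℝ) else 0

/-- The expected cost of `I.listSchedule tie a`, where the pairs `a j` (machine and tentative start
time of job `j`) are independent and `a j = (i, t)` has probability `x i j t`. -/
def roundingExpectedCost (I : Instance n m) (p : ℝ) (tie : Equiv.Perm (Fin n)) (x : I.Point) : ℝ :=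
  ∑ a : I.Tentative, (∏ j, x (a j).1 j (a j).2) * I.cost p (I.listSchedule tie a)

end Instance

/-! ## Randomized algorithms over the reals, with a step count

A program is a finite piece of code, the same for all inputs. Its memory consists of numbered
arrays of natural numbers and of real numbers, with three indices each. The exponent `p` of the
problem is fixed, and powers `k ^ p` of natural numbers `k` are a primitive. -/

/-- Expressions for natural numbers: constants, memory cells, sums, truncated differences. -/
inductive NatExp where
  | lit (c : ℕ)
  | get (arr : ℕ) (i j k : NatExp)
  | add (e f : NatExp)
  | sub (e f : NatExp)

/-- Expressions for real numbers: natural numbers, memory cells, the field operations, and `p`-th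
powers of natural numbers. -/
inductive RealExp where
  | cast (e : NatExp)
  | get (arr : ℕ) (i j k : NatExp)
  | add (e f : RealExp)
  | sub (e f : RealExp)
  | mul (e f : RealExp)
  | div (e f : RealExp)
  | pow (e : NatExp)

/-- Tests: comparison of natural numbers or of real numbers. -/
inductive Test where
  | natLe (e f : NatExp)
  | realLe (e f : RealExp)

/-- Commands. `flip arr i j k q` sets a cell of an array of natural numbers to `1` with probability
`q` (truncated to `[0, 1]`) and to `0` otherwise, independently of all that happened before. -/
inductive Cmd where
  | setNat (arr : ℕ) (i j k e : NatExp)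
  | setReal (arr : ℕ) (i j k : NatExp) (e : RealExp)
  | flip (arr : ℕ) (i j k : NatExp) (q : RealExp)
  | seq (c d : Cmd)
  | ite (b : Test) (c d : Cmd)
  | while (b : Test) (c : Cmd)

/-- The contents of the memory. -/
structure Mem where
  nat : ℕ → ℕ → ℕ → ℕ → ℕ
  real : ℕ → ℕ → ℕ → ℕ → ℝ

def NatExp.eval (s : Mem) : NatExp → ℕ
  | .lit c => c
  | .get arr i j k => s.nat arr (i.eval s) (j.eval s) (k.eval s)
  | .add e f => e.eval s + f.eval s
  | .sub e f => e.eval s - f.eval s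

def RealExp.eval (p : ℝ) (s : Mem) : RealExp → ℝ
  | .cast e => (e.eval s : ℝ)
  | .get arr i j k => s.real arr (i.eval s) (j.eval s) (k.eval s)
  | .add e f => e.eval p s + f.eval p s
  | .sub e f => e.eval p s - f.eval p s
  | .mul e f => e.eval p s * f.eval p s
  | .div e f => e.eval p s / f.eval p s
  | .pow e => (e.eval s : ℝ) ^ p

def Test.Holds (p : ℝ) (s : Mem) : Test → Prop
  | .natLe e f => e.eval s ≤ f.eval s
  | .realLe e f => e.eval p s ≤ f.eval p s

def Mem.setNat (s : Mem) (arr i j k v : ℕ) : Mem where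
  nat a b c d := if a = arr ∧ b = i ∧ c = j ∧ d = k then v else s.nat a b c d
  real := s.real

def Mem.setReal (s : Mem) (arr i j k : ℕ) (v : ℝ) : Mem where
  nat := s.nat
  real a b c d := if a = arr ∧ b = i ∧ c = j ∧ d = k then v else s.real a b c d

/-- The coin that shows `true` with probability `q` truncated to `[0, 1]`. -/
def coin (q : ℝ) : PMF Bool :=
  PMF.ofFintype
    (fun b => if b then ENNReal.ofReal (max 0 (min q 1)) else ENNReal.ofReal (1 - max 0 (min q 1)))
    (by
      have h0 : (0 : ℝ) ≤ max 0 (min q 1) := le_max_left _ _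
      have h1 : max 0 (min q 1) ≤ 1 := max_le zero_le_one (min_le_right _ _)
      simp only [Fintype.sum_bool, if_true, Bool.false_eq_true, if_false]
      rw [← ENNReal.ofReal_add h0 (by linarith)]
      simp)

/-- A configuration: the commands that are still to be executed, and the memory. -/
abbrev Config : Type := List Cmd × Mem

open Classical in
/-- One step of a computation. A configuration with nothing left to execute is final. -/
def step (p : ℝ) : Config → PMF Config
  | ([], s) => PMF.pure ([], s)
  | (.setNat arr i j k e :: K, s) =>
      PMF.pure (K, s.setNat arr (i.eval s) (j.eval s) (k.eval s) (e.eval s))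
  | (.setReal arr i j k e :: K, s) =>
      PMF.pure (K, s.setReal arr (i.eval s) (j.eval s) (k.eval s) (e.eval p s))
  | (.flip arr i j k q :: K, s) =>
      (coin (q.eval p s)).map fun b =>
        (K, s.setNat arr (i.eval s) (j.eval s) (k.eval s) (if b then 1 else 0))
  | (.seq c d :: K, s) => PMF.pure (c :: d :: K, s)
  | (.ite b c d :: K, s) => PMF.pure (if b.Holds p s then c :: K else d :: K, s)
  | (.while b c :: K, s) => PMF.pure (if b.Holds p s then c :: .while b c :: K else K, s)

/-- The distribution of the configuration after a number of steps. -/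
def run (p : ℝ) : ℕ → Config → PMF Config
  | 0, c => PMF.pure c
  | k + 1, c => (step p c).bind (run p k)

variable {n m : ℕ}

/-- The memory at the start: `n` and `m` are in the arrays `0` and `1` of natural numbers, the
processing times in array `2`, the weights in array `0` of real numbers, and all other cells are
zero. -/
def Instance.inputMem (I : Instance n m) : Mem where
  nat arr i j k :=
    if arr = 0 ∧ i = 0 ∧ j = 0 ∧ k = 0 then n
    else if arr = 1 ∧ i = 0 ∧ j = 0 ∧ k = 0 then m
    else if h : arr = 2 ∧ i < m ∧ j < n ∧ k = 0 then I.proc ⟨i, h.2.1⟩ ⟨j, h.2.2.1⟩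
    else 0
  real arr i j k :=
    if h : arr = 0 ∧ i < n ∧ j = 0 ∧ k = 0 then I.weight ⟨i, h.2.1⟩ else 0

/-- The schedule written in the memory: the machines are in array `3` of natural numbers and the
start times in array `4`. (Machine numbers are reduced modulo `m` here;
`WritesFeasible` demands that they are less than `m`.) -/
def Mem.schedule [NeZero m] (s : Mem) : Schedule n m where
  machine j := Fin.ofNat m (s.nat 3 j 0 0)
  start j := (s.nat 4 j 0 0 : ℝ)

/-- The memory holds a feasible schedule of the instance. -/
def Instance.WritesFeasible [NeZero m] (I : Instance n m) (s : Mem) : Prop :=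
  (∀ j : Fin n, s.nat 3 j 0 0 < m) ∧ I.Feasible s.schedule

/-- The distribution of the configuration of the program `P` on input `I` after `k` steps. -/
def Instance.runOn (I : Instance n m) (p : ℝ) (P : Cmd) (k : ℕ) : PMF Config :=
  run p k ([P], I.inputMem)

/-- The expected cost of the schedule that is in the memory after `k` steps. -/
def Instance.expectedCost [NeZero m] (I : Instance n m) (p : ℝ) (P : Cmd) (k : ℕ) : ℝ≥0∞ :=
  ∑' c : Config, I.runOn p P k c * ENNReal.ofReal (I.cost p c.2.schedule)

/-- The program `P` is a randomized `α`-approximation algorithm for `R || ∑ w_j C_j ^ p` whose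
running time is polynomial in `n`, `m` and the planning horizon: for some fixed `d`, on every
instance it halts within `(n + m + horizon + 2) ^ d` steps whatever the coins show, it then has
always written a feasible schedule, and the expected cost of this schedule is at most `α` times the
cost of any feasible schedule. -/
def IsPolyTimeApprox (p α : ℝ) (P : Cmd) : Prop :=
  ∃ d : ℕ, ∀ (n m : ℕ) [NeZero m] (I : Instance n m),
    (∀ c ∈ (I.runOn p P ((n + m + I.horizon + 2) ^ d)).support,
      c.1 = [] ∧ I.WritesFeasible c.2) ∧
    ∀ S : Schedule n m, I.Feasible S →
      I.expectedCost p P ((n + m + I.horizon + 2) ^ d) ≤ ENNReal.ofReal (α * I.cost p S)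

end UnrelatedScheduling

end

open scoped ENNReal NNReal

noncomputable section

namespace UnrelatedScheduling

open MeasureTheory ProbabilityTheory

/-! ## Moments of Poisson variables -/

/-! Write A for the fractional Bell number. The core is a convex-order estimate. If a variable with
values in [0, 1] and mean u is added to an independent quantity, convexity bounds the expected p-th
power by the chord from 0 to 1, and this chord is the first-order lower bound for adding an
independent Poisson(u) variable instead. Replacing the summands one after the other
(`prodExp_poissonMoment_le`) shows that a sum of independent [0, 1]-valued variables of total mean μ
≤ 1 has p-th moment at most that of Poisson(μ), which in turn is at most A - (1 - μ)
(`prodExp_sum_rpow_le`).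

For the rounding, fix the choice q of job j, with deadline C. Job j is completed no later than its
own processing time plus the load of the other jobs on its machine with deadline at most C. Divided
by C, that load is a sum of independent variables in [0, 1]: a contributing job fits before its own
deadline, which is at most C. Its mean is at most 1, because the capacity constraints summed over
the times below C bound the expected load by C. The inequality (a + b)^p ≤ 2^(p-1) (a^p + b^p)
separates job j from the rest. The result is 2^(p-1) C^p (A + 1 - x), where x is the probability of
q (`prodExp_completion_le`), and A ≥ 1 turns this into 2^p A C^p. This settles the linear program;
it bounds the optimum from below because a schedule can be left-justified without delaying any job.

The algorithm does not solve that linear program. The rounding only uses the weaker deadline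
relaxation: every job picks a machine and a deadline, and the load with deadline at most C is at
most C. Capacities are replaced by a quadratic penalty and the convex objective is minimized by the
conditional gradient method. Each step is a separate minimization for every job, and the iterate is
a product distribution that need not be stored: replaying the steps, with the step length as the
probability of overwriting a job's choice, samples from it exactly.

After polynomially many steps both the optimality gap and the capacity violation are inverse
polynomial. The slack -x in the rounding bound absorbs them, so the ratio 2^p A holds with no
additive error. The scale is the total weight W of the jobs that take positive time on all machines:
the slack is worth at least W / size^2, and the errors are W divided by a higher power of the size
(`exists_exponents_prodExp_le`).

The program is verified by a deterministic Hoare logic with step bounds (`Runs`) and, where coins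
are tossed, by upper bounds on expectations (`ExpectLe`). The bounded cost function is infinite on
every configuration that has not halted with a feasible schedule, so a finite expectation also
proves termination and feasibility for all coin outcomes. -/

/-- The `p`-th moment of `s + P`, where `P` is Poisson with parameter `r`. -/
def poissonMoment (p s : ℝ) (r : ℝ≥0) : ℝ :=
  ∫ k : ℕ, (s + k : ℝ) ^ p ∂(poissonMeasure r)

/-- A power is dominated by an exponential: (s + k)^p ≤ d! e^(1 + s + k) with d = ⌈p⌉. The series is
thus bounded by a multiple of the exponential series at r e. -/
theorem summable_poisson_moment (p s : ℝ) (hp : 0 ≤ p) (hs : 0 ≤ s) (r : ℝ) (hr : 0 ≤ r) :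
    Summable fun k : ℕ => Real.exp (-r) * r ^ k / (k.factorial : ℝ) * ((s + k : ℝ) ^ p) := by
  set d := ⌈p⌉₊
  have hbound : ∀ k : ℕ, (s + k : ℝ) ^ p ≤ (d.factorial : ℝ) * (Real.exp (1 + s) * Real.exp 1 ^ k) := by
    intro k
    have h1 : (s + k : ℝ) ^ p ≤ (1 + s + k : ℝ) ^ (d : ℝ) := by
      calc (s + k : ℝ) ^ p ≤ (1 + s + k : ℝ) ^ p :=
            Real.rpow_le_rpow (by positivity) (by linarith) hp
        _ ≤ _ := Real.rpow_le_rpow_of_exponent_le (by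
            have : (0 : ℝ) ≤ k := by positivity
            linarith) (Nat.le_ceil p)
    rw [Real.rpow_natCast] at h1
    have h2 := Real.pow_div_factorial_le_exp (1 + s + k) (by positivity) d
    rw [div_le_iff₀ (by positivity)] at h2
    have h3 : Real.exp (1 + s + k) = Real.exp (1 + s) * Real.exp 1 ^ k := by
      rw [Real.exp_add, ← Real.exp_nat_mul, mul_one]
    rw [h3] at h2
    linarith
  have hsum := (Real.summable_pow_div_factorial (r * Real.exp 1)).mul_left
    (Real.exp (-r) * d.factorial * Real.exp (1 + s))
  refine Summable.of_nonneg_of_le (fun k => by positivity) (fun k => ?_) hsum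
  calc Real.exp (-r) * r ^ k / (k.factorial : ℝ) * ((s + k : ℝ) ^ p)
      ≤ Real.exp (-r) * r ^ k / (k.factorial : ℝ) *
        ((d.factorial : ℝ) * (Real.exp (1 + s) * Real.exp 1 ^ k)) :=
        mul_le_mul_of_nonneg_left (hbound k) (by positivity)
    _ = _ := by rw [mul_pow]; ring

theorem integrable_poisson_moment {p s : ℝ} (hp : 0 ≤ p) (hs : 0 ≤ s) (r : ℝ≥0) :
    Integrable (fun k : ℕ => (s + k : ℝ) ^ p) (poissonMeasure r) := by
  rw [integrable_poissonMeasure_iff]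
  refine (summable_poisson_moment p s hp hs r r.2).congr fun k => ?_
  rw [Real.norm_of_nonneg (by positivity)]

theorem integral_id_poissonMeasure (r : ℝ≥0) :
    ∫ k : ℕ, (k : ℝ) ∂(poissonMeasure r) = r := by
  rw [integral_poissonMeasure]
  have h := (hasSum_one_poissonMeasure r).mul_left (r : ℝ)
  rw [mul_one] at h
  refine HasSum.tsum_eq ?_
  rw [← hasSum_nat_add_iff' 1]
  simp only [Finset.range_one, Finset.sum_singleton, Nat.cast_zero, smul_eq_mul, mul_zero, sub_zero]
  convert! h using 2 with k
  rw [Nat.factorial_succ]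
  push_cast
  field_simp
  ring

theorem convex_rpow_chord {p : ℝ} (hp : 1 ≤ p) {s t : ℝ} (hs : 0 ≤ s) (ht : 0 ≤ t) (ht1 : t ≤ 1) :
    (s + t) ^ p ≤ s ^ p + t * ((s + 1) ^ p - s ^ p) := by
  have h := (convexOn_rpow hp).2 (Set.mem_Ici.2 hs)
    (Set.mem_Ici.2 (show 0 ≤ s + 1 by linarith))
    (show 0 ≤ 1 - t by linarith) ht (by ring)
  simp only [smul_eq_mul] at h
  have e : (1 - t) * s + t * (s + 1) = s + t := by ring
  rw [e] at h
  linarith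

/-- For k ≥ 1 the point s + 1 is the convex combination of s and s + k with weight 1/k on the
latter. Integrality of k is essential: between 0 and 1 the inequality is reversed, and this contrast
between [0, 1]-valued and integer variables makes the Poisson comparison work. -/
theorem convex_rpow_secant {p : ℝ} (hp : 1 ≤ p) {s : ℝ} (hs : 0 ≤ s) (k : ℕ) :
    s ^ p + k * ((s + 1) ^ p - s ^ p) ≤ (s + k) ^ p := by
  rcases Nat.eq_zero_or_pos k with rfl | hk
  · simp
  have hk' : (1 : ℝ) ≤ k := by exact_mod_cast hk
  have hk0 : (k : ℝ) ≠ 0 := by positivity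
  have h := (convexOn_rpow hp).2 (Set.mem_Ici.2 hs)
    (Set.mem_Ici.2 (show 0 ≤ s + k by positivity))
    (show 0 ≤ 1 - 1 / (k : ℝ) by rw [sub_nonneg, div_le_one (by positivity)]; exact hk')
    (show 0 ≤ 1 / (k : ℝ) by positivity) (by ring)
  simp only [smul_eq_mul] at h
  have e : (1 - 1 / (k : ℝ)) * s + 1 / k * (s + k) = s + 1 := by field_simp; ring
  rw [e] at h
  have h2 := mul_le_mul_of_nonneg_left h (show (0 : ℝ) ≤ k by positivity)
  have e2 : (k : ℝ) * ((1 - 1 / (k : ℝ)) * s ^ p + 1 / k * (s + k) ^ p)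
      = k * s ^ p - s ^ p + (s + k) ^ p := by field_simp
  rw [e2] at h2
  linarith

theorem integral_affine {μ : Measure ℕ} {f g : ℕ → ℝ} (hf : Integrable f μ) (hg : Integrable g μ)
    (t : ℝ) : Integrable (fun k => f k + t * (g k - f k)) μ ∧
      ∫ k, (f k + t * (g k - f k)) ∂μ = ∫ k, f k ∂μ + t * (∫ k, g k ∂μ - ∫ k, f k ∂μ) := by
  have h : Integrable (fun k => t * (g k - f k)) μ := (hg.sub hf).const_mul t
  exact ⟨hf.add h, by rw [integral_add hf h, integral_const_mul, integral_sub hg hf]⟩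

theorem poissonMoment_chord {p : ℝ} (hp : 1 ≤ p) {s t : ℝ} (hs : 0 ≤ s) (ht : 0 ≤ t) (ht1 : t ≤ 1)
    (r : ℝ≥0) :
    poissonMoment p (s + t) r ≤
      poissonMoment p s r + t * (poissonMoment p (s + 1) r - poissonMoment p s r) := by
  have hp0 : 0 ≤ p := by linarith
  have i0 := integrable_poisson_moment hp0 hs r
  have i1 := integrable_poisson_moment hp0 (show 0 ≤ s + 1 by linarith) r
  have it := integrable_poisson_moment hp0 (show 0 ≤ s + t by linarith) r
  unfold poissonMoment
  rw [← (integral_affine i0 i1 t).2]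
  refine integral_mono it (integral_affine i0 i1 t).1 fun k => ?_
  have := convex_rpow_chord hp (s := s + k) (t := t) (by positivity) ht ht1
  simpa only [add_right_comm s _ (k : ℝ)] using this

/-- A Poisson variable with parameter r + u is the sum of independent ones with parameters u and r;
the integral is evaluated by conditioning on the first. -/
theorem poissonMoment_add {p : ℝ} (hp : 0 ≤ p) {s : ℝ} (hs : 0 ≤ s) (r u : ℝ≥0) :
    Integrable (fun k : ℕ => poissonMoment p (s + k) r) (poissonMeasure u) ∧
    poissonMoment p s (r + u) = ∫ k : ℕ, poissonMoment p (s + k) r ∂(poissonMeasure u) := by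
  have hi := integrable_poisson_moment hp hs (r + u)
  have hc : poissonMeasure u ∗ poissonMeasure r = poissonMeasure (r + u) := by
    rw [add_comm, poissonMeasure_conv_poissonMeasure]
  rw [← hc] at hi
  have e : ∀ k l : ℕ, (s + ((k + l : ℕ) : ℝ)) ^ p = (s + k + l) ^ p := by
    intro k l; push_cast; ring_nf
  constructor
  · have h := ((integrable_conv_iff (by exact hi.aestronglyMeasurable)).1 hi).2
    refine (Integrable.congr h ?_)
    refine Filter.Eventually.of_forall fun k => ?_
    simp only [poissonMoment]
    refine integral_congr_ae (Filter.Eventually.of_forall fun l => ?_)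
    simp only
    rw [e, Real.norm_of_nonneg (by positivity)]
  · unfold poissonMoment
    rw [← hc, integral_conv hi]
    simp only [e]

/-- Condition on the Poisson(u) part k, use the secant inequality at s plus the Poisson(r) part, and
average: only the mean u of k enters. The left side is exactly the chord bound of
`poissonMoment_chord` for an increment of mean u. -/
theorem poissonMoment_tangent {p : ℝ} (hp : 1 ≤ p) {s : ℝ} (hs : 0 ≤ s) (r u : ℝ≥0) :
    poissonMoment p s r + u * (poissonMoment p (s + 1) r - poissonMoment p s r) ≤
      poissonMoment p s (r + u) := by
  have hp0 : 0 ≤ p := by linarith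
  obtain ⟨hi, he⟩ := poissonMoment_add hp0 hs r u
  have hid : Integrable (fun k : ℕ => (k : ℝ)) (poissonMeasure u) := by
    simpa using integrable_poisson_moment (p := 1) (s := 0) zero_le_one le_rfl u
  set a := poissonMoment p s r
  set b := poissonMoment p (s + 1) r
  have h1 : ∫ k : ℕ, (a + k * (b - a)) ∂(poissonMeasure u) = a + u * (b - a) := by
    rw [integral_add (integrable_const _) (hid.mul_const _), integral_mul_const,
      integral_id_poissonMeasure]
    simp
  rw [he, ← h1]
  refine integral_mono ((integrable_const _).add (hid.mul_const _)) hi fun k => ?_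
  have i0 := integrable_poisson_moment hp0 hs r
  have i1 := integrable_poisson_moment hp0 (show 0 ≤ s + 1 by linarith) r
  have ik := integrable_poisson_moment hp0 (show 0 ≤ s + k by positivity) r
  simp only [a, b, poissonMoment]
  rw [← (integral_affine i0 i1 k).2]
  refine integral_mono (integral_affine i0 i1 k).1 ik fun l => ?_
  have := convex_rpow_secant hp (s := s + l) (by positivity) k
  simpa only [add_right_comm s _ (l : ℝ)] using this

/-- Superadditivity of the p-th power gives (1 + k)^p - k^p ≥ 1 for every value k of the Poisson
variable. -/
theorem one_le_poissonMoment_sub {p : ℝ} (hp : 1 ≤ p) (r : ℝ≥0) :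
    1 ≤ poissonMoment p (0 + 1) r - poissonMoment p 0 r := by
  have hp0 : 0 ≤ p := by linarith
  have i0 := integrable_poisson_moment hp0 (le_refl (0 : ℝ)) r
  have i1 := integrable_poisson_moment hp0 (show (0 : ℝ) ≤ 0 + 1 by norm_num) r
  have h : ∫ _ : ℕ, (1 : ℝ) ∂(poissonMeasure r) = 1 := by simp
  have hle : ∀ k : ℕ, (1 : ℝ) ≤ (0 + 1 + (k : ℝ)) ^ p - (0 + (k : ℝ)) ^ p := by
    intro k
    have := Real.add_rpow_le_rpow_add (show (0 : ℝ) ≤ k by positivity) zero_le_one hp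
    rw [Real.one_rpow] at this
    rw [zero_add, zero_add, add_comm (1 : ℝ)]
    linarith
  unfold poissonMoment
  rw [← integral_sub i1 i0]
  calc (1 : ℝ) = ∫ _ : ℕ, (1 : ℝ) ∂(poissonMeasure r) := h.symm
    _ ≤ _ := integral_mono (integrable_const (1 : ℝ)) (i1.sub i0) hle

theorem fractionalBell_eq (p : ℝ) : fractionalBell p = poissonMoment p 0 1 := by
  simp [fractionalBell, poissonMoment]

/-- Raising the parameter from r to 1 raises the moment at rate at least 1. The term 1 - r is the
slack that later pays for job j's own processing time and for the errors of the algorithm. -/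
theorem poissonMoment_add_le_fractionalBell {p : ℝ} (hp : 1 ≤ p) {r : ℝ≥0} (hr : r ≤ 1) :
    poissonMoment p 0 r + (1 - r) ≤ fractionalBell p := by
  have h := poissonMoment_tangent hp le_rfl r (1 - r)
  have h1 := one_le_poissonMoment_sub hp r
  rw [add_tsub_cancel_of_le hr, NNReal.coe_sub hr, ← fractionalBell_eq] at h
  have h2 : (0 : ℝ) ≤ (1 : ℝ≥0) - r := sub_nonneg.2 (by exact_mod_cast hr)
  have h3 := mul_le_mul_of_nonneg_left h1 h2
  simp only [NNReal.coe_one] at *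
  linarith

theorem poissonMoment_zero (p s : ℝ) : poissonMoment p s 0 = s ^ p := by
  rw [poissonMoment, integral_poissonMeasure, tsum_eq_single 0]
  · simp
  · intro k hk
    simp [hk]

theorem one_le_fractionalBell {p : ℝ} (hp : 1 ≤ p) : 1 ≤ fractionalBell p := by
  have h := poissonMoment_add_le_fractionalBell hp (zero_le_one)
  rw [poissonMoment_zero, Real.zero_rpow (by linarith)] at h
  simpa using h

/-! ## Expectations under product distributions -/

section ProdExp

variable {ι Q : Type*} [Fintype ι] [DecidableEq ι] [Fintype Q]

/-- The expectation of `g a`, where the coordinates `a j` are independent and `a j = q` has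
probability `x j q`. -/
def prodExp (x : ι → Q → ℝ) (g : (ι → Q) → ℝ) : ℝ :=
  ∑ a : ι → Q, (∏ j, x j (a j)) * g a

theorem prodExp_add (x : ι → Q → ℝ) (g h : (ι → Q) → ℝ) :
    prodExp x (fun a => g a + h a) = prodExp x g + prodExp x h := by
  simp [prodExp, mul_add, Finset.sum_add_distrib]

theorem prodExp_const_mul (x : ι → Q → ℝ) (c : ℝ) (g : (ι → Q) → ℝ) :
    prodExp x (fun a => c * g a) = c * prodExp x g := by
  simp only [prodExp, Finset.mul_sum]
  exact Finset.sum_congr rfl fun a _ => by ring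

theorem prodExp_sum {κ : Type*} (s : Finset κ) (x : ι → Q → ℝ) (g : κ → (ι → Q) → ℝ) :
    prodExp x (fun a => ∑ k ∈ s, g k a) = ∑ k ∈ s, prodExp x (g k) := by
  simp only [prodExp, Finset.mul_sum]
  exact Finset.sum_comm

theorem prodExp_mono {x : ι → Q → ℝ} (hx : ∀ j q, 0 ≤ x j q) {g h : (ι → Q) → ℝ}
    (hgh : ∀ a, (∀ j, x j (a j) ≠ 0) → g a ≤ h a) : prodExp x g ≤ prodExp x h := by
  refine Finset.sum_le_sum fun a _ => ?_
  by_cases ha : ∀ j, x j (a j) ≠ 0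
  · exact mul_le_mul_of_nonneg_left (hgh a ha) (Finset.prod_nonneg fun j _ => hx j _)
  · push Not at ha
    obtain ⟨j, hj⟩ := ha
    have h0 : ∏ j, x j (a j) = 0 := Finset.prod_eq_zero (Finset.mem_univ j) hj
    simp [h0]

/-- Replacing one row of the product distribution amounts to resampling one coordinate. -/
theorem prodExp_update {x : ι → Q → ℝ} (j : ι) (hx : ∑ q, x j q = 1) (y : Q → ℝ)
    (g : (ι → Q) → ℝ) :
    prodExp (Function.update x j y) g =
      prodExp x fun a => ∑ q, y q * g (Function.update a j q) := by
  let R : (ι → Q) → ℝ := fun a => ∏ k ∈ Finset.univ.erase j, x k (a k)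
  have hR : ∀ a q, R (Function.update a j q) = R a := by
    intro a q
    refine Finset.prod_congr rfl fun k hk => ?_
    rw [Function.update_of_ne (Finset.ne_of_mem_erase hk)]
  have h1 : ∀ a, ∏ k, x k (a k) = x j (a j) * R a := fun a =>
    (Finset.mul_prod_erase _ _ (Finset.mem_univ j)).symm
  have h2 : ∀ a, ∏ k, (Function.update x j y) k (a k) = y (a j) * R a := by
    intro a
    rw [← Finset.mul_prod_erase _ _ (Finset.mem_univ j), Function.update_self]
    congr 1
    refine Finset.prod_congr rfl fun k hk => ?_
    rw [Function.update_of_ne (Finset.ne_of_mem_erase hk)]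
  -- Exchanging coordinate j of the assignment with an independent spare value is an involution;
  -- reindexing the double sum along it transfers the row y from one to the other.
  have hinv : Function.Involutive fun z : (ι → Q) × Q => (Function.update z.1 j z.2, z.1 j) := by
    intro z
    simp
  have h3 := Equiv.sum_comp hinv.toPerm
    (fun z : (ι → Q) × Q => x j z.2 * (y (z.1 j) * R z.1 * g z.1))
  simp only [Function.Involutive.coe_toPerm, Function.update_self, hR,
    Fintype.sum_prod_type] at h3
  simp only [prodExp, h1, h2, Finset.mul_sum]
  calc ∑ a, y (a j) * R a * g a
      = ∑ a, ∑ q, x j q * (y (a j) * R a * g a) := by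
        simp only [← Finset.sum_mul, hx, one_mul]
    _ = _ := by
        rw [← h3]
        exact Finset.sum_congr rfl fun a _ => Finset.sum_congr rfl fun q _ => by ring

theorem prodExp_resample {x : ι → Q → ℝ} (j : ι) (hx : ∑ q, x j q = 1) (g : (ι → Q) → ℝ) :
    prodExp x g = prodExp x fun a => ∑ q, x j q * g (Function.update a j q) := by
  rw [← prodExp_update j hx, Function.update_eq_self]

theorem prodExp_const {x : ι → Q → ℝ} (hx : ∀ j, ∑ q, x j q = 1) (c : ℝ) :
    prodExp x (fun _ => c) = c := by
  have h := Finset.prod_univ_sum (fun _ : ι => (Finset.univ : Finset Q)) x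
  simp only [hx, Finset.prod_const_one, Fintype.piFinset_univ] at h
  rw [prodExp, ← Finset.sum_mul, ← h, one_mul]

theorem prodExp_point [DecidableEq Q] (a₀ : ι → Q) (g : (ι → Q) → ℝ) :
    prodExp (fun j q => if q = a₀ j then 1 else 0) g = g a₀ := by
  rw [prodExp, Finset.sum_eq_single a₀]
  · simp
  · intro a _ ha
    obtain ⟨j, hj⟩ := Function.ne_iff.1 ha
    rw [Finset.prod_eq_zero (Finset.mem_univ j) (by simp [hj]), zero_mul]
  · simp

variable {p : ℝ} {x : ι → Q → ℝ}

/-- Sums of independent variables with values in `[0, 1]` are dominated by Poisson variables in the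
convex order, for powers. -/
theorem prodExp_poissonMoment_le (hp : 1 ≤ p) (hx0 : ∀ j q, 0 ≤ x j q)
    (hx1 : ∀ j, ∑ q, x j q = 1) (l : ι → Q → ℝ) (hl0 : ∀ j q, 0 ≤ l j q)
    (hl1 : ∀ j q, x j q ≠ 0 → l j q ≤ 1) (s : Finset ι) (b : ℝ) (hb : 0 ≤ b) (r : ℝ≥0) :
    prodExp x (fun a => poissonMoment p (b + ∑ k ∈ s, l k (a k)) r) ≤
      poissonMoment p b (r + ∑ k ∈ s, (∑ q, x k q * l k q).toNNReal) := by
  induction s using Finset.induction_on generalizing r with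
  | empty => simp [prodExp_const hx1]
  | insert k s hk ih =>
    rw [Finset.sum_insert hk, ← add_assoc]
    refine le_trans ?_ (ih _)
    -- Average over coordinate k with the others fixed: the chord bound gives an expression
    -- depending only on the mean of l k, and the tangent bound absorbs this mean into the Poisson
    -- parameter. Hence the induction must hold for all r.
    rw [prodExp_resample k (hx1 k)]
    refine prodExp_mono hx0 fun a _ => ?_
    set S := ∑ i ∈ s, l i (a i)
    have hS : 0 ≤ S := Finset.sum_nonneg fun i _ => hl0 _ _
    have hsum : ∀ q, ∑ i ∈ insert k s, l i (Function.update a k q i) = l k q + S := by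
      intro q
      rw [Finset.sum_insert hk, Function.update_self]
      congr 1
      refine Finset.sum_congr rfl fun i hi => ?_
      rw [Function.update_of_ne (ne_of_mem_of_not_mem hi hk)]
    simp only [hsum]
    set G := poissonMoment p (b + S) r
    set D := poissonMoment p (b + S + 1) r - G
    have hterm : ∀ q, x k q * poissonMoment p (b + (l k q + S)) r ≤
        x k q * G + (x k q * l k q) * D := by
      intro q
      by_cases hq : x k q = 0
      · simp [hq]
      · have := poissonMoment_chord hp (show 0 ≤ b + S by positivity) (hl0 k q) (hl1 k q hq) r
        rw [show b + (l k q + S) = b + S + l k q by ring]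
        calc _ ≤ x k q * (G + l k q * D) := mul_le_mul_of_nonneg_left this (hx0 k q)
          _ = _ := by ring
    calc ∑ q, x k q * poissonMoment p (b + (l k q + S)) r
        ≤ ∑ q, (x k q * G + (x k q * l k q) * D) := Finset.sum_le_sum fun q _ => hterm q
      _ = G + (∑ q, x k q * l k q).toNNReal * D := by
          rw [Finset.sum_add_distrib, ← Finset.sum_mul, ← Finset.sum_mul, hx1, one_mul,
            Real.coe_toNNReal _ (Finset.sum_nonneg fun q _ => mul_nonneg (hx0 _ _) (hl0 _ _))]
      _ ≤ _ := poissonMoment_tangent hp (by positivity) r _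

/-- Start the comparison from the Poisson parameter 0, which is the constant 0, and then extend the
parameter from the total mean to 1. -/
theorem prodExp_sum_rpow_le (hp : 1 ≤ p) (hx0 : ∀ j q, 0 ≤ x j q)
    (hx1 : ∀ j, ∑ q, x j q = 1) (l : ι → Q → ℝ) (hl0 : ∀ j q, 0 ≤ l j q)
    (hl1 : ∀ j q, x j q ≠ 0 → l j q ≤ 1) (s : Finset ι)
    (hs : ∑ k ∈ s, ∑ q, x k q * l k q ≤ 1) :
    prodExp x (fun a => (∑ k ∈ s, l k (a k)) ^ p) ≤
      fractionalBell p - (1 - ∑ k ∈ s, ∑ q, x k q * l k q) := by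
  have h := prodExp_poissonMoment_le hp hx0 hx1 l hl0 hl1 s 0 le_rfl 0
  simp only [poissonMoment_zero, zero_add] at h
  set r : ℝ≥0 := ∑ k ∈ s, (∑ q, x k q * l k q).toNNReal
  have hr : (r : ℝ) = ∑ k ∈ s, ∑ q, x k q * l k q := by
    rw [NNReal.coe_sum]
    exact Finset.sum_congr rfl fun k _ =>
      Real.coe_toNNReal _ (Finset.sum_nonneg fun q _ => mul_nonneg (hx0 _ _) (hl0 _ _))
  have h2 := poissonMoment_add_le_fractionalBell hp (r := r) (by
    rw [← NNReal.coe_le_coe, hr]; exact hs)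
  rw [hr] at h2
  linarith

end ProdExp

/-! ## The rounding bound -/

theorem add_rpow_le_two_rpow {p a b : ℝ} (hp : 1 ≤ p) (ha : 0 ≤ a) (hb : 0 ≤ b) :
    (a + b) ^ p ≤ 2 ^ (p - 1) * (a ^ p + b ^ p) := by
  lift a to ℝ≥0 using ha
  lift b to ℝ≥0 using hb
  exact_mod_cast NNReal.rpow_add_le_mul_rpow_add_rpow a b hp

section Rounding

variable {n m : ℕ} {Q : Type*} [Fintype Q]

/-- The load that the jobs with deadline at most `C` put on machine `i`. -/
def fracLoad (I : Instance n m) (mach : Q → Fin m) (dl : Fin n → Q → ℕ) (x : Fin n → Q → ℝ)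
    (i : Fin m) (C : ℕ) : ℝ :=
  ∑ k, ∑ q, if mach q = i ∧ dl k q ≤ C then (I.proc i k : ℝ) * x k q else 0

variable {I : Instance n m} {mach : Q → Fin m} {dl : Fin n → Q → ℕ} {x : Fin n → Q → ℝ}
  {p v : ℝ}

/-- Other jobs contribute independent variables that, scaled by C(1 + v), lie in [0, 1] and have
total mean at most 1; the constraint also contains the share of job j itself, which lowers that mean
and yields the term `- x j q`. The parameter v allows for slightly violated capacities. -/
theorem prodExp_completion_le (hp : 1 ≤ p) (hv : 0 ≤ v) (hx0 : ∀ j q, 0 ≤ x j q)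
    (hx1 : ∀ j, ∑ q, x j q = 1) (hdl : ∀ j q, x j q ≠ 0 → I.proc (mach q) j ≤ dl j q)
    (j : Fin n) (q : Q) (hq : x j q ≠ 0)
    (hcap : fracLoad I mach dl x (mach q) (dl j q) ≤ dl j q + v) :
    prodExp x (fun a => ((I.proc (mach q) j : ℝ) + ∑ k ∈ Finset.univ.erase j,
      if mach (a k) = mach q ∧ dl k (a k) ≤ dl j q then (I.proc (mach q) k : ℝ) else 0) ^ p) ≤
    2 ^ (p - 1) * ((dl j q : ℝ) ^ p * ((1 + v) ^ p * fractionalBell p + 1 - x j q)) := by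
  have hp0 : p ≠ 0 := by linarith
  have haC := hdl j q hq
  -- With deadline 0 all jobs that count have processing time 0, so the completion bound vanishes;
  -- this case must be split off before dividing by C.
  rcases Nat.eq_zero_or_pos (dl j q) with hC | hC
  · rw [hC] at haC ⊢
    have hz : prodExp x (fun _ => (0 : ℝ)) = 0 := prodExp_const hx1 0
    rw [Nat.cast_zero, Real.zero_rpow hp0, zero_mul, mul_zero]
    refine le_trans ?_ hz.le
    refine prodExp_mono hx0 fun a ha => ?_
    have hsum : (∑ k ∈ Finset.univ.erase j,
      if mach (a k) = mach q ∧ dl k (a k) ≤ 0 then (I.proc (mach q) k : ℝ) else 0) = 0 := by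
      refine Finset.sum_eq_zero fun k _ => ?_
      split_ifs with h
      · have := hdl k (a k) (ha k)
        rw [h.1] at this
        exact_mod_cast Nat.le_zero.1 (this.trans h.2)
      · rfl
    rw [hsum, Nat.le_zero.1 haC, Nat.cast_zero, add_zero, Real.zero_rpow hp0]
  set C : ℝ := (dl j q : ℝ) with hCdef
  set a₀ : ℝ := (I.proc (mach q) j : ℝ) with ha₀
  have hC1 : (1 : ℝ) ≤ C := Nat.one_le_cast.2 hC
  have hC0 : 0 < C := by linarith
  have haC' : a₀ ≤ C := Nat.cast_le.2 haC
  have ha0 : 0 ≤ a₀ := by positivity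
  set u := 1 + v with hu
  have hu1 : 1 ≤ u := by linarith
  have hu0 : 0 < u := by linarith
  have hCu : 0 < C * u := by positivity
  have hxq : x j q ≤ 1 := by
    rw [← hx1 j]
    exact Finset.single_le_sum (fun q _ => hx0 j q) (Finset.mem_univ q)
  let l : Fin n → Q → ℝ := fun k q' =>
    if mach q' = mach q ∧ dl k q' ≤ dl j q then (I.proc (mach q) k : ℝ) / (C * u) else 0
  have hl0 : ∀ k q', 0 ≤ l k q' := fun k q' => by
    simp only [l]; split_ifs <;> positivity
  have hl1 : ∀ k q', x k q' ≠ 0 → l k q' ≤ 1 := fun k q' h => by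
    simp only [l]
    split_ifs with h'
    · rw [div_le_one hCu]
      have h1 := hdl k q' h
      rw [h'.1] at h1
      have h2 : (I.proc (mach q) k : ℝ) ≤ C := Nat.cast_le.2 (h1.trans h'.2)
      nlinarith
    · exact zero_le_one
  set μ := ∑ k ∈ Finset.univ.erase j, ∑ q', x k q' * l k q' with hμ
  -- The capacity bounds the load of all jobs including j, and choice q of job j alone accounts for
  -- `a₀ * x j q` of it.
  have hμle : μ ≤ (C + v - a₀ * x j q) / (C * u) := by
    have h1 : ∀ k, ∑ q', x k q' * l k q' = (∑ q', if mach q' = mach q ∧ dl k q' ≤ dl j q then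
        (I.proc (mach q) k : ℝ) * x k q' else 0) / (C * u) := by
      intro k
      rw [Finset.sum_div]
      refine Finset.sum_congr rfl fun q' _ => ?_
      simp only [l]
      split_ifs <;> ring
    have h2 : a₀ * x j q ≤ ∑ q', if mach q' = mach q ∧ dl j q' ≤ dl j q then
        (I.proc (mach q) j : ℝ) * x j q' else 0 := by
      refine le_trans (le_of_eq ?_) (Finset.single_le_sum (fun q' _ => ?_) (Finset.mem_univ q))
      · simp [ha₀]
      · have := hx0 j q'
        split_ifs <;> positivity
    rw [fracLoad, ← Finset.add_sum_erase _ _ (Finset.mem_univ j)] at hcap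
    simp only [hμ, h1]
    rw [← Finset.sum_div]
    gcongr
    linarith
  have hμ1 : μ ≤ 1 := by
    refine hμle.trans ((div_le_one hCu).2 ?_)
    have := hx0 j q
    nlinarith [mul_nonneg ha0 this]
  have hmom := prodExp_sum_rpow_le hp hx0 hx1 l hl0 hl1 (Finset.univ.erase j) hμ1
  have hL : ∀ a : Fin n → Q, (∑ k ∈ Finset.univ.erase j,
      if mach (a k) = mach q ∧ dl k (a k) ≤ dl j q then (I.proc (mach q) k : ℝ) else 0) =
      (C * u) * ∑ k ∈ Finset.univ.erase j, l k (a k) := by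
    intro a
    rw [Finset.mul_sum]
    refine Finset.sum_congr rfl fun k _ => ?_
    simp only [l]
    split_ifs
    · field_simp
    · simp
  have hB := Real.rpow_le_rpow_of_exponent_le hu1 hp
  rw [Real.rpow_one] at hB
  have hup : 0 < u ^ p := by positivity
  have hCp : 0 < C ^ p := by positivity
  -- Since a₀ ≤ C, the ratio satisfies (a₀/C)^p ≤ a₀/C. Being linear in a₀, this bound can be set
  -- against the loss in the mean, which is also linear in a₀.
  have haP : a₀ ^ p ≤ C ^ p * (a₀ / C) := by
    have h1 : (a₀ / C) ^ p ≤ (a₀ / C) ^ (1 : ℝ) :=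
      Real.rpow_le_rpow_of_exponent_ge' (by positivity) ((div_le_one hC0).2 haC') zero_le_one hp
    rw [Real.rpow_one, Real.div_rpow ha0 hC0.le, div_le_iff₀ hCp] at h1
    linarith
  -- As C + v ≤ C u for C ≥ 1, the gap 1 - μ is at least (a₀/C) x / u, and u^p ≥ u recovers the lost
  -- factor.
  have hkey : (C * u) ^ p * (fractionalBell p - (1 - μ)) ≤
      C ^ p * (u ^ p * fractionalBell p - a₀ / C * x j q) := by
    rw [Real.mul_rpow hC0.le hu0.le, mul_assoc]
    refine mul_le_mul_of_nonneg_left ?_ hCp.le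
    have h1 : u ^ p * (1 - μ) ≥ u ^ p * (a₀ / C * x j q / u) := by
      refine mul_le_mul_of_nonneg_left ?_ hup.le
      have h3 : (C + v - a₀ * x j q) / (C * u) ≤ 1 - a₀ / C * x j q / u := by
        rw [div_le_iff₀ hCu]
        have : (1 - a₀ / C * x j q / u) * (C * u) = C * u - a₀ * x j q := by
          field_simp
        rw [this]
        nlinarith
      linarith
    have h2 : a₀ / C * x j q ≤ u ^ p * (a₀ / C * x j q / u) := by
      have : u ^ p * (a₀ / C * x j q / u) = (u ^ p / u) * (a₀ / C * x j q) := by ring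
      rw [this]
      have h4 : 1 ≤ u ^ p / u := (one_le_div hu0).2 hB
      have h5 : 0 ≤ a₀ / C * x j q := mul_nonneg (by positivity) (hx0 j q)
      nlinarith
    linarith
  calc prodExp x (fun a => (a₀ + ∑ k ∈ Finset.univ.erase j,
      if mach (a k) = mach q ∧ dl k (a k) ≤ dl j q then (I.proc (mach q) k : ℝ) else 0) ^ p)
      ≤ prodExp x (fun a => 2 ^ (p - 1) * (a₀ ^ p +
          (C * u) ^ p * (∑ k ∈ Finset.univ.erase j, l k (a k)) ^ p)) := by
        refine prodExp_mono hx0 fun a _ => ?_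
        have hS : 0 ≤ ∑ k ∈ Finset.univ.erase j, l k (a k) :=
          Finset.sum_nonneg fun k _ => hl0 _ _
        rw [hL, ← Real.mul_rpow hCu.le hS]
        exact add_rpow_le_two_rpow hp ha0 (by positivity)
    _ = 2 ^ (p - 1) * (a₀ ^ p + (C * u) ^ p *
          prodExp x (fun a => (∑ k ∈ Finset.univ.erase j, l k (a k)) ^ p)) := by
        rw [prodExp_const_mul, prodExp_add, prodExp_const hx1, prodExp_const_mul]
    _ ≤ 2 ^ (p - 1) * (C ^ p * (a₀ / C) + C ^ p * (u ^ p * fractionalBell p - a₀ / C * x j q)) := by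
        exact mul_le_mul_of_nonneg_left (add_le_add haP
          ((mul_le_mul_of_nonneg_left hmom (by positivity)).trans hkey)) (by positivity)
    _ ≤ _ := by
        rw [← mul_add]
        gcongr
        -- The own term and the slack combine to (a₀/C)(1 - x), which is largest when the job fills
        -- its whole deadline.
        have h1 : a₀ / C * (1 - x j q) ≤ 1 * (1 - x j q) :=
          mul_le_mul_of_nonneg_right ((div_le_one hC0).2 haC') (by linarith)
        linarith

/-- The expected cost of the rounded schedule, up to a violation `v` of the capacities. -/
theorem prodExp_cost_le (hp : 1 ≤ p) (hv : 0 ≤ v) (hx0 : ∀ j q, 0 ≤ x j q)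
    (hx1 : ∀ j, ∑ q, x j q = 1) (hdl : ∀ j q, x j q ≠ 0 → I.proc (mach q) j ≤ dl j q)
    (hcap : ∀ j q, x j q ≠ 0 → fracLoad I mach dl x (mach q) (dl j q) ≤ dl j q + v)
    (comp : (Fin n → Q) → Fin n → ℝ) (hcomp0 : ∀ a j, 0 ≤ comp a j)
    (hcomp : ∀ a j, comp a j ≤ (I.proc (mach (a j)) j : ℝ) + ∑ k ∈ Finset.univ.erase j,
      if mach (a k) = mach (a j) ∧ dl k (a k) ≤ dl j (a j) then (I.proc (mach (a j)) k : ℝ)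
      else 0) :
    prodExp x (fun a => ∑ j, I.weight j * comp a j ^ p) ≤
      2 ^ (p - 1) * ∑ j, ∑ q, x j q * (I.weight j * ((dl j q : ℝ) ^ p *
        ((1 + v) ^ p * fractionalBell p + 1 - x j q))) := by
  rw [prodExp_sum, Finset.mul_sum]
  refine Finset.sum_le_sum fun j _ => ?_
  have hp0 : 0 ≤ p := by linarith
  let g : (Fin n → Q) → ℝ := fun a => ((I.proc (mach (a j)) j : ℝ) + ∑ k ∈ Finset.univ.erase j,
      if mach (a k) = mach (a j) ∧ dl k (a k) ≤ dl j (a j) then (I.proc (mach (a j)) k : ℝ)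
      else 0) ^ p
  calc prodExp x (fun a => I.weight j * comp a j ^ p)
      ≤ prodExp x (fun a => I.weight j * g a) := by
        refine prodExp_mono hx0 fun a _ => ?_
        exact mul_le_mul_of_nonneg_left (Real.rpow_le_rpow (hcomp0 a j) (hcomp a j) hp0)
          (I.weight_nonneg j)
    _ = I.weight j * ∑ q, x j q * prodExp x (fun a => g (Function.update a j q)) := by
        rw [prodExp_const_mul, prodExp_resample j (hx1 j), prodExp_sum]
        simp only [prodExp_const_mul]
    _ ≤ I.weight j * ∑ q, x j q * (2 ^ (p - 1) * ((dl j q : ℝ) ^ p *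
          ((1 + v) ^ p * fractionalBell p + 1 - x j q))) := by
        refine mul_le_mul_of_nonneg_left (Finset.sum_le_sum fun q _ => ?_) (I.weight_nonneg j)
        by_cases hq : x j q = 0
        · simp [hq]
        refine mul_le_mul_of_nonneg_left ?_ (hx0 j q)
        refine le_trans (le_of_eq ?_)
          (prodExp_completion_le hp hv hx0 hx1 hdl j q hq (hcap j q hq))
        congr 1
        funext a
        simp only [g, Function.update_self]
        congr 2
        refine Finset.sum_congr rfl fun k hk => ?_
        rw [Function.update_of_ne (Finset.ne_of_mem_erase hk)]
    _ = _ := by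
        rw [Finset.mul_sum, Finset.mul_sum]
        exact Finset.sum_congr rfl fun q _ => by ring

end Rounding

namespace Instance

variable {n m : ℕ}

/-! ## Schedules without idle time and the linear program -/

/-- If j precedes k on one machine, then the predecessors of j together with j are among the
predecessors of k, so the start of k is at least the completion of j. -/
theorem feasible_of_order (I : Instance n m) (S : Schedule n m) (r : Fin n → Fin n → Prop)
    [DecidableRel r] (htrans : ∀ i j k, r i j → r j k → r i k) (hirr : ∀ j, ¬ r j j)
    (htri : ∀ j k, j ≠ k → r j k ∨ r k j)
    (hS : ∀ j, S.start j = ∑ k, if S.machine k = S.machine j ∧ r k j then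
      (I.proc (S.machine k) k : ℝ) else 0) : I.Feasible S := by
  have key : ∀ j k, S.machine j = S.machine k → r j k → I.completion S j ≤ S.start k := by
    intro j k hm hr
    have h1 : I.duration S j = ∑ l, if l = j then (I.proc (S.machine l) l : ℝ) else 0 := by
      simp [duration]
    rw [completion, h1, hS j, hS k, ← Finset.sum_add_distrib]
    refine Finset.sum_le_sum fun l _ => ?_
    by_cases hl : l = j
    · subst hl
      simp [hirr, hm, hr]
    · by_cases h2 : S.machine l = S.machine j ∧ r l j
      · have h3 : S.machine l = S.machine k ∧ r l k := ⟨h2.1.trans hm, htrans _ _ _ h2.2 hr⟩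
        rw [if_pos h2, if_neg hl, if_pos h3, add_zero]
      · simp only [hl, h2, if_false, add_zero]
        split_ifs <;> positivity
  refine ⟨fun j => ?_, fun j k hjk hm => ?_⟩
  · rw [hS]
    exact Finset.sum_nonneg fun k _ => by split_ifs <;> positivity
  · rcases htri j k hjk with h | h
    · exact Or.inl (key j k hm h)
    · exact Or.inr (key k j hm.symm h)

/-- Jobs on one machine that are completed by time `B` have total processing time at most `B`. -/
theorem sum_proc_le_of_feasible {I : Instance n m} {S : Schedule n m} (hS : I.Feasible S)
    (i : Fin m) (s : Finset (Fin n)) (B : ℝ) (hB : 0 ≤ B) (hi : ∀ k ∈ s, S.machine k = i)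
    (hs : ∀ k ∈ s, I.completion S k ≤ B) : ∑ k ∈ s, (I.proc i k : ℝ) ≤ B := by
  -- Induct on the job that is completed last: the others end before it starts. Zero-length jobs are
  -- excluded since such a job may start exactly when the last one ends; they contribute nothing to
  -- the sum anyway.
  have main : ∀ s : Finset (Fin n), (∀ k ∈ s, S.machine k = i ∧ 0 < I.proc i k) →
      ∀ B : ℝ, 0 ≤ B → (∀ k ∈ s, I.completion S k ≤ B) → ∑ k ∈ s, (I.proc i k : ℝ) ≤ B := by
    intro s
    induction s using Finset.induction_on_max_value (fun k => I.completion S k) with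
    | empty => intro _ B hB _; simpa using hB
    | insert j s hj hmax ih =>
      intro hs B _ hcomp
      rw [Finset.sum_insert hj]
      have hjs := hs j (Finset.mem_insert_self _ _)
      have h1 := ih (fun k hk => hs k (Finset.mem_insert_of_mem hk)) (S.start j) (hS.1 j)
        (fun k hk => by
          have hks := hs k (Finset.mem_insert_of_mem hk)
          have hne : k ≠ j := ne_of_mem_of_not_mem hk hj
          rcases hS.2 k j hne (hks.1.trans hjs.1.symm) with h | h
          · exact h
          · have h2 := hmax k hk
            have h3 : I.completion S k = S.start k + I.proc i k := by
              rw [completion, duration, hks.1]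
            have h4 : (0 : ℝ) < I.proc i k := Nat.cast_pos.2 hks.2
            linarith)
      have h2 := hcomp j (Finset.mem_insert_self _ _)
      rw [completion, duration, hjs.1] at h2
      linarith
  have h := main (s.filter fun k => 0 < I.proc i k) (fun k hk => by
    rw [Finset.mem_filter] at hk; exact ⟨hi k hk.1, hk.2⟩) B hB
    (fun k hk => hs k (Finset.mem_filter.1 hk).1)
  rw [Finset.sum_filter] at h
  refine le_trans (le_of_eq (Finset.sum_congr rfl fun k _ => ?_)) h
  split_ifs with h0
  · rfl
  · simp [Nat.eq_zero_of_not_pos h0]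

theorem completion_nonneg {I : Instance n m} {S : Schedule n m} (hS : I.Feasible S) (j : Fin n) :
    0 ≤ I.completion S j :=
  add_nonneg (hS.1 j) (Nat.cast_nonneg _)

theorem sum_proc_le_horizon (I : Instance n m) (mach : Fin n → Fin m) :
    ∑ j, I.proc (mach j) j ≤ I.horizon := by
  rw [horizon, Finset.sum_comm]
  exact Finset.sum_le_sum fun j _ =>
    Finset.single_le_sum (f := fun i => I.proc i j) (fun _ _ => Nat.zero_le _) (Finset.mem_univ _)

theorem cost_nonneg {I : Instance n m} {S : Schedule n m} (hS : I.Feasible S) (p : ℝ) :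
    0 ≤ I.cost p S :=
  Finset.sum_nonneg fun j _ => mul_nonneg (I.weight_nonneg j)
    (Real.rpow_nonneg (completion_nonneg hS j) p)

theorem exists_feasible [NeZero m] (I : Instance n m) : ∃ S : Schedule n m, I.Feasible S := by
  refine ⟨⟨fun _ => 0, fun j => ∑ k, if (0 : Fin m) = 0 ∧ k < j then (I.proc 0 k : ℝ) else 0⟩,
    I.feasible_of_order _ (fun k j => k < j) (fun _ _ _ => lt_trans) (fun _ => lt_irrefl _)
      (fun j k h => lt_or_gt_of_ne h) fun j => rfl⟩

/-- Every feasible schedule gives an integral point of the linear program that costs no more. -/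
theorem exists_lpFeasible_le {I : Instance n m} {S : Schedule n m} (hS : I.Feasible S)
    {p : ℝ} (hp : 0 ≤ p) : ∃ y : I.Point, I.LPFeasible y ∧ I.lpCost p y ≤ I.cost p S := by
  classical
  -- Left-justify S in the order of its completion times. The new starts are sums of processing
  -- times, hence integers within the horizon, and no job is delayed because the jobs completed by
  -- time B on a machine have total length at most B.
  let r : Fin n → Fin n → Prop := fun k j =>
    I.completion S k < I.completion S j ∨ (I.completion S k = I.completion S j ∧ k < j)
  let st : Fin n → ℕ := fun j => ∑ k, if S.machine k = S.machine j ∧ r k j then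
    I.proc (S.machine k) k else 0
  let S' : Schedule n m := ⟨S.machine, fun j => (st j : ℝ)⟩
  have hirr : ∀ j, ¬ r j j := fun j h => by
    rcases h with h | h
    · exact lt_irrefl _ h
    · exact lt_irrefl _ h.2
  have hS' : I.Feasible S' := by
    refine I.feasible_of_order S' r (fun i j k h1 h2 => ?_) hirr
      (fun j k h => ?_) (fun j => by simp [S', st])
    · rcases h1 with h1 | h1 <;> rcases h2 with h2 | h2
      · exact Or.inl (h1.trans h2)
      · exact Or.inl (h2.1 ▸ h1)
      · exact Or.inl (h1.1 ▸ h2)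
      · exact Or.inr ⟨h1.1.trans h2.1, h1.2.trans h2.2⟩
    · rcases lt_trichotomy (I.completion S j) (I.completion S k) with h1 | h1 | h1
      · exact Or.inl (Or.inl h1)
      · rcases lt_or_gt_of_ne h with h2 | h2
        · exact Or.inl (Or.inr ⟨h1, h2⟩)
        · exact Or.inr (Or.inr ⟨h1.symm, h2⟩)
      · exact Or.inr (Or.inl h1)
  have hst : ∀ j, st j + I.proc (S.machine j) j =
      ∑ k ∈ insert j (Finset.univ.filter fun k => S.machine k = S.machine j ∧ r k j),
        I.proc (S.machine k) k := by
    intro j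
    rw [Finset.sum_insert (by simp [hirr]), Finset.sum_filter, add_comm]
  have hle : ∀ j, ((st j : ℝ) + I.proc (S.machine j) j) ≤ I.completion S j := by
    intro j
    have hmem : ∀ k ∈ insert j (Finset.univ.filter fun k => S.machine k = S.machine j ∧ r k j),
        S.machine k = S.machine j ∧ I.completion S k ≤ I.completion S j := by
      intro k hk
      rcases Finset.mem_insert.1 hk with rfl | hk
      · exact ⟨rfl, le_rfl⟩
      · obtain ⟨h1, h2⟩ := (Finset.mem_filter.1 hk).2
        exact ⟨h1, h2.elim le_of_lt fun h => h.1.le⟩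
    have h := sum_proc_le_of_feasible hS (S.machine j) _ (I.completion S j)
      (completion_nonneg hS j) (fun k hk => (hmem k hk).1) (fun k hk => (hmem k hk).2)
    refine le_trans (le_of_eq ?_) h
    rw [← Nat.cast_add, hst, Nat.cast_sum]
    exact Finset.sum_congr rfl fun k hk => by rw [(hmem k hk).1]
  have hT : ∀ j, st j < I.horizon + 1 := by
    intro j
    have h1 : st j + I.proc (S.machine j) j ≤ I.horizon := by
      rw [hst]
      exact (Finset.sum_le_sum_of_subset (Finset.subset_univ _)).trans (I.sum_proc_le_horizon _)
    omega
  let y : I.Point := fun i j t => if i = S.machine j ∧ t = ⟨st j, hT j⟩ then 1 else 0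
  have hsum : ∀ (f : Fin m → Fin n → Fin (I.horizon + 1) → ℝ) j,
      ∑ i, ∑ t, f i j t * y i j t = f (S.machine j) j ⟨st j, hT j⟩ := by
    intro f j
    rw [Finset.sum_eq_single (S.machine j), Finset.sum_eq_single ⟨st j, hT j⟩]
    · simp [y]
    · intro t _ ht; simp [y, ht]
    · simp
    · intro i _ hi; simp [y, hi]
    · simp
  refine ⟨y, ⟨fun j => ?_, fun i t => ?_, fun i j t => ?_⟩, ?_⟩
  · simpa using hsum (fun _ _ _ => 1) j
  · have h1 : ∀ j, (∑ τ : Fin (I.horizon + 1),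
        if (τ : ℕ) ≤ t ∧ t < (τ : ℕ) + I.proc i j then y i j τ else 0) =
        if S.machine j = i ∧ st j ≤ t ∧ t < st j + I.proc i j then 1 else 0 := by
      intro j
      rw [Finset.sum_eq_single ⟨st j, hT j⟩]
      · simp only [y, eq_comm (a := i)]
        by_cases h : S.machine j = i <;> simp [h]
      · intro τ _ hτ; simp [y, hτ]
      · simp
    simp only [h1]
    rw [Finset.sum_boole]
    norm_cast
    refine Finset.card_le_one.2 fun j hj k hk => ?_
    simp only [Finset.mem_filter, Finset.mem_univ, true_and] at hj hk
    by_contra hne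
    have h2 : ∀ l, S.machine l = i → I.completion S' l = ((st l + I.proc i l : ℕ) : ℝ) := by
      intro l hl
      simp [completion, duration, S', hl]
    rcases hS'.2 j k hne (hj.1.trans hk.1.symm) with h | h
    · rw [h2 j hj.1] at h
      have : st j + I.proc i j ≤ st k := Nat.cast_le (α := ℝ) |>.1 h
      omega
    · rw [h2 k hk.1] at h
      have : st k + I.proc i k ≤ st j := Nat.cast_le (α := ℝ) |>.1 h
      omega
  · simp only [y]; split_ifs <;> norm_num
  · rw [lpCost, Finset.sum_comm, cost]
    refine Finset.sum_le_sum fun j _ => ?_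
    rw [hsum (fun i j t => I.weight j * ((t : ℝ) + (I.proc i j : ℝ)) ^ p)]
    exact mul_le_mul_of_nonneg_left (Real.rpow_le_rpow (by positivity) (hle j) hp)
      (I.weight_nonneg j)

theorem exists_lpOptimal [NeZero m] (I : Instance n m) {p : ℝ} (hp : 0 ≤ p) :
    ∃ x : I.Point, I.LPOptimal p x := by
  obtain ⟨S, hS⟩ := I.exists_feasible
  obtain ⟨y, hy, -⟩ := exists_lpFeasible_le hS hp
  have hsub : {x : I.Point | I.LPFeasible x} ⊆ Set.Icc 0 1 := by
    intro x hx
    refine ⟨fun i j t => hx.2.2 i j t, fun i j t => ?_⟩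
    have h1 := hx.1 j
    have h2 : x i j t ≤ ∑ t, x i j t :=
      Finset.single_le_sum (fun t _ => hx.2.2 i j t) (Finset.mem_univ t)
    have h3 : ∑ t, x i j t ≤ ∑ i, ∑ t, x i j t :=
      Finset.single_le_sum (f := fun i => ∑ t, x i j t)
        (fun i _ => Finset.sum_nonneg fun t _ => hx.2.2 i j t) (Finset.mem_univ i)
    simp only [Pi.one_apply]
    linarith
  have hclosed : IsClosed {x : I.Point | I.LPFeasible x} := by
    refine IsClosed.and ?_ (IsClosed.and ?_ ?_)
    · simp only [Set.ofPred_forall]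
      exact isClosed_iInter fun j => isClosed_eq (by fun_prop) continuous_const
    · simp only [Set.ofPred_forall]
      refine isClosed_iInter fun i => isClosed_iInter fun t => isClosed_le ?_ continuous_const
      refine continuous_finsetSum _ fun j _ => continuous_finsetSum _ fun τ _ => ?_
      split_ifs <;> fun_prop
    · simp only [Set.ofPred_forall]
      exact isClosed_iInter fun i => isClosed_iInter fun j => isClosed_iInter fun t =>
        isClosed_le continuous_const (by fun_prop)
  have hcomp : IsCompact {x : I.Point | I.LPFeasible x} :=
    isCompact_Icc.of_isClosed_subset hclosed hsub
  have hcont : Continuous fun x : I.Point => I.lpCost p x := by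
    unfold lpCost
    fun_prop
  obtain ⟨x, hx, hmin⟩ := hcomp.exists_isMinOn ⟨y, hy⟩ hcont.continuousOn
  exact ⟨x, hx, fun z hz => hmin hz⟩

theorem precedes_trans (I : Instance n m) (tie : Equiv.Perm (Fin n)) (a : I.Tentative)
    (i j k : Fin n) (h1 : I.Precedes tie a i j) (h2 : I.Precedes tie a j k) :
    I.Precedes tie a i k := by
  unfold Precedes at *
  omega

theorem not_precedes_self (I : Instance n m) (tie : Equiv.Perm (Fin n)) (a : I.Tentative)
    (j : Fin n) : ¬ I.Precedes tie a j j := by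
  simp [Precedes]

theorem precedes_or_precedes (I : Instance n m) (tie : Equiv.Perm (Fin n)) (a : I.Tentative)
    (j k : Fin n) (h : j ≠ k) : I.Precedes tie a j k ∨ I.Precedes tie a k j := by
  have h1 : tie j ≠ tie k := fun h2 => h (tie.injective h2)
  unfold Precedes
  omega

theorem feasible_listSchedule (I : Instance n m) (tie : Equiv.Perm (Fin n)) (a : I.Tentative) :
    I.Feasible (I.listSchedule tie a) := by
  classical
  refine I.feasible_of_order _ (I.Precedes tie a) (I.precedes_trans tie a)
    (I.not_precedes_self tie a) (I.precedes_or_precedes tie a) fun j => ?_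
  simp only [listSchedule]
  exact Finset.sum_congr rfl fun k _ => by congr

/-- Add up the capacity constraints for the times below C. A job that starts at t and ends by C
occupies exactly `proc` of these times, so its variable is counted that often. No other use of the
capacity constraints is made. -/
theorem fracLoad_le_of_lpFeasible {I : Instance n m} {x : I.Point} (hx : I.LPFeasible x)
    (i : Fin m) (C : ℕ) :
    fracLoad I (Prod.fst : Fin m × Fin (I.horizon + 1) → Fin m)
      (fun j q => (q.2 : ℕ) + I.proc q.1 j) (fun j q => x q.1 j q.2) i C ≤ C := by
  have h1 : ∑ τ ∈ Finset.range C, (∑ j, ∑ t : Fin (I.horizon + 1),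
      (if (t : ℕ) ≤ τ ∧ τ < (t : ℕ) + I.proc i j then x i j t else 0)) ≤
      ∑ _τ ∈ Finset.range C, (1 : ℝ) := Finset.sum_le_sum fun τ _ => hx.2.1 i τ
  simp only [Finset.sum_const, Finset.card_range, nsmul_eq_mul, mul_one] at h1
  refine le_trans ?_ h1
  rw [fracLoad]
  conv_rhs => rw [Finset.sum_comm]
  refine Finset.sum_le_sum fun k _ => ?_
  conv_rhs => rw [Finset.sum_comm]
  rw [Fintype.sum_prod_type, Finset.sum_eq_single i]
  · refine Finset.sum_le_sum fun t _ => ?_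
    have hnn := hx.2.2 i k t
    by_cases h : (t : ℕ) + I.proc i k ≤ C
    · simp only [h, and_self, if_true]
      rw [← Finset.sum_filter, Finset.sum_const, nsmul_eq_mul]
      refine mul_le_mul_of_nonneg_right (Nat.cast_le.2 ?_) hnn
      calc I.proc i k = (Finset.Ico (t : ℕ) (t + I.proc i k)).card := by simp
        _ ≤ _ := Finset.card_le_card fun τ hτ => by
          rw [Finset.mem_Ico] at hτ
          rw [Finset.mem_filter, Finset.mem_range]
          omega
    · simp only [h, and_false, if_false]
      exact Finset.sum_nonneg fun τ _ => by split_ifs <;> simp [hnn]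
  · intro i' _ hi'
    simp [hi']
  · simp

/-- The rounding bound with tentative completion times as deadlines and with no violation, v = 0. A
job that precedes j has a deadline no later than that of j, whatever the tie-breaking. -/
theorem roundingExpectedCost_le {I : Instance n m} {p : ℝ} (hp : 1 ≤ p) {x : I.Point}
    (hx : I.LPFeasible x) (tie : Equiv.Perm (Fin n)) :
    I.roundingExpectedCost p tie x ≤ 2 ^ p * fractionalBell p * I.lpCost p x := by
  classical
  let Q := Fin m × Fin (I.horizon + 1)
  let z : Fin n → Q → ℝ := fun j q => x q.1 j q.2
  have hz0 : ∀ j q, 0 ≤ z j q := fun j q => hx.2.2 _ _ _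
  have hz1 : ∀ j, ∑ q, z j q = 1 := fun j => by
    rw [← hx.1 j, Fintype.sum_prod_type]
  have h := prodExp_cost_le (I := I) (mach := (Prod.fst : Q → Fin m))
    (dl := fun j q => (q.2 : ℕ) + I.proc q.1 j) (x := z) hp le_rfl hz0 hz1
    (fun j q _ => Nat.le_add_left _ _)
    (fun j q _ => by rw [add_zero]; exact fracLoad_le_of_lpFeasible hx _ _)
    (fun a j => I.completion (I.listSchedule tie a) j)
    (fun a j => completion_nonneg (I.feasible_listSchedule tie a) j)
    (fun a j => by
      rw [completion, duration, add_comm]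
      simp only [listSchedule]
      gcongr
      rw [← Finset.add_sum_erase _ _ (Finset.mem_univ j),
        if_neg (fun h => I.not_precedes_self tie a j h.2), zero_add]
      refine Finset.sum_le_sum fun k _ => ?_
      split_ifs with h1 h2 h2
      · rw [h1.1]
      · refine absurd ⟨h1.1, ?_⟩ h2
        have h3 := h1.2
        unfold Precedes tentativeCompletion at h3
        omega
      · positivity
      · exact le_rfl)
  refine le_trans h ?_
  have hA := one_le_fractionalBell hp
  have e2 : (2 : ℝ) ^ p = 2 ^ (p - 1) * 2 := by
    rw [Real.rpow_sub_one two_ne_zero]; ring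
  rw [e2, mul_assoc (2 ^ (p - 1)), mul_assoc (2 ^ (p - 1))]
  refine mul_le_mul_of_nonneg_left ?_ (by positivity)
  rw [lpCost]
  conv_rhs => rw [Finset.sum_comm]
  rw [Finset.mul_sum]
  refine Finset.sum_le_sum fun j _ => ?_
  rw [← Fintype.sum_prod_type' (f := fun i (t : Fin (I.horizon + 1)) =>
    I.weight j * ((t : ℝ) + (I.proc i j : ℝ)) ^ p * x i j t), Finset.mul_sum]
  refine Finset.sum_le_sum fun q _ => ?_
  have hq := hz0 j q
  have hw := I.weight_nonneg j
  rw [add_zero, Real.one_rpow, one_mul]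
  push_cast
  have hc : 0 ≤ z j q * (I.weight j * ((q.2 : ℝ) + I.proc q.1 j) ^ p) := by positivity
  calc z j q * (I.weight j * (((q.2 : ℝ) + I.proc q.1 j) ^ p *
        (fractionalBell p + 1 - z j q)))
      = (z j q * (I.weight j * ((q.2 : ℝ) + I.proc q.1 j) ^ p)) *
        (fractionalBell p + 1 - z j q) := by ring
    -- Here the slack is discarded: A + 1 - z ≤ 2A because z ≥ 0 and A ≥ 1.
    _ ≤ (z j q * (I.weight j * ((q.2 : ℝ) + I.proc q.1 j) ^ p)) * (2 * fractionalBell p) :=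
        mul_le_mul_of_nonneg_left (by linarith) hc
    _ = _ := by simp only [z]; ring

end Instance

/-! ## A conditional gradient method for the deadline relaxation

In the deadline relaxation every job chooses a machine and a deadline, and on every machine the
jobs with deadline at most `C` have total processing time at most `C`. The capacity constraints are
replaced by a quadratic penalty. -/

namespace Instance

variable {n m : ℕ}

/-- The size `n + m + T + 2` of an instance, an upper bound for all deadlines. -/
def size (I : Instance n m) : ℕ := n + m + I.horizon + 2

/-- A machine and a deadline. -/
abbrev Choice (I : Instance n m) : Type := Fin m × Fin I.size

/-- The load of the jobs with deadline at most `C` on machine `i`. -/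
def load (I : Instance n m) (x : Fin n → I.Choice → ℝ) (i : Fin m) (C : ℕ) : ℝ :=
  fracLoad I (Q := I.Choice) Prod.fst (fun _ q => (q.2 : ℕ)) x i C

/-- The integral point of the assignment `u`. -/
def point (I : Instance n m) (u : Fin n → I.Choice) (j : Fin n) (q : I.Choice) : ℝ :=
  if q = u j then 1 else 0

/-- The cost of the deadlines. -/
def linCost (I : Instance n m) (p : ℝ) (x : Fin n → I.Choice → ℝ) : ℝ :=
  ∑ j, ∑ q, x j q * (I.weight j * ((q.2 : ℕ) : ℝ) ^ p)

/-- The excess of a load over the capacity. -/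
def excess (L : Fin m → ℕ → ℝ) (i : Fin m) (C : ℕ) : ℝ := max 0 (L i C - C)

/-- The quadratic penalty for violated capacities. -/
def penalty (I : Instance n m) (L : Fin m → ℕ → ℝ) : ℝ :=
  ∑ i, ∑ C ∈ Finset.range I.size, excess L i C ^ 2

/-- The partial derivative of the penalized cost. -/
def gradient (I : Instance n m) (p M : ℝ) (L : Fin m → ℕ → ℝ) (j : Fin n) (q : I.Choice) : ℝ :=
  I.weight j * ((q.2 : ℕ) : ℝ) ^ p + 2 * M * (I.proc q.1 j *
    ∑ C ∈ Finset.range I.size, if (q.2 : ℕ) ≤ C then excess L q.1 C else 0)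

/-- The choice `q` leaves enough time for job `j`. -/
def Admissible (I : Instance n m) (j : Fin n) (q : I.Choice) : Prop := I.proc q.1 j ≤ q.2

/-- The point `x` moved by `γ` towards the assignment `u`. -/
def mix (I : Instance n m) (γ : ℝ) (x : Fin n → I.Choice → ℝ) (u : Fin n → I.Choice) :
    Fin n → I.Choice → ℝ :=
  fun j q => (1 - γ) * x j q + γ * I.point u j q

variable {I : Instance n m}

/-! ### Loads, gradients and a single conditional gradient step -/

theorem load_mix (γ : ℝ) (x : Fin n → I.Choice → ℝ) (u : Fin n → I.Choice) (i : Fin m) (C : ℕ) :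
    I.load (I.mix γ x u) i C = (1 - γ) * I.load x i C + γ * I.load (I.point u) i C := by
  simp only [load, fracLoad, Finset.mul_sum, ← Finset.sum_add_distrib, mix]
  refine Finset.sum_congr rfl fun k _ => Finset.sum_congr rfl fun q _ => ?_
  split_ifs <;> ring

theorem linCost_mix (p γ : ℝ) (x : Fin n → I.Choice → ℝ) (u : Fin n → I.Choice) :
    I.linCost p (I.mix γ x u) = (1 - γ) * I.linCost p x + γ * I.linCost p (I.point u) := by
  simp only [linCost, Finset.mul_sum, ← Finset.sum_add_distrib, mix]
  exact Finset.sum_congr rfl fun k _ => Finset.sum_congr rfl fun q _ => by ring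

theorem load_point (u : Fin n → I.Choice) (i : Fin m) (C : ℕ) :
    I.load (I.point u) i C =
      ∑ j, if (u j).1 = i ∧ ((u j).2 : ℕ) ≤ C then (I.proc i j : ℝ) else 0 := by
  rw [load, fracLoad]
  refine Finset.sum_congr rfl fun j _ => ?_
  rw [Finset.sum_eq_single (u j)]
  · simp [point]
  · intro q _ hq; simp [point, hq]
  · simp

theorem linCost_point (p : ℝ) (u : Fin n → I.Choice) :
    I.linCost p (I.point u) = ∑ j, I.weight j * (((u j).2 : ℕ) : ℝ) ^ p := by
  refine Finset.sum_congr rfl fun j _ => ?_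
  rw [Finset.sum_eq_single (u j)]
  · simp [point]
  · intro q _ hq; simp [point, hq]
  · simp

/-- The gradient is separable over the jobs, so its pairing with an integral point is a sum of one
entry per job; exchanging the sums over jobs and over pairs (i, C) rewrites the penalty part in
terms of loads. -/
theorem sum_gradient (p M : ℝ) (L : Fin m → ℕ → ℝ) (u : Fin n → I.Choice) :
    ∑ j, I.gradient p M L j (u j) = I.linCost p (I.point u) +
      2 * M * ∑ i, ∑ C ∈ Finset.range I.size, excess L i C * I.load (I.point u) i C := by
  have h : ∑ i, ∑ C ∈ Finset.range I.size, excess L i C * I.load (I.point u) i C =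
      ∑ j, (I.proc (u j).1 j : ℝ) * ∑ C ∈ Finset.range I.size,
        if ((u j).2 : ℕ) ≤ C then excess L (u j).1 C else 0 := by
    simp only [load_point, Finset.mul_sum]
    have : ∀ i, ∑ C ∈ Finset.range I.size, ∑ j, excess L i C *
        (if (u j).1 = i ∧ ((u j).2 : ℕ) ≤ C then (I.proc i j : ℝ) else 0) =
        ∑ j, ∑ C ∈ Finset.range I.size, excess L i C *
        (if (u j).1 = i ∧ ((u j).2 : ℕ) ≤ C then (I.proc i j : ℝ) else 0) := fun i =>
      Finset.sum_comm
    simp only [this]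
    rw [Finset.sum_comm]
    refine Finset.sum_congr rfl fun j _ => ?_
    rw [Finset.sum_eq_single (u j).1]
    · refine Finset.sum_congr rfl fun C _ => ?_
      by_cases hC : ((u j).2 : ℕ) ≤ C <;> simp [hC, mul_comm]
    · intro i _ hi
      simp [hi.symm]
    · simp
  rw [h, linCost_point, Finset.mul_sum, ← Finset.sum_add_distrib]
  rfl

theorem excess_nonneg (L : Fin m → ℕ → ℝ) (i : Fin m) (C : ℕ) : 0 ≤ excess L i C :=
  le_max_left _ _

/-- The smoothness of the penalty: the squared positive part lies below its first-order expansion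
plus e². This follows from max(0, t + e) ≤ |max(0, t) + e|. -/
theorem sq_max_add_le (t e : ℝ) : max 0 (t + e) ^ 2 ≤ max 0 t ^ 2 + 2 * max 0 t * e + e ^ 2 := by
  have h1 : max 0 (t + e) ≤ |max 0 t + e| := by
    refine max_le (abs_nonneg _) ((add_le_add_left (le_max_right 0 t) e).trans (le_abs_self _))
  calc max 0 (t + e) ^ 2 ≤ |max 0 t + e| ^ 2 := by
        gcongr
    _ = _ := by rw [sq_abs]; ring

/-- The gain of one step of the conditional gradient method. -/
theorem conditional_gradient_step {p M γ : ℝ} (hM : 0 ≤ M) (hγ0 : 0 ≤ γ)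
    {x : Fin n → I.Choice → ℝ} {u b : Fin n → I.Choice}
    (hu : ∀ j q, I.Admissible j q →
      I.gradient p M (I.load x) j (u j) ≤ I.gradient p M (I.load x) j q)
    (hb : ∀ j, I.Admissible j (b j))
    (hbC : ∀ i C, C < I.size → I.load (I.point b) i C ≤ C)
    (hdiff : ∀ i C, |I.load (I.point u) i C - I.load x i C| ≤ I.size) :
    I.linCost p (I.mix γ x u) + M * I.penalty (I.load (I.mix γ x u)) ≤
      (1 - γ) * (I.linCost p x + M * I.penalty (I.load x)) + γ * I.linCost p (I.point b) +
        γ ^ 2 * (M * (I.size : ℝ) ^ 4) := by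
  set L := I.load x with hL
  set D := ∑ i, ∑ C ∈ Finset.range I.size, excess L i C * (I.load (I.point u) i C - C) with hD
  -- Since excess times (L - C) equals the squared excess, the first-order term splits into 2γD and
  -- -2γ times the penalty.
  have hpen : I.penalty (I.load (I.mix γ x u)) ≤
      (1 - 2 * γ) * I.penalty L + 2 * γ * D + γ ^ 2 * (I.size : ℝ) ^ 4 := by
    have hterm : ∀ i, ∀ C ∈ Finset.range I.size, excess (I.load (I.mix γ x u)) i C ^ 2 ≤
        (1 - 2 * γ) * excess L i C ^ 2 + 2 * γ * (excess L i C * (I.load (I.point u) i C - C)) +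
          γ ^ 2 * (I.size : ℝ) ^ 2 := by
      intro i C _
      have h1 := sq_max_add_le (L i C - C) (γ * (I.load (I.point u) i C - L i C))
      have h2 : max 0 (L i C - C) * (L i C - C) = max 0 (L i C - C) ^ 2 := by
        rcases le_total 0 (L i C - C) with h | h
        · rw [max_eq_right h]; ring
        · rw [max_eq_left h]; ring
      have h3 : (I.load (I.point u) i C - L i C) ^ 2 ≤ (I.size : ℝ) ^ 2 := by
        rw [← sq_abs]
        exact pow_le_pow_left₀ (abs_nonneg _) (hdiff i C) 2
      have h4 := mul_le_mul_of_nonneg_left h3 (sq_nonneg γ)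
      unfold excess
      rw [load_mix, show (1 - γ) * L i C + γ * I.load (I.point u) i C - C =
        (L i C - C) + γ * (I.load (I.point u) i C - L i C) by ring]
      have h5 : 2 * max 0 (L i C - C) * (γ * (I.load (I.point u) i C - L i C)) =
          2 * γ * (max 0 (L i C - C) * (I.load (I.point u) i C - C)) -
            2 * γ * (max 0 (L i C - C) * (L i C - C)) := by ring
      rw [h5, h2] at h1
      nlinarith
    -- There are at most size² pairs (i, C), and each second-order term is at most (γ size)²; hence
    -- the fourth power.
    have hcard : (m : ℝ) * (I.size * (γ ^ 2 * (I.size : ℝ) ^ 2)) ≤ γ ^ 2 * (I.size : ℝ) ^ 4 := by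
      have h1 : (m : ℝ) ≤ I.size := by
        have : m ≤ I.size := by unfold size; omega
        exact_mod_cast this
      calc (m : ℝ) * (I.size * (γ ^ 2 * (I.size : ℝ) ^ 2))
          ≤ I.size * (I.size * (γ ^ 2 * (I.size : ℝ) ^ 2)) :=
            mul_le_mul_of_nonneg_right h1 (by positivity)
        _ = _ := by ring
    calc I.penalty (I.load (I.mix γ x u))
        ≤ ∑ i, ∑ C ∈ Finset.range I.size, ((1 - 2 * γ) * excess L i C ^ 2 +
          2 * γ * (excess L i C * (I.load (I.point u) i C - C)) + γ ^ 2 * (I.size : ℝ) ^ 2) :=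
          Finset.sum_le_sum fun i _ => Finset.sum_le_sum (hterm i)
      _ = (1 - 2 * γ) * I.penalty L + 2 * γ * D + m * (I.size * (γ ^ 2 * (I.size : ℝ) ^ 2)) := by
          simp only [Finset.sum_add_distrib, ← Finset.mul_sum, penalty, hD]
          simp
          ring
      _ ≤ _ := by linarith
  -- The choices u minimize the gradient over all admissible choices, in particular against b, whose
  -- loads do not exceed C.
  have hopt : I.linCost p (I.point u) + 2 * M * D ≤ I.linCost p (I.point b) := by
    have h1 : ∑ j, I.gradient p M L j (u j) ≤ ∑ j, I.gradient p M L j (b j) :=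
      Finset.sum_le_sum fun j _ => hu j (b j) (hb j)
    rw [sum_gradient, sum_gradient] at h1
    have h2 : ∑ i, ∑ C ∈ Finset.range I.size, excess L i C * I.load (I.point b) i C ≤
        ∑ i, ∑ C ∈ Finset.range I.size, excess L i C * (C : ℝ) :=
      Finset.sum_le_sum fun i _ => Finset.sum_le_sum fun C hC =>
        mul_le_mul_of_nonneg_left (hbC i C (Finset.mem_range.1 hC)) (excess_nonneg L i C)
    have h3 : D = ∑ i, ∑ C ∈ Finset.range I.size, excess L i C * I.load (I.point u) i C -
        ∑ i, ∑ C ∈ Finset.range I.size, excess L i C * (C : ℝ) := by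
      simp only [hD, mul_sub, Finset.sum_sub_distrib]
    have h4 := mul_le_mul_of_nonneg_left h2 (show 0 ≤ 2 * M by positivity)
    rw [h3, mul_sub]
    linarith
  have hpn : 0 ≤ I.penalty L :=
    Finset.sum_nonneg fun i _ => Finset.sum_nonneg fun C _ => sq_nonneg _
  -- The penalty has shrunk by the factor 1 - 2γ; weakening this to 1 - γ leaves a nonnegative
  -- remainder and matches the factor of the linear cost.
  rw [linCost_mix]
  have h1 := mul_le_mul_of_nonneg_left hpen hM
  have h2 := mul_le_mul_of_nonneg_left hopt hγ0
  have h3 : 0 ≤ γ * (M * I.penalty L) := by positivity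
  nlinarith

/-! ### The iterates -/

/-- The step lengths. -/
def stepLength (k : ℕ) : ℝ := 2 / ((k : ℝ) + 2)

theorem stepLength_nonneg (k : ℕ) : 0 ≤ stepLength k := by unfold stepLength; positivity

theorem stepLength_le_one (k : ℕ) : stepLength k ≤ 1 := by
  unfold stepLength
  rw [div_le_one (by positivity)]
  have : (0 : ℝ) ≤ k := by positivity
  linarith

theorem stepLength_zero : stepLength 0 = 1 := by simp [stepLength]

/-- The iterates that start at `x` and move towards `u 0`, `u 1`, …. -/
def iterate (I : Instance n m) (x : Fin n → I.Choice → ℝ) (u : ℕ → Fin n → I.Choice) :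
    ℕ → Fin n → I.Choice → ℝ
  | 0 => x
  | k + 1 => I.mix (stepLength k) (iterate I x u k) (u k)

theorem iterate_congr (x : Fin n → I.Choice → ℝ) {u u' : ℕ → Fin n → I.Choice} (k : ℕ)
    (h : ∀ l < k, u l = u' l) : I.iterate x u k = I.iterate x u' k := by
  induction k with
  | zero => rfl
  | succ k ih =>
    simp only [iterate]
    rw [ih fun l hl => h l (by omega), h k (by omega)]

/-- The first step forgets the starting point. -/
theorem iterate_succ_eq (x y : Fin n → I.Choice → ℝ) (u : ℕ → Fin n → I.Choice) (k : ℕ) :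
    I.iterate x u (k + 1) = I.iterate y u (k + 1) := by
  induction k with
  | zero =>
    funext j q
    simp [iterate, mix, stepLength_zero]
  | succ k ih =>
    rw [iterate, ih, ← iterate]

theorem iterate_nonneg (u : ℕ → Fin n → I.Choice) (k : ℕ) (j : Fin n) (q : I.Choice) :
    0 ≤ I.iterate (fun _ _ => 0) u k j q := by
  induction k with
  | zero => exact le_rfl
  | succ k ih =>
    have h1 := stepLength_nonneg k
    have h2 := sub_nonneg.2 (stepLength_le_one k)
    simp only [iterate, mix, point]
    split_ifs <;> positivity

theorem sum_point (u : Fin n → I.Choice) (j : Fin n) : ∑ q, I.point u j q = 1 := by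
  simp [point]

theorem sum_mix (γ : ℝ) (x : Fin n → I.Choice → ℝ) (u : Fin n → I.Choice) (j : Fin n) :
    ∑ q, I.mix γ x u j q = (1 - γ) * ∑ q, x j q + γ := by
  simp only [mix, Finset.sum_add_distrib, ← Finset.mul_sum, sum_point, mul_one]

theorem sum_iterate (u : ℕ → Fin n → I.Choice) (k : ℕ) (j : Fin n) :
    ∑ q, I.iterate (fun _ _ => 0) u (k + 1) j q = 1 := by
  induction k with
  | zero => rw [iterate, sum_mix, stepLength_zero]; simp
  | succ k ih => rw [iterate, sum_mix, ih]; ring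

theorem sum_iterate_le (u : ℕ → Fin n → I.Choice) (k : ℕ) (j : Fin n) :
    ∑ q, I.iterate (fun _ _ => 0) u k j q ≤ 1 := by
  cases k with
  | zero => simp [iterate]
  | succ k => exact (sum_iterate u k j).le

theorem admissible_of_iterate_ne_zero {u : ℕ → Fin n → I.Choice} {k : ℕ}
    (hu : ∀ l < k, ∀ j, I.Admissible j (u l j)) {j : Fin n} {q : I.Choice}
    (h : I.iterate (fun _ _ => 0) u k j q ≠ 0) : I.Admissible j q := by
  induction k with
  | zero => exact absurd rfl h
  | succ k ih =>
    by_cases hq : q = u k j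
    · rw [hq]; exact hu k (by omega) j
    · refine ih (fun l hl => hu l (by omega)) fun h0 => h ?_
      simp [iterate, mix, h0, point, hq]

theorem load_nonneg {x : Fin n → I.Choice → ℝ} (hx : ∀ j q, 0 ≤ x j q) (i : Fin m) (C : ℕ) :
    0 ≤ I.load x i C := by
  rw [load, fracLoad]
  exact Finset.sum_nonneg fun k _ => Finset.sum_nonneg fun q _ => by
    have := hx k q
    split_ifs <;> positivity

theorem load_le {x : Fin n → I.Choice → ℝ} (hx : ∀ j q, 0 ≤ x j q) (hx1 : ∀ j, ∑ q, x j q ≤ 1)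
    (i : Fin m) (C : ℕ) : I.load x i C ≤ I.size := by
  have h1 : I.load x i C ≤ ∑ k, (I.proc i k : ℝ) := by
    rw [load, fracLoad]
    refine Finset.sum_le_sum fun k _ => ?_
    calc (∑ q, if q.1 = i ∧ (q.2 : ℕ) ≤ C then (I.proc i k : ℝ) * x k q else 0)
        ≤ ∑ q, (I.proc i k : ℝ) * x k q := by
          refine Finset.sum_le_sum fun q _ => ?_
          have := hx k q
          split_ifs
          · exact le_rfl
          · positivity
      _ = I.proc i k * ∑ q, x k q := by rw [Finset.mul_sum]
      _ ≤ I.proc i k * 1 := mul_le_mul_of_nonneg_left (hx1 k) (by positivity)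
      _ = _ := mul_one _
  have h2 : ∑ k, I.proc i k ≤ I.size := by
    have := I.sum_proc_le_horizon fun _ => i
    unfold size
    omega
  refine h1.trans ?_
  exact_mod_cast h2

theorem abs_load_sub_le {x y : Fin n → I.Choice → ℝ} (hx : ∀ j q, 0 ≤ x j q)
    (hx1 : ∀ j, ∑ q, x j q ≤ 1) (hy : ∀ j q, 0 ≤ y j q) (hy1 : ∀ j, ∑ q, y j q ≤ 1)
    (i : Fin m) (C : ℕ) : |I.load y i C - I.load x i C| ≤ I.size := by
  have h1 := load_le hx hx1 i C
  have h2 := load_le hy hy1 i C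
  have h3 := load_nonneg hx i C
  have h4 := load_nonneg hy i C
  rw [abs_le]
  constructor <;> linarith

theorem point_nonneg (u : Fin n → I.Choice) (j : Fin n) (q : I.Choice) : 0 ≤ I.point u j q := by
  unfold point; split_ifs <;> norm_num

/-- The convergence of the conditional gradient method. -/
theorem iterate_value_le {p M : ℝ} (hM : 0 ≤ M) {u : ℕ → Fin n → I.Choice} {b : Fin n → I.Choice}
    {K : ℕ}
    (hu : ∀ k < K, ∀ j q, I.Admissible j q →
      I.gradient p M (I.load (I.iterate (fun _ _ => 0) u k)) j (u k j) ≤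
        I.gradient p M (I.load (I.iterate (fun _ _ => 0) u k)) j q)
    (hb : ∀ j, I.Admissible j (b j))
    (hbC : ∀ i C, C < I.size → I.load (I.point b) i C ≤ C) (k : ℕ) (hk : k + 1 ≤ K) :
    I.linCost p (I.iterate (fun _ _ => 0) u (k + 1)) +
      M * I.penalty (I.load (I.iterate (fun _ _ => 0) u (k + 1))) ≤
      I.linCost p (I.point b) + 4 * (M * (I.size : ℝ) ^ 4) / ((k : ℝ) + 3) := by
  set B := M * (I.size : ℝ) ^ 4 with hB
  have hB0 : 0 ≤ B := by positivity
  have hstep : ∀ k < K, I.linCost p (I.iterate (fun _ _ => 0) u (k + 1)) +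
      M * I.penalty (I.load (I.iterate (fun _ _ => 0) u (k + 1))) ≤
      (1 - stepLength k) * (I.linCost p (I.iterate (fun _ _ => 0) u k) +
      M * I.penalty (I.load (I.iterate (fun _ _ => 0) u k))) +
      stepLength k * I.linCost p (I.point b) + stepLength k ^ 2 * B := fun k hk =>
    conditional_gradient_step hM (stepLength_nonneg k) (hu k hk) hb hbC
      (abs_load_sub_le (iterate_nonneg u k) (sum_iterate_le u k)
        (point_nonneg _) fun j => (sum_point _ j).le)
  induction k with
  | zero =>
    have h := hstep 0 (by omega)
    rw [stepLength_zero] at h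
    have : B ≤ 4 * B / ((0 : ℕ) + 3) := by
      rw [le_div_iff₀ (by norm_num)]
      push_cast
      linarith
    simp only [Nat.cast_zero] at *
    linarith
  | succ k ih =>
    have h := hstep (k + 1) (by omega)
    have ih := ih (by omega)
    have h1 := mul_le_mul_of_nonneg_left ih (sub_nonneg.2 (stepLength_le_one (k + 1)))
    -- With step length 2/(k + 3) the left side is 4B (k + 2)/(k + 3)², and (k + 2)(k + 4) ≤ (k +
    -- 3)².
    have h2 : (1 - stepLength (k + 1)) * (4 * B / ((k : ℝ) + 3)) + stepLength (k + 1) ^ 2 * B ≤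
        4 * B / (((k + 1 : ℕ) : ℝ) + 3) := by
      have hk0 : (0 : ℝ) ≤ k := by positivity
      unfold stepLength
      push_cast
      rw [show (k : ℝ) + 1 + 2 = k + 3 by ring, show (k : ℝ) + 1 + 3 = k + 4 by ring]
      have e : (1 - 2 / ((k : ℝ) + 3)) * (4 * B / ((k : ℝ) + 3)) + (2 / ((k : ℝ) + 3)) ^ 2 * B =
          4 * B * ((k + 2) / (k + 3) ^ 2) := by
        field_simp
        ring
      rw [e, ← mul_one_div (4 * B) ((k : ℝ) + 4)]
      refine mul_le_mul_of_nonneg_left ?_ (by positivity)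
      rw [div_le_div_iff₀ (by positivity) (by positivity)]
      nlinarith
    linarith

end Instance

/-! ### Bounds for the relaxation in terms of the essential weight, and the choice of exponents -/

namespace Instance

variable {n m : ℕ} {I : Instance n m}

open Classical in
/-- The total weight of the jobs with positive processing times on all machines. -/
def essentialWeight (I : Instance n m) : ℝ :=
  ∑ j, if ∀ i, I.proc i j ≠ 0 then I.weight j else 0

theorem essentialWeight_nonneg (I : Instance n m) : 0 ≤ I.essentialWeight :=
  Finset.sum_nonneg fun j _ => by
    have := I.weight_nonneg j
    split_ifs <;> simp [this]

theorem horizon_add_two_le_size (I : Instance n m) : I.horizon + 2 ≤ I.size := by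
  unfold size; omega

/-- A feasible schedule gives an admissible assignment that respects the capacities. -/
theorem exists_assignment_le_cost {S : Schedule n m} (hS : I.Feasible S) {p : ℝ} (hp : 0 ≤ p) :
    ∃ b : Fin n → I.Choice, (∀ j, I.Admissible j (b j)) ∧
      (∀ i C, C < I.size → I.load (I.point b) i C ≤ C) ∧
      I.linCost p (I.point b) ≤ I.cost p S := by
  have hX := I.horizon_add_two_le_size
  have hproc : ∀ j, I.proc (S.machine j) j ≤ I.horizon := fun j =>
    (Finset.single_le_sum (f := fun j => I.proc (S.machine j) j) (fun _ _ => Nat.zero_le _)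
      (Finset.mem_univ j)).trans (I.sum_proc_le_horizon S.machine)
  have hc0 := fun j => completion_nonneg hS j
  -- The deadline is the completion time rounded down, capped at the largest available one because S
  -- may idle beyond the horizon. Rounding down costs nothing: integer loads bounded by a completion
  -- time are bounded by its floor.
  refine ⟨fun j => (S.machine j, ⟨min ⌊I.completion S j⌋₊ (I.size - 1), by omega⟩),
    fun j => ?_, fun i C hC => ?_, ?_⟩
  · have h1 : I.proc (S.machine j) j ≤ ⌊I.completion S j⌋₊ :=
      Nat.le_floor (le_add_of_nonneg_left (hS.1 j))
    have h2 := hproc j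
    simp only [Admissible]
    omega
  · rw [load_point, ← Finset.sum_filter]
    simp only
    -- At the last deadline the capacity exceeds the horizon and is never binding; below it the cap
    -- is inactive.
    by_cases hCX : C = I.size - 1
    · have h1 : ∑ j, I.proc i j ≤ C := by
        have := I.sum_proc_le_horizon fun _ => i
        omega
      refine (Finset.sum_le_sum_of_subset_of_nonneg (Finset.subset_univ _)
        fun j _ _ => Nat.cast_nonneg _).trans ?_
      exact_mod_cast h1
    · set s := Finset.univ.filter fun j => S.machine j = i ∧
        min ⌊I.completion S j⌋₊ (I.size - 1) ≤ C with hs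
      rcases s.eq_empty_or_nonempty with h0 | h0
      · rw [h0]; simp
      obtain ⟨j, hj, hmax⟩ := Finset.exists_max_image s (fun j => I.completion S j) h0
      have h1 := sum_proc_le_of_feasible hS i s (I.completion S j) (hc0 j)
        (fun k hk => (Finset.mem_filter.1 hk).2.1) hmax
      have h2 : ⌊I.completion S j⌋₊ ≤ C := by
        have := (Finset.mem_filter.1 hj).2.2
        omega
      have h3 : ((∑ k ∈ s, I.proc i k : ℕ) : ℝ) ≤ I.completion S j := by
        rw [Nat.cast_sum]; exact h1
      have h4 := (Nat.le_floor h3).trans h2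
      exact_mod_cast h4
  · rw [linCost_point, cost]
    refine Finset.sum_le_sum fun j _ => mul_le_mul_of_nonneg_left
      (Real.rpow_le_rpow (by positivity) ?_ hp) (I.weight_nonneg j)
    refine le_trans (Nat.cast_le.2 (min_le_left _ _)) (Nat.floor_le (hc0 j))

/-- Jobs with a zero processing time somewhere go there with deadline 0 and cost nothing; the others
get the last deadline. This bounds the relaxation by a multiple of W, which makes the penalty small
relative to M = W size^e₁. -/
theorem exists_assignment_le_essentialWeight [NeZero m] (I : Instance n m) {p : ℝ} (hp : 0 < p) :
    ∃ b : Fin n → I.Choice, (∀ j, I.Admissible j (b j)) ∧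
      (∀ i C, C < I.size → I.load (I.point b) i C ≤ C) ∧
      I.linCost p (I.point b) ≤ I.essentialWeight * (I.size : ℝ) ^ p := by
  classical
  have hX := I.horizon_add_two_le_size
  have hT := fun i => I.sum_proc_le_horizon fun _ => i
  have hch : ∀ j, ∃ q : I.Choice, I.Admissible j q ∧
      (((q.2 : ℕ) = 0 ∧ I.proc q.1 j = 0 ∧ ¬ ∀ i, I.proc i j ≠ 0) ∨
        ((q.2 : ℕ) = I.size - 1 ∧ ∀ i, I.proc i j ≠ 0)) := by
    intro j
    by_cases h : ∀ i, I.proc i j ≠ 0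
    · refine ⟨(0, ⟨I.size - 1, by omega⟩), ?_, Or.inr ⟨rfl, h⟩⟩
      have h1 : I.proc 0 j ≤ ∑ j, I.proc 0 j :=
        Finset.single_le_sum (f := fun j => I.proc 0 j) (fun _ _ => Nat.zero_le _)
          (Finset.mem_univ j)
      have := hT 0
      simp only [Admissible]
      omega
    · obtain ⟨i, hi⟩ := not_forall_not.1 h
      exact ⟨(i, ⟨0, by omega⟩), by simp [Admissible, hi], Or.inl ⟨rfl, hi, h⟩⟩
  choose b hb1 hb2 using hch
  refine ⟨b, hb1, fun i C hC => ?_, ?_⟩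
  · rw [load_point]
    by_cases hCX : C = I.size - 1
    · calc (∑ j, if (b j).1 = i ∧ ((b j).2 : ℕ) ≤ C then (I.proc i j : ℝ) else 0)
          ≤ ∑ j, (I.proc i j : ℝ) := Finset.sum_le_sum fun j _ => by split_ifs <;> simp
        _ ≤ C := by
          have h1 : ∑ j, I.proc i j ≤ C := by
            have := hT i
            omega
          exact_mod_cast h1
    · rw [Finset.sum_eq_zero]
      · positivity
      · intro j _
        rcases hb2 j with ⟨_, h, _⟩ | ⟨h, _⟩
        · split_ifs with h'
          · rw [← h'.1, h, Nat.cast_zero]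
          · rfl
        · rw [if_neg (by omega)]
  · rw [linCost_point, essentialWeight, Finset.sum_mul]
    refine Finset.sum_le_sum fun j _ => ?_
    rcases hb2 j with ⟨h, _, h'⟩ | ⟨h, h'⟩
    · rw [h, if_neg h', Nat.cast_zero, Real.zero_rpow hp.ne']
      simp
    · rw [if_pos h']
      refine mul_le_mul_of_nonneg_left (Real.rpow_le_rpow (by positivity) ?_ hp.le)
        (I.weight_nonneg j)
      exact Nat.cast_le.2 (b j).2.is_lt.le

theorem linCost_nonneg {x : Fin n → I.Choice → ℝ} (hx : ∀ j q, 0 ≤ x j q) (p : ℝ) :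
    0 ≤ I.linCost p x :=
  Finset.sum_nonneg fun j _ => Finset.sum_nonneg fun q _ => by
    have := hx j q
    have := I.weight_nonneg j
    positivity

/-- The slack of the rounding bound is quadratic in x. A job has at most size² choices, so
Cauchy-Schwarz gives ∑ x² ≥ 1/size², and every admissible deadline of an essential job is at least
1. -/
theorem sum_sq_linCost_ge {x : Fin n → I.Choice → ℝ}
    (hx1 : ∀ j, ∑ q, x j q = 1) (hadm : ∀ j q, x j q ≠ 0 → I.Admissible j q) {p : ℝ}
    (hp : 0 ≤ p) :
    I.essentialWeight / (I.size : ℝ) ^ 2 ≤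
      ∑ j, ∑ q, x j q ^ 2 * (I.weight j * ((q.2 : ℕ) : ℝ) ^ p) := by
  classical
  rw [essentialWeight, Finset.sum_div]
  refine Finset.sum_le_sum fun j _ => ?_
  have hw := I.weight_nonneg j
  split_ifs with hj
  · have hX : (0 : ℝ) < I.size := Nat.cast_pos.2 (by unfold size; omega)
    have h1 : (1 : ℝ) ≤ (I.size : ℝ) ^ 2 * ∑ q, x j q ^ 2 := by
      have h := sq_sum_le_card_mul_sum_sq (s := Finset.univ) (f := x j)
      rw [hx1, one_pow, Finset.card_univ, Fintype.card_prod, Fintype.card_fin,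
        Fintype.card_fin] at h
      refine h.trans (mul_le_mul_of_nonneg_right ?_ (Finset.sum_nonneg fun q _ => sq_nonneg _))
      have h2 : m ≤ I.size := by unfold size; omega
      rw [sq, Nat.cast_mul]
      exact mul_le_mul_of_nonneg_right (Nat.cast_le.2 h2) hX.le
    rw [div_le_iff₀ (by positivity)]
    calc I.weight j ≤ I.weight j * ((I.size : ℝ) ^ 2 * ∑ q, x j q ^ 2) :=
          le_mul_of_one_le_right hw h1
      _ = (∑ q, x j q ^ 2 * (I.weight j * 1)) * (I.size : ℝ) ^ 2 := by
          rw [← Finset.sum_mul]; ring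
      _ ≤ _ := by
          refine mul_le_mul_of_nonneg_right (Finset.sum_le_sum fun q _ => ?_) (by positivity)
          by_cases hq : x j q = 0
          · simp [hq]
          · refine mul_le_mul_of_nonneg_left (mul_le_mul_of_nonneg_left ?_ hw) (sq_nonneg _)
            have h2 : I.proc q.1 j ≤ (q.2 : ℕ) := hadm j q hq
            have h3 := hj q.1
            exact Real.one_le_rpow (Nat.one_le_cast.2 (by omega)) hp
  · rw [zero_div]
    exact Finset.sum_nonneg fun q _ => by positivity

theorem one_add_rpow_le {p v : ℝ} (hp : 1 ≤ p) (hv : 0 ≤ v) (hv1 : v ≤ 1) :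
    (1 + v) ^ p ≤ 1 + v * 2 ^ p := by
  have h := convex_rpow_chord hp zero_le_one hv hv1
  rw [Real.one_rpow, one_add_one_eq_two] at h
  linarith

/-- Rounding an approximate solution of the deadline relaxation. The exponents of the penalty factor
and of the number of iterations only depend on `p`. -/
theorem exists_exponents_prodExp_le {p : ℝ} (hp : 1 ≤ p) : ∃ e₁ e₂ : ℕ,
    ∀ (n m : ℕ) [NeZero m] (I : Instance n m) (u : ℕ → Fin n → I.Choice),
      (∀ k < I.size ^ e₂, ∀ j, I.Admissible j (u k j)) →
      (∀ k < I.size ^ e₂, ∀ j q, I.Admissible j q →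
        I.gradient p (I.essentialWeight * (I.size : ℝ) ^ e₁)
          (I.load (I.iterate (fun _ _ => 0) u k)) j (u k j) ≤
        I.gradient p (I.essentialWeight * (I.size : ℝ) ^ e₁)
          (I.load (I.iterate (fun _ _ => 0) u k)) j q) →
      ∀ comp : (Fin n → I.Choice) → Fin n → ℝ, (∀ a j, 0 ≤ comp a j) →
      (∀ a j, comp a j ≤ (I.proc (a j).1 j : ℝ) + ∑ k ∈ Finset.univ.erase j,
        if (a k).1 = (a j).1 ∧ ((a k).2 : ℕ) ≤ (a j).2 then (I.proc (a j).1 k : ℝ) else 0) →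
      ∀ S : Schedule n m, I.Feasible S →
        prodExp (I.iterate (fun _ _ => 0) u (I.size ^ e₂))
          (fun a => ∑ j, I.weight j * comp a j ^ p) ≤ 2 ^ p * fractionalBell p * I.cost p S := by
  obtain ⟨P, hP⟩ := exists_nat_ge p
  set A := fractionalBell p with hA
  have hA1 : 1 ≤ A := one_le_fractionalBell hp
  -- The size is at least 3, so its c-th power dominates the constants that depend on p.
  obtain ⟨c, hc⟩ := pow_unbounded_of_one_lt (2 ^ p * A + A + 1) (show (1 : ℝ) < 3 by norm_num)
  -- With P ≥ p, E = c + P + 4 and D = c + 3: the penalty factor W X^e₁ forces every excess below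
  -- X^(-E), and X^e₂ steps bring the optimality gap below W / X^D. Each of the two resulting errors
  -- is then at most W / X³.
  refine ⟨P + 1 + 2 * (c + P + 4), P + 1 + 2 * (c + P + 4) + 6 + (c + 3), ?_⟩
  intro n m _ I u hadm hmin comp hcomp0 hcomp S hS
  set E := c + P + 4 with hE
  set D := c + 3 with hD
  set e₁ := P + 1 + 2 * E with he₁
  set e₂ := e₁ + 6 + D with he₂
  set W := I.essentialWeight with hW
  have hW0 : 0 ≤ W := I.essentialWeight_nonneg
  set X : ℝ := (I.size : ℝ) with hX
  have hX3 : 3 ≤ X := by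
    have h1 : 3 ≤ I.size := by
      have := NeZero.pos m
      unfold size; omega
    have : ((3 : ℕ) : ℝ) ≤ X := Nat.cast_le.2 h1
    exact_mod_cast this
  have hX0 : 0 < X := by linarith
  have hX1 : 1 ≤ X := by linarith
  set M := W * X ^ e₁ with hM
  have hM0 : 0 ≤ M := by positivity
  obtain ⟨k, hk⟩ : ∃ k, I.size ^ e₂ = k + 1 :=
    Nat.exists_eq_succ_of_ne_zero (pow_ne_zero _ (by unfold size; omega))
  have hkX : X ^ e₂ ≤ (k : ℝ) + 3 := by
    have : ((I.size ^ e₂ : ℕ) : ℝ) = ((k + 1 : ℕ) : ℝ) := by rw [hk]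
    push_cast at this
    linarith
  set x := I.iterate (fun _ _ => 0) u (I.size ^ e₂) with hx
  have hx0 : ∀ j q, 0 ≤ x j q := iterate_nonneg u _
  have hx1 : ∀ j, ∑ q, x j q = 1 := fun j => by rw [hx, hk]; exact sum_iterate u k j
  have hxadm : ∀ j q, x j q ≠ 0 → I.Admissible j q := fun j q h =>
    admissible_of_iterate_ne_zero hadm h
  have herr : 4 * (M * X ^ 4) / ((k : ℝ) + 3) ≤ W / X ^ D := by
    rw [div_le_div_iff₀ (by positivity) (by positivity)]
    calc 4 * (M * X ^ 4) * X ^ D ≤ X ^ 2 * (M * X ^ 4) * X ^ D := by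
          gcongr
          nlinarith
      _ = W * X ^ e₂ := by rw [hM, he₂]; ring
      _ ≤ W * ((k : ℝ) + 3) := mul_le_mul_of_nonneg_left hkX hW0
  have hval : ∀ b : Fin n → I.Choice, (∀ j, I.Admissible j (b j)) →
      (∀ i C, C < I.size → I.load (I.point b) i C ≤ C) →
      I.linCost p x + M * I.penalty (I.load x) ≤ I.linCost p (I.point b) + W / X ^ D := by
    intro b hb hbC
    have h := iterate_value_le hM0 hmin hb hbC k hk.ge
    rw [← hk] at h
    exact h.trans (add_le_add_right herr _)
  have hlin0 := linCost_nonneg hx0 p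
  have hpen0 : 0 ≤ I.penalty (I.load x) :=
    Finset.sum_nonneg fun i _ => Finset.sum_nonneg fun C _ => sq_nonneg _
  have hMp : 0 ≤ M * I.penalty (I.load x) := mul_nonneg hM0 hpen0
  have hlinS : I.linCost p x ≤ I.cost p S + W / X ^ D := by
    obtain ⟨b, hb, hbC, hbc⟩ := exists_assignment_le_cost hS (show 0 ≤ p by linarith)
    have := hval b hb hbC
    linarith
  have hlinW : I.linCost p x + M * I.penalty (I.load x) ≤ W * X ^ (P + 1) := by
    obtain ⟨b, hb, hbC, hbc⟩ := I.exists_assignment_le_essentialWeight (show 0 < p by linarith)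
    have h1 := hval b hb hbC
    have h2 : X ^ p ≤ X ^ P := by
      rw [← Real.rpow_natCast]
      exact Real.rpow_le_rpow_of_exponent_le hX1 hP
    have h3 := mul_le_mul_of_nonneg_left h2 hW0
    have h4 : W / X ^ D ≤ W := div_le_self hW0 (one_le_pow₀ hX1)
    have h5 : (1 : ℝ) ≤ X ^ P := one_le_pow₀ hX1
    have h6 : X ^ P + 1 ≤ X ^ (P + 1) := by rw [pow_succ]; nlinarith
    have h7 := mul_le_mul_of_nonneg_left h6 hW0
    linarith
  obtain ⟨v, hv0, hcap, hvlin⟩ : ∃ v : ℝ, 0 ≤ v ∧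
      (∀ i C, C < I.size → I.load x i C ≤ C + v) ∧
      (1 + v) ^ p * A * I.linCost p x ≤
        A * I.linCost p x + 2 ^ p * A * (W * X ^ (P + 1) / X ^ E) := by
    rcases hW0.eq_or_lt with h0 | hWpos
    -- If W = 0, the penalty factor is 0 and capacities are uncontrolled, but the linear cost of x
    -- is 0, so the trivial violation v = X does no harm.
    · refine ⟨X, hX0.le, fun i C _ => ?_, ?_⟩
      · have h1 := load_le hx0 (fun j => (hx1 j).le) i C
        have h2 : (0 : ℝ) ≤ C := by positivity
        linarith
      · have h1 : I.linCost p x = 0 := by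
          rw [← h0, zero_mul] at hlinW
          linarith
        rw [h1, ← h0]
        simp
    · have hv1 : 1 / X ^ E ≤ 1 := (div_le_one (by positivity)).2 (one_le_pow₀ hX1)
      refine ⟨1 / X ^ E, by positivity, fun i C hC => ?_, ?_⟩
      · have h1 : excess (I.load x) i C ^ 2 ≤ I.penalty (I.load x) := by
          refine le_trans ?_ (Finset.single_le_sum
            (f := fun i => ∑ C ∈ Finset.range I.size, excess (I.load x) i C ^ 2)
            (fun i _ => Finset.sum_nonneg fun C _ => sq_nonneg _) (Finset.mem_univ i))
          exact Finset.single_le_sum (f := fun C => excess (I.load x) i C ^ 2)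
            (fun C _ => sq_nonneg _) (Finset.mem_range.2 hC)
        have h2 : M * I.penalty (I.load x) ≤ W * X ^ (P + 1) := by linarith
        -- Cancel W > 0 in M · penalty ≤ W X^(P+1); the exponent e₁ is P + 1 + 2E, which leaves
        -- X^(-2E).
        have h3 : I.penalty (I.load x) ≤ (1 / X ^ E) ^ 2 := by
          rw [hM, mul_assoc] at h2
          have h4 := le_of_mul_le_mul_left h2 hWpos
          rw [one_div, inv_pow, ← one_div, le_div_iff₀ (by positivity)]
          have h5 : X ^ e₁ = X ^ (P + 1) * (X ^ E) ^ 2 := by rw [he₁]; ring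
          rw [h5, mul_assoc] at h4
          have h6 := le_of_mul_le_mul_left (h4.trans (le_of_eq (mul_one _).symm))
            (show 0 < X ^ (P + 1) by positivity)
          linarith
        have h4 := abs_le_of_sq_le_sq' (h1.trans h3) (by positivity)
        have h5 : I.load x i C - C ≤ excess (I.load x) i C := le_max_right _ _
        linarith [h4.2]
      · have h1 := one_add_rpow_le hp (by positivity) hv1
        have h2 : I.linCost p x ≤ W * X ^ (P + 1) := by linarith
        have h3 := mul_le_mul_of_nonneg_right h1 (show 0 ≤ A * I.linCost p x by positivity)
        have h4 : 1 / X ^ E * 2 ^ p * (A * I.linCost p x) ≤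
            1 / X ^ E * 2 ^ p * (A * (W * X ^ (P + 1))) := by gcongr
        have h5 : 1 / X ^ E * 2 ^ p * (A * (W * X ^ (P + 1))) =
            2 ^ p * A * (W * X ^ (P + 1) / X ^ E) := by ring
        linarith
  have hround := prodExp_cost_le (I := I) (mach := (Prod.fst : I.Choice → Fin m))
    (dl := fun _ q => (q.2 : ℕ)) hp hv0 hx0 hx1 hxadm
    (fun j q _ => hcap q.1 q.2 q.2.is_lt) comp hcomp0 hcomp
  refine hround.trans ?_
  -- The slack is worth W / X², which outweighs the two errors of W / X³ because X ≥ 2.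
  have hsq := sum_sq_linCost_ge hx1 hxadm (show 0 ≤ p by linarith)
  have hexp : ∑ j, ∑ q, x j q * (I.weight j * (((q.2 : ℕ) : ℝ) ^ p *
        ((1 + v) ^ p * fractionalBell p + 1 - x j q))) =
      ((1 + v) ^ p * A + 1) * I.linCost p x -
        ∑ j, ∑ q, x j q ^ 2 * (I.weight j * ((q.2 : ℕ) : ℝ) ^ p) := by
    simp only [linCost, Finset.mul_sum, ← Finset.sum_sub_distrib]
    exact Finset.sum_congr rfl fun j _ => Finset.sum_congr rfl fun q _ => by ring
  rw [hexp]
  have e2 : (2 : ℝ) ^ p = 2 ^ (p - 1) * 2 := by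
    rw [Real.rpow_sub_one two_ne_zero]; ring
  rw [show (2 : ℝ) ^ p * A * I.cost p S = 2 ^ (p - 1) * (2 * A * I.cost p S) by rw [e2]; ring]
  refine mul_le_mul_of_nonneg_left ?_ (by positivity)
  have hcX : (3 : ℝ) ^ c ≤ X ^ c := pow_le_pow_left₀ (by norm_num) hX3 c
  have h2A : 0 < 2 ^ p * A := by positivity
  have hs1 : (A + 1) * (W / X ^ D) ≤ W / X ^ 3 := by
    rw [← mul_div_assoc, div_le_div_iff₀ (by positivity) (by positivity)]
    calc (A + 1) * W * X ^ 3 ≤ X ^ c * W * X ^ 3 := by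
          gcongr
          linarith
      _ = W * X ^ D := by rw [hD]; ring
  have hs2 : 2 ^ p * A * (W * X ^ (P + 1) / X ^ E) ≤ W / X ^ 3 := by
    rw [← mul_div_assoc, div_le_div_iff₀ (by positivity) (by positivity)]
    calc 2 ^ p * A * (W * X ^ (P + 1)) * X ^ 3 ≤ X ^ c * (W * X ^ (P + 1)) * X ^ 3 := by
          gcongr
          linarith
      _ = W * X ^ E := by rw [hE]; ring
  have hs3 : W / X ^ 3 + W / X ^ 3 ≤ W / X ^ 2 := by
    rw [← add_div, div_le_div_iff₀ (by positivity) (by positivity)]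
    have : (W + W) * X ^ 2 ≤ (W * X) * X ^ 2 :=
      mul_le_mul_of_nonneg_right (by nlinarith) (by positivity)
    calc _ ≤ _ := this
      _ = _ := by ring
  have hl := mul_le_mul_of_nonneg_left hlinS (show 0 ≤ A + 1 by linarith)
  have hcS := cost_nonneg hS p
  have hAS : (A + 1) * I.cost p S ≤ 2 * A * I.cost p S :=
    mul_le_mul_of_nonneg_right (by linarith) hcS
  linarith

end Instance

/-! ## Reasoning about programs -/

namespace Mem

@[simp] theorem setNat_real (s : Mem) (a i j k v : ℕ) : (s.setNat a i j k v).real = s.real := rfl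

@[simp] theorem setReal_nat (s : Mem) (a i j k : ℕ) (v : ℝ) :
    (s.setReal a i j k v).nat = s.nat := rfl

@[simp] theorem setNat_nat_ne (s : Mem) {a b : ℕ} (h : b ≠ a) (i j k v : ℕ) :
    (s.setNat a i j k v).nat b = s.nat b := by
  funext c d e
  simp [setNat, h]

@[simp] theorem setReal_real_ne (s : Mem) {a b : ℕ} (h : b ≠ a) (i j k : ℕ) (v : ℝ) :
    (s.setReal a i j k v).real b = s.real b := by
  funext c d e
  simp [setReal, h]

theorem setNat_nat (s : Mem) (a i j k v b c d : ℕ) :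
    (s.setNat a i j k v).nat a b c d = if b = i ∧ c = j ∧ d = k then v else s.nat a b c d := by
  simp [setNat]

theorem setReal_real (s : Mem) (a i j k : ℕ) (v : ℝ) (b c d : ℕ) :
    (s.setReal a i j k v).real a b c d = if b = i ∧ c = j ∧ d = k then v else s.real a b c d := by
  simp [setReal]

@[simp] theorem setNat_nat_self (s : Mem) (a i j k v : ℕ) :
    (s.setNat a i j k v).nat a i j k = v := by
  simp [setNat]

@[simp] theorem setReal_real_self (s : Mem) (a i j k : ℕ) (v : ℝ) :
    (s.setReal a i j k v).real a i j k = v := by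
  simp [setReal]

end Mem

/-- The command does not write to the array `a` of natural numbers. -/
def Cmd.natFree (a : ℕ) : Cmd → Bool
  | .setNat arr _ _ _ _ => arr != a
  | .setReal _ _ _ _ _ => true
  | .flip arr _ _ _ _ => arr != a
  | .seq c d => c.natFree a && d.natFree a
  | .ite _ c d => c.natFree a && d.natFree a
  | .while _ c => c.natFree a

/-- The command does not write to the array `a` of real numbers. -/
def Cmd.realFree (a : ℕ) : Cmd → Bool
  | .setNat _ _ _ _ _ => true
  | .setReal arr _ _ _ _ => arr != a
  | .flip _ _ _ _ _ => true
  | .seq c d => c.realFree a && d.realFree a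
  | .ite _ c d => c.realFree a && d.realFree a
  | .while _ c => c.realFree a

/-- Execution of the command `c`, without coins, takes the memory `s` to `s'` in `k` steps. -/
inductive Evaluates (p : ℝ) : Cmd → Mem → Mem → ℕ → Prop
  | setNat (arr : ℕ) (i j k e : NatExp) (s : Mem) : Evaluates p (.setNat arr i j k e) s
      (s.setNat arr (i.eval s) (j.eval s) (k.eval s) (e.eval s)) 1
  | setReal (arr : ℕ) (i j k : NatExp) (e : RealExp) (s : Mem) :
      Evaluates p (.setReal arr i j k e) s
      (s.setReal arr (i.eval s) (j.eval s) (k.eval s) (e.eval p s)) 1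
  | seq {c d : Cmd} {s s₁ s₂ : Mem} {a b : ℕ} : Evaluates p c s s₁ a → Evaluates p d s₁ s₂ b →
      Evaluates p (.seq c d) s s₂ (a + b + 1)
  | iteTrue {t : Test} {c d : Cmd} {s s₁ : Mem} {a : ℕ} : t.Holds p s → Evaluates p c s s₁ a →
      Evaluates p (.ite t c d) s s₁ (a + 1)
  | iteFalse {t : Test} {c d : Cmd} {s s₁ : Mem} {a : ℕ} : ¬ t.Holds p s → Evaluates p d s s₁ a →
      Evaluates p (.ite t c d) s s₁ (a + 1)
  | whileTrue {t : Test} {c : Cmd} {s s₁ s₂ : Mem} {a b : ℕ} : t.Holds p s →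
      Evaluates p c s s₁ a → Evaluates p (.while t c) s₁ s₂ b →
      Evaluates p (.while t c) s s₂ (a + b + 1)
  | whileFalse {t : Test} {c : Cmd} {s : Mem} : ¬ t.Holds p s → Evaluates p (.while t c) s s 1

/-- The arrays that `c` does not write to agree. -/
structure Frame (c : Cmd) (s s' : Mem) : Prop where
  nat : ∀ a, c.natFree a = true → s'.nat a = s.nat a
  real : ∀ a, c.realFree a = true → s'.real a = s.real a

theorem Frame.refl (c : Cmd) (s : Mem) : Frame c s s := ⟨fun _ _ => rfl, fun _ _ => rfl⟩

theorem Frame.trans {c : Cmd} {s s' s'' : Mem} (h : Frame c s s') (h' : Frame c s' s'') :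
    Frame c s s'' :=
  ⟨fun a ha => (h'.nat a ha).trans (h.nat a ha), fun a ha => (h'.real a ha).trans (h.real a ha)⟩

theorem Frame.mono {c d : Cmd} {s s' : Mem} (h : Frame c s s')
    (hn : ∀ a, d.natFree a = true → c.natFree a = true)
    (hr : ∀ a, d.realFree a = true → c.realFree a = true) : Frame d s s' :=
  ⟨fun a ha => h.nat a (hn a ha), fun a ha => h.real a (hr a ha)⟩

theorem Evaluates.frame {p : ℝ} {c : Cmd} {s s' : Mem} {k : ℕ} (h : Evaluates p c s s' k) :
    Frame c s s' := by
  induction h with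
  | setNat arr i j k e s =>
    exact ⟨fun a ha => Mem.setNat_nat_ne _ (bne_iff_ne.1 (show (arr != a) = true from ha)).symm _ _ _ _,
      fun a _ => rfl⟩
  | setReal arr i j k e s =>
    exact ⟨fun a _ => rfl,
      fun a ha => Mem.setReal_real_ne _ (bne_iff_ne.1 (show (arr != a) = true from ha)).symm _ _ _ _⟩
  | seq _ _ h₁ h₂ =>
    exact (h₁.mono (by simp +contextual [Cmd.natFree]) (by simp +contextual [Cmd.realFree])).trans
      (h₂.mono (by simp +contextual [Cmd.natFree]) (by simp +contextual [Cmd.realFree]))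
  | iteTrue _ _ h =>
    exact h.mono (by simp +contextual [Cmd.natFree]) (by simp +contextual [Cmd.realFree])
  | iteFalse _ _ h =>
    exact h.mono (by simp +contextual [Cmd.natFree]) (by simp +contextual [Cmd.realFree])
  | whileTrue _ _ _ h₁ h₂ =>
    exact (h₁.mono (by simp [Cmd.natFree]) (by simp [Cmd.realFree])).trans h₂
  | whileFalse _ => exact Frame.refl _ _

/-- Links the big-step relation to the step semantics. Quantifying over the remaining commands K and
steps N makes sequences and loops compose by mere rewriting. -/
theorem Evaluates.run_eq {p : ℝ} {c : Cmd} {s s' : Mem} {k : ℕ} (h : Evaluates p c s s' k) :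
    ∀ (N : ℕ) (K : List Cmd), run p (k + N) (c :: K, s) = run p N (K, s') := by
  induction h with
  | setNat arr i j k e s =>
    intro N K
    rw [add_comm, run, step, PMF.pure_bind]
  | setReal arr i j k e s =>
    intro N K
    rw [add_comm, run, step, PMF.pure_bind]
  | @seq c d s s₁ s₂ a b _ _ h₁ h₂ =>
    intro N K
    rw [show a + b + 1 + N = (a + (b + N)) + 1 by ring, run, step, PMF.pure_bind, h₁, h₂]
  | @iteTrue t c d s s₁ a ht _ h =>
    intro N K
    rw [show a + 1 + N = (a + N) + 1 by ring, run, step, if_pos ht, PMF.pure_bind, h]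
  | @iteFalse t c d s s₁ a ht _ h =>
    intro N K
    rw [show a + 1 + N = (a + N) + 1 by ring, run, step, if_neg ht, PMF.pure_bind, h]
  | @whileTrue t c s s₁ s₂ a b ht _ _ h₁ h₂ =>
    intro N K
    rw [show a + b + 1 + N = (a + (b + N)) + 1 by ring, run, step, if_pos ht, PMF.pure_bind, h₁, h₂]
  | whileFalse ht =>
    intro N K
    rw [add_comm, run, step, if_neg ht, PMF.pure_bind]

/-- Execution of `c` in memory `s` needs no coins, takes at most `B` steps, and establishes `R`. -/
def Runs (p : ℝ) (c : Cmd) (B : ℕ) (s : Mem) (R : Mem → Prop) : Prop :=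
  ∃ s' k, Evaluates p c s s' k ∧ k ≤ B ∧ R s'

section Runs

variable {p : ℝ} {c d : Cmd} {B B' : ℕ} {s : Mem} {R R' : Mem → Prop}

theorem Runs.mono (h : Runs p c B s R) (hB : B ≤ B') (hR : ∀ s', Frame c s s' → R s' → R' s') :
    Runs p c B' s R' := by
  obtain ⟨s', k, h1, h2, h3⟩ := h
  exact ⟨s', k, h1, h2.trans hB, hR _ h1.frame h3⟩

theorem Runs.setNat {arr : ℕ} {i j k e : NatExp}
    (h : R (s.setNat arr (i.eval s) (j.eval s) (k.eval s) (e.eval s))) :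
    Runs p (.setNat arr i j k e) 1 s R :=
  ⟨_, _, .setNat arr i j k e s, le_rfl, h⟩

theorem Runs.setReal {arr : ℕ} {i j k : NatExp} {e : RealExp}
    (h : R (s.setReal arr (i.eval s) (j.eval s) (k.eval s) (e.eval p s))) :
    Runs p (.setReal arr i j k e) 1 s R :=
  ⟨_, _, .setReal arr i j k e s, le_rfl, h⟩

theorem Runs.seq (h : Runs p c B s R) (h' : ∀ s', Frame c s s' → R s' → Runs p d B' s' R') :
    Runs p (.seq c d) (B + B' + 1) s R' := by
  obtain ⟨s₁, k, h1, h2, h3⟩ := h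
  obtain ⟨s₂, l, h4, h5, h6⟩ := h' s₁ h1.frame h3
  exact ⟨s₂, _, h1.seq h4, by omega, h6⟩

theorem Runs.ite {t : Test} (h : t.Holds p s → Runs p c B s R) (h' : ¬ t.Holds p s → Runs p d B s R) :
    Runs p (.ite t c d) (B + 1) s R := by
  by_cases ht : t.Holds p s
  · obtain ⟨s₁, k, h1, h2, h3⟩ := h ht
    exact ⟨s₁, _, .iteTrue ht h1, by omega, h3⟩
  · obtain ⟨s₁, k, h1, h2, h3⟩ := h' ht
    exact ⟨s₁, _, .iteFalse ht h1, by omega, h3⟩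

end Runs

/-- The scalar variable in the array `a` of natural numbers. -/
def nvar (a : ℕ) : NatExp := .get a (.lit 0) (.lit 0) (.lit 0)

/-- The scalar variable in the array `a` of real numbers. -/
def rvar (a : ℕ) : RealExp := .get a (.lit 0) (.lit 0) (.lit 0)

@[simp] theorem nvar_eval (a : ℕ) (s : Mem) : (nvar a).eval s = s.nat a 0 0 0 := rfl

@[simp] theorem rvar_eval (p : ℝ) (a : ℕ) (s : Mem) : (rvar a).eval p s = s.real a 0 0 0 := rfl

/-- Assignment to a scalar variable of type natural number. -/
def setN (a : ℕ) (e : NatExp) : Cmd := .setNat a (.lit 0) (.lit 0) (.lit 0) e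

/-- Assignment to a scalar variable of type real number. -/
def setR (a : ℕ) (e : RealExp) : Cmd := .setReal a (.lit 0) (.lit 0) (.lit 0) e

/-- The body of a loop that counts with the variable `v`. -/
def countLoop (t : Test) (v : ℕ) (c : Cmd) : Cmd :=
  .while t (.seq c (setN v (.add (nvar v) (.lit 1))))

/-- The loop `for v < N do c`. -/
def forLoop (v : ℕ) (N : NatExp) (c : Cmd) : Cmd :=
  .seq (setN v (.lit 0)) (countLoop (.natLe (.add (nvar v) (.lit 1)) N) v c)

section CountLoop

variable {p : ℝ} {t : Test} {v : ℕ} {c : Cmd}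

theorem countLoop_frame_body {s s' : Mem} (h : Frame c s s') : Frame (countLoop t v c) s s' :=
  h.mono (by simp +contextual [countLoop, Cmd.natFree])
    (by simp +contextual [countLoop, Cmd.realFree])

theorem countLoop_frame_var (s : Mem) (x : ℕ) :
    Frame (countLoop t v c) s (s.setNat v 0 0 0 x) :=
  ⟨fun a ha => Mem.setNat_nat_ne _ (by
    simp only [countLoop, Cmd.natFree, setN, Bool.and_eq_true, bne_iff_ne] at ha
    exact fun h => ha.2 h.symm) _ _ _ _, fun _ _ => rfl⟩

/-- Loops that count up to `N`. -/
theorem Runs.countLoop {B N : ℕ} {s₀ : Mem} {Inv : ℕ → Mem → Prop} (hv : c.natFree v = true)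
    (ht : ∀ s, Frame (UnrelatedScheduling.countLoop t v c) s₀ s →
      (t.Holds p s ↔ s.nat v 0 0 0 + 1 ≤ N))
    (hstep : ∀ i < N, ∀ s, Frame (UnrelatedScheduling.countLoop t v c) s₀ s → s.nat v 0 0 0 = i →
      Inv i s → Runs p c B s fun s' => Inv (i + 1) (s'.setNat v 0 0 0 (i + 1)))
    (r : ℕ) (i : ℕ) (hi : i + r = N) (s : Mem)
    (hf : Frame (UnrelatedScheduling.countLoop t v c) s₀ s) (hs : s.nat v 0 0 0 = i)
    (hinv : Inv i s) :
    Runs p (UnrelatedScheduling.countLoop t v c) (r * (B + 3) + 1) s (Inv N) := by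
  induction r generalizing i s with
  | zero =>
    refine ⟨s, 1, .whileFalse fun h => ?_, by omega, ?_⟩
    · have := (ht s hf).1 h
      omega
    · rwa [show N = i by omega]
  | succ r ih =>
    obtain ⟨s₁, k, h1, h2, h3⟩ := hstep i (by omega) s hf hs hinv
    have hs1 : s₁.nat v 0 0 0 = i := by rw [h1.frame.nat v hv, hs]
    have hf1 : Frame (UnrelatedScheduling.countLoop t v c) s₀ (s₁.setNat v 0 0 0 (i + 1)) :=
      (hf.trans (countLoop_frame_body h1.frame)).trans (countLoop_frame_var _ _)
    obtain ⟨s₂, l, h4, h5, h6⟩ := ih (i + 1) (by omega) _ hf1 (by simp) h3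
    have h7 : Evaluates p (setN v (.add (nvar v) (.lit 1))) s₁ (s₁.setNat v 0 0 0 (i + 1)) 1 := by
      have := Evaluates.setNat (p := p) v (.lit 0) (.lit 0) (.lit 0) (.add (nvar v) (.lit 1)) s₁
      simpa [setN, NatExp.eval, hs1] using this
    -- One round costs the loop test, the unfolding of the sequence, the body and the increment: B +
    -- 3 steps.
    refine ⟨s₂, _, .whileTrue ((ht s hf).2 (by omega)) (h1.seq h7) h4, ?_, h6⟩
    rw [add_mul]
    omega

/-- The rule for loops: `Inv i` holds before the iteration in which the variable `v` is `i`. -/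
theorem Runs.forLoop {N : NatExp} {B n : ℕ} {s : Mem} (Inv : ℕ → Mem → Prop)
    (hv : c.natFree v = true)
    (hN : ∀ s', Frame (UnrelatedScheduling.forLoop v N c) s s' → N.eval s' = n)
    (h0 : Inv 0 (s.setNat v 0 0 0 0))
    (hstep : ∀ i < n, ∀ s', Frame (UnrelatedScheduling.forLoop v N c) s s' →
      s'.nat v 0 0 0 = i → Inv i s' →
      Runs p c B s' fun s'' => Inv (i + 1) (s''.setNat v 0 0 0 (i + 1))) :
    Runs p (UnrelatedScheduling.forLoop v N c) (n * (B + 3) + 3) s (Inv n) := by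
  have hfr : ∀ s', Frame (UnrelatedScheduling.countLoop (.natLe (.add (nvar v) (.lit 1)) N) v c)
      (s.setNat v 0 0 0 0) s' → Frame (UnrelatedScheduling.forLoop v N c) s s' := by
    intro s' h
    have h1 : Frame (UnrelatedScheduling.forLoop v N c) s (s.setNat v 0 0 0 0) :=
      ⟨fun a ha => Mem.setNat_nat_ne _ (by
        simp only [UnrelatedScheduling.forLoop, Cmd.natFree, setN, Bool.and_eq_true,
          bne_iff_ne] at ha
        exact fun h => ha.1 h.symm) _ _ _ _, fun _ _ => rfl⟩
    exact h1.trans (h.mono (by simp +contextual [UnrelatedScheduling.forLoop, Cmd.natFree])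
      (by simp +contextual [UnrelatedScheduling.forLoop, Cmd.realFree]))
  refine (Runs.seq (B := 1) (B' := n * (B + 3) + 1) (R := fun s' => s' = s.setNat v 0 0 0 0)
    (Runs.setNat rfl) ?_).mono (by omega) fun _ _ h => h
  rintro s' - rfl
  refine Runs.countLoop hv (fun s' hs' => ?_) (fun i hi s' hs' => hstep i hi s' (hfr s' hs')) n 0
    (by omega) _ (Frame.refl _ _) (by simp) h0
  simp [Test.Holds, NatExp.eval, hN s' (hfr s' hs')]

end CountLoop

/-! ### Expectations -/

/-- The expectation of `F` after `N` steps. -/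
def expect (p : ℝ) (F : Config → ℝ≥0∞) (N : ℕ) (c : Config) : ℝ≥0∞ :=
  ∑' c', run p N c c' * F c'

/-- From the `N`-th step on the expectation of `F` is at most `v`. -/
def ExpectLe (p : ℝ) (F : Config → ℝ≥0∞) (N : ℕ) (c : Config) (v : ℝ≥0∞) : Prop :=
  ∀ k, N ≤ k → expect p F k c ≤ v

section ExpectLe

variable {p : ℝ} {F : Config → ℝ≥0∞} {N B : ℕ} {K : List Cmd} {s : Mem} {v : ℝ≥0∞}

theorem ExpectLe.mono_steps {c : Config} {N' : ℕ} (h : ExpectLe p F N c v) (hN : N ≤ N') :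
    ExpectLe p F N' c v := fun k hk => h k (hN.trans hk)

theorem ExpectLe.of_pure {c c' : Config} (hc : step p c = PMF.pure c')
    (h : ExpectLe p F N c' v) : ExpectLe p F (N + 1) c v := by
  intro k hk
  obtain ⟨k, rfl⟩ : ∃ l, k = l + 1 := ⟨k - 1, by omega⟩
  have : run p (k + 1) c = run p k c' := by rw [run, hc, PMF.pure_bind]
  unfold expect
  rw [this]
  exact h k (by omega)

theorem ExpectLe.seq {c d : Cmd} (h : ExpectLe p F N (c :: d :: K, s) v) :
    ExpectLe p F (N + 1) (.seq c d :: K, s) v :=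
  ExpectLe.of_pure rfl h

theorem ExpectLe.whileTrue {t : Test} {c : Cmd} (ht : t.Holds p s)
    (h : ExpectLe p F N (c :: .while t c :: K, s) v) :
    ExpectLe p F (N + 1) (.while t c :: K, s) v :=
  ExpectLe.of_pure (by rw [step, if_pos ht]) h

theorem ExpectLe.runs {c : Cmd} {R : Mem → Prop} (h : Runs p c B s R)
    (h' : ∀ s', Frame c s s' → R s' → ExpectLe p F N (K, s') v) :
    ExpectLe p F (N + B) (c :: K, s) v := by
  obtain ⟨s', k, h1, h2, h3⟩ := h
  intro l hl
  have h4 := h' s' h1.frame h3 (l - k) (by omega)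
  have h5 := h1.run_eq (l - k) K
  rw [show k + (l - k) = l by omega] at h5
  unfold expect at h4 ⊢
  rwa [h5]

theorem coin_true (q : ℝ) (h0 : 0 ≤ q) (h1 : q ≤ 1) : coin q true = ENNReal.ofReal q := by
  simp [coin, PMF.ofFintype_apply, h0, h1]

theorem coin_false (q : ℝ) (h0 : 0 ≤ q) (h1 : q ≤ 1) : coin q false = ENNReal.ofReal (1 - q) := by
  simp [coin, PMF.ofFintype_apply, h0, h1]

/-- Condition on the first step. The values are real and nonnegative, so that the convex combination
can be formed before passing to extended nonnegative reals. -/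
theorem ExpectLe.flip {arr : ℕ} {i j k : NatExp} {q : RealExp} {v₁ v₀ : ℝ} (hv1 : 0 ≤ v₁)
    (hv0 : 0 ≤ v₀) (h0 : 0 ≤ q.eval p s) (h1 : q.eval p s ≤ 1)
    (ht : ExpectLe p F N (K, s.setNat arr (i.eval s) (j.eval s) (k.eval s) 1) (ENNReal.ofReal v₁))
    (hf : ExpectLe p F N (K, s.setNat arr (i.eval s) (j.eval s) (k.eval s) 0)
      (ENNReal.ofReal v₀)) :
    ExpectLe p F (N + 1) (.flip arr i j k q :: K, s)
      (ENNReal.ofReal (q.eval p s * v₁ + (1 - q.eval p s) * v₀)) := by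
  intro l hl
  obtain ⟨l, rfl⟩ : ∃ a, l = a + 1 := ⟨l - 1, by omega⟩
  have hrun : run p (l + 1) (.flip arr i j k q :: K, s) = (coin (q.eval p s)).bind fun b =>
      run p l (K, s.setNat arr (i.eval s) (j.eval s) (k.eval s) (if b then 1 else 0)) := by
    rw [run, step, PMF.bind_map]
    rfl
  have hexp : expect p F (l + 1) (.flip arr i j k q :: K, s) =
      ∑' b, coin (q.eval p s) b * expect p F l
        (K, s.setNat arr (i.eval s) (j.eval s) (k.eval s) (if b then 1 else 0)) := by
    simp only [expect, hrun, PMF.bind_apply, ← ENNReal.tsum_mul_right, ← ENNReal.tsum_mul_left]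
    rw [ENNReal.tsum_comm]
    simp only [mul_assoc]
  rw [hexp, tsum_bool, coin_true _ h0 h1, coin_false _ h0 h1, add_comm,
    ENNReal.ofReal_add (mul_nonneg h0 hv1) (mul_nonneg (sub_nonneg.2 h1) hv0),
    ENNReal.ofReal_mul h0, ENNReal.ofReal_mul (sub_nonneg.2 h1)]
  exact add_le_add (mul_le_mul_right (by simpa using ht l (by omega)) _)
    (mul_le_mul_right (by simpa using hf l (by omega)) _)

theorem expect_nil (s : Mem) (k : ℕ) : expect p F k ([], s) = F ([], s) := by
  have hrun : ∀ k, run p k ([], s) = PMF.pure ([], s) := by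
    intro k
    induction k with
    | zero => rfl
    | succ k ih => rw [run, step, PMF.pure_bind, ih]
  rw [expect, hrun, tsum_eq_single ([], s)]
  · simp
  · intro c hc
    simp [hc]

end ExpectLe

/-! ## The program

Arrays of natural numbers: 6 holds the size, 7 to 11 are loop counters (machine, job, deadline,
summation index, iteration), 12 and 13 hold the choices of the conditional gradient method, 3 and 5
the sampled machines and deadlines, 4 the start times, 16 a coin, 17 a sum, 18 is never read.
Arrays of real numbers: 1 holds the essential weight, 2 the loads, 3 a partial derivative, 4 the
smallest one so far, 5 a sum. -/

section Sums

/-- A command without effect on the relevant memory. -/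
def skipCmd : Cmd := setN 18 (.lit 0)

/-- Sum of the values of `e` over those `v < N` that pass the test `t`. -/
def sumNat (acc v : ℕ) (N : NatExp) (t : Test) (e : NatExp) : Cmd :=
  .seq (setN acc (.lit 0)) (forLoop v N (.ite t (setN acc (.add (nvar acc) e)) skipCmd))

/-- Sum of the values of `e` over those `v < N` that pass the test `t`. -/
def sumReal (acc v : ℕ) (N : NatExp) (t : Test) (e : RealExp) : Cmd :=
  .seq (setR acc (.cast (.lit 0))) (forLoop v N (.ite t (setR acc (.add (rvar acc) e)) skipCmd))

variable {p : ℝ} {X : ℕ} {c d : Cmd} {s : Mem} {R R' : Mem → Prop} {e e' : ℕ}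

theorem Runs.weaken (h : Runs p c (X ^ e) s R) (hX : 3 ≤ X) (he : e ≤ e') :
    Runs p c (X ^ e') s R :=
  h.mono (Nat.pow_le_pow_right (by omega) he) fun _ _ h => h

theorem Runs.setNat_pow (hX : 3 ≤ X) {arr : ℕ} {i j k f : NatExp}
    (h : R (s.setNat arr (i.eval s) (j.eval s) (k.eval s) (f.eval s))) :
    Runs p (.setNat arr i j k f) (X ^ e) s R :=
  (Runs.setNat h).mono (Nat.one_le_pow _ _ (by omega)) fun _ _ h => h

theorem Runs.setReal_pow (hX : 3 ≤ X) {arr : ℕ} {i j k : NatExp} {f : RealExp}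
    (h : R (s.setReal arr (i.eval s) (j.eval s) (k.eval s) (f.eval p s))) :
    Runs p (.setReal arr i j k f) (X ^ e) s R :=
  (Runs.setReal h).mono (Nat.one_le_pow _ _ (by omega)) fun _ _ h => h

/-- Step counts are only tracked as powers of the size X ≥ 3: 2 X^e + 1 ≤ X^(e+1). Sequencing and
branching cost one exponent each, a loop of at most X rounds costs three. -/
theorem Runs.seq_pow (hX : 3 ≤ X) (h : Runs p c (X ^ e) s R)
    (h' : ∀ s', Frame c s s' → R s' → Runs p d (X ^ e) s' R') :
    Runs p (.seq c d) (X ^ (e + 1)) s R' := by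
  refine (Runs.seq h h').mono ?_ fun _ _ h => h
  have h1 : 1 ≤ X ^ e := Nat.one_le_pow _ _ (by omega)
  rw [pow_succ]
  nlinarith

theorem Runs.ite_pow (hX : 3 ≤ X) {t : Test} (h : t.Holds p s → Runs p c (X ^ e) s R)
    (h' : ¬ t.Holds p s → Runs p d (X ^ e) s R) : Runs p (.ite t c d) (X ^ (e + 1)) s R := by
  refine (Runs.ite h h').mono ?_ fun _ _ h => h
  have h1 : 1 ≤ X ^ e := Nat.one_le_pow _ _ (by omega)
  rw [pow_succ]
  nlinarith

theorem loop_steps_le (hX : 3 ≤ X) {n a : ℕ} (hn : n ≤ X ^ a) :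
    n * (X ^ e + 3) + 3 ≤ X ^ (a + e + 2) := by
  have h1 : 1 ≤ X ^ e := Nat.one_le_pow _ _ (by omega)
  have h2 : 1 ≤ X ^ a := Nat.one_le_pow _ _ (by omega)
  have h3 : X ^ (a + e + 2) = X ^ a * X ^ e * X ^ 2 := by ring
  have h4 : 9 ≤ X ^ 2 := by nlinarith
  calc n * (X ^ e + 3) + 3 ≤ X ^ a * (4 * X ^ e) + 3 * (X ^ a * X ^ e) := by
        have h5 : 1 ≤ X ^ a * X ^ e := Nat.mul_pos h2 h1
        have h6 : n * (X ^ e + 3) ≤ X ^ a * (4 * X ^ e) := Nat.mul_le_mul hn (by omega)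
        omega
    _ = X ^ a * X ^ e * 7 := by ring
    _ ≤ X ^ a * X ^ e * X ^ 2 := Nat.mul_le_mul_left _ (by omega)
    _ = _ := h3.symm

theorem Runs.forLoop_pow (hX : 3 ≤ X) {v : ℕ} {N : NatExp} {n : ℕ} (hn : n ≤ X)
    (Inv : ℕ → Mem → Prop) (hv : c.natFree v = true)
    (hN : ∀ s', Frame (UnrelatedScheduling.forLoop v N c) s s' → N.eval s' = n)
    (h0 : Inv 0 (s.setNat v 0 0 0 0))
    (hstep : ∀ i < n, ∀ s', Frame (UnrelatedScheduling.forLoop v N c) s s' →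
      s'.nat v 0 0 0 = i → Inv i s' →
      Runs p c (X ^ e) s' fun s'' => Inv (i + 1) (s''.setNat v 0 0 0 (i + 1))) :
    Runs p (UnrelatedScheduling.forLoop v N c) (X ^ (e + 3)) s (Inv n) := by
  refine (Runs.forLoop Inv hv hN h0 hstep).mono ?_ fun _ _ h => h
  have := loop_steps_le (e := e) hX (show n ≤ X ^ 1 by simpa using hn)
  rwa [show 1 + e + 2 = e + 3 by ring] at this

theorem sum_range_succ_dite {M : Type*} [AddCommMonoid M] {n : ℕ} (G : Fin n → M) {i : ℕ}
    (hi : i < n) : (∑ l ∈ Finset.range (i + 1), if h : l < n then G ⟨l, h⟩ else 0) =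
      (∑ l ∈ Finset.range i, if h : l < n then G ⟨l, h⟩ else 0) + G ⟨i, hi⟩ := by
  rw [Finset.sum_range_succ, dif_pos hi]

theorem sum_range_dite {M : Type*} [AddCommMonoid M] {n : ℕ} (G : Fin n → M) :
    (∑ l ∈ Finset.range n, if h : l < n then G ⟨l, h⟩ else 0) = ∑ l, G l := by
  rw [Finset.sum_range]
  simp

theorem runs_sumNat (hX : 3 ≤ X) {acc v : ℕ} {N : NatExp} {t : Test} {f : NatExp} {n : ℕ}
    (hn : n ≤ X) (hva : v ≠ acc) (hv : v ≠ 18) (ha : acc ≠ 18)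
    (hN : ∀ s', Frame (sumNat acc v N t f) s s' → N.eval s' = n) (G : Fin n → ℕ)
    (hG : ∀ s', Frame (sumNat acc v N t f) s s' → ∀ i : Fin n, s'.nat v 0 0 0 = i →
      (t.Holds p s' → f.eval s' = G i) ∧ (¬ t.Holds p s' → G i = 0)) :
    Runs p (sumNat acc v N t f) (X ^ 5) s fun s' => s'.nat acc 0 0 0 = ∑ i, G i := by
  refine Runs.seq_pow hX (R := fun s' => s'.nat acc 0 0 0 = 0) (Runs.setNat_pow hX ?_) ?_
  · simp [NatExp.eval]
  intro s₁ hf₁ h₁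
  have hfr : ∀ s', Frame (forLoop v N (.ite t (setN acc (.add (nvar acc) f)) skipCmd)) s₁ s' →
      Frame (sumNat acc v N t f) s s' := fun s' h =>
    (hf₁.mono (by simp +contextual [sumNat, Cmd.natFree])
      (by simp +contextual [sumNat, Cmd.realFree])).trans
      (h.mono (by simp +contextual [sumNat, Cmd.natFree])
      (by simp +contextual [sumNat, Cmd.realFree]))
  refine (Runs.forLoop_pow (e := 1) hX hn (fun i s' => s'.nat acc 0 0 0 =
    ∑ l ∈ Finset.range i, if h : l < n then G ⟨l, h⟩ else 0) ?_ (fun s' h => hN s' (hfr s' h)) ?_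
    ?_).mono le_rfl fun s' _ h => by rw [h, sum_range_dite]
  · simp [Cmd.natFree, setN, skipCmd, hva.symm, hv.symm]
  · simp [hva.symm, h₁]
  · intro i hi s' hf hs hinv
    obtain ⟨hg1, hg2⟩ := hG s' (hfr s' hf) ⟨i, hi⟩ hs
    refine Runs.ite_pow (e := 0) hX (fun ht => Runs.setNat_pow hX ?_)
      fun ht => Runs.setNat_pow hX ?_
    · rw [sum_range_succ_dite G hi, ← hg1 ht, ← hinv]
      simp [NatExp.eval, hva.symm]
    · rw [sum_range_succ_dite G hi, hg2 ht, ← hinv]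
      simp [hva.symm, ha]

theorem runs_sumReal (hX : 3 ≤ X) {acc v : ℕ} {N : NatExp} {t : Test} {f : RealExp} {n : ℕ}
    (hn : n ≤ X) (hv : v ≠ 18)
    (hN : ∀ s', Frame (sumReal acc v N t f) s s' → N.eval s' = n) (G : Fin n → ℝ)
    (hG : ∀ s', Frame (sumReal acc v N t f) s s' → ∀ i : Fin n, s'.nat v 0 0 0 = i →
      (t.Holds p s' → f.eval p s' = G i) ∧ (¬ t.Holds p s' → G i = 0)) :
    Runs p (sumReal acc v N t f) (X ^ 5) s fun s' => s'.real acc 0 0 0 = ∑ i, G i := by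
  refine Runs.seq_pow hX (R := fun s' => s'.real acc 0 0 0 = 0) (Runs.setReal_pow hX ?_) ?_
  · simp [NatExp.eval, RealExp.eval]
  intro s₁ hf₁ h₁
  have hfr : ∀ s', Frame (forLoop v N (.ite t (setR acc (.add (rvar acc) f)) skipCmd)) s₁ s' →
      Frame (sumReal acc v N t f) s s' := fun s' h =>
    (hf₁.mono (by simp +contextual [sumReal, Cmd.natFree])
      (by simp +contextual [sumReal, Cmd.realFree])).trans
      (h.mono (by simp +contextual [sumReal, Cmd.natFree])
      (by simp +contextual [sumReal, Cmd.realFree]))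
  refine (Runs.forLoop_pow (e := 1) hX hn (fun i s' => s'.real acc 0 0 0 =
    ∑ l ∈ Finset.range i, if h : l < n then G ⟨l, h⟩ else 0) ?_ (fun s' h => hN s' (hfr s' h)) ?_
    ?_).mono le_rfl fun s' _ h => by rw [h, sum_range_dite]
  · simp [Cmd.natFree, setN, setR, skipCmd, hv.symm]
  · simp [h₁]
  · intro i hi s' hf hs hinv
    obtain ⟨hg1, hg2⟩ := hG s' (hfr s' hf) ⟨i, hi⟩ hs
    refine Runs.ite_pow (e := 0) hX (fun ht => Runs.setReal_pow hX ?_)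
      fun ht => Runs.setNat_pow hX ?_
    · rw [sum_range_succ_dite G hi, ← hg1 ht, ← hinv]
      simp [RealExp.eval, NatExp.eval]
    · rw [sum_range_succ_dite G hi, hg2 ht, ← hinv]
      simp

end Sums

/-! ### Preparations -/

section Preparations

variable {n m : ℕ} {p : ℝ} {s s' : Mem}

/-- The memory contains the instance. -/
structure Holds (I : Instance n m) (s : Mem) : Prop where
  jobs : s.nat 0 0 0 0 = n
  machines : s.nat 1 0 0 0 = m
  proc : ∀ (i : Fin m) (j : Fin n), s.nat 2 i j 0 = I.proc i j
  weight : ∀ j : Fin n, s.real 0 j 0 0 = I.weight j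

theorem Holds.frame {I : Instance n m} {c : Cmd} (h : Holds I s) (hf : Frame c s s')
    (hc : (c.natFree 0 && c.natFree 1 && c.natFree 2 && c.realFree 0) = true) : Holds I s' := by
  simp only [Bool.and_eq_true] at hc
  obtain ⟨⟨⟨h0, h1⟩, h2⟩, h3⟩ := hc
  exact ⟨by rw [hf.nat 0 h0, h.jobs], by rw [hf.nat 1 h1, h.machines],
    fun i j => by rw [hf.nat 2 h2, h.proc], fun j => by rw [hf.real 0 h3, h.weight]⟩

/-- The memory contains the instance, its size and its essential weight. -/
structure Ready (I : Instance n m) (s : Mem) : Prop extends Holds I s where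
  size : s.nat 6 0 0 0 = I.size
  essentialWeight : s.real 1 0 0 0 = I.essentialWeight

theorem Ready.frame {I : Instance n m} {c : Cmd} (h : Ready I s) (hf : Frame c s s')
    (hc : ((c.natFree 0 && c.natFree 1 && c.natFree 2 && c.realFree 0) &&
      (c.natFree 6 && c.realFree 1)) = true) : Ready I s' := by
  rw [Bool.and_eq_true, Bool.and_eq_true (c.natFree 6)] at hc
  exact { h.toHolds.frame hf hc.1 with
    size := by rw [hf.nat 6 hc.2.1, h.size]
    essentialWeight := by rw [hf.real 1 hc.2.2, h.essentialWeight] }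

/-- The processing time of the current job on the current machine. -/
def procExp : NatExp := .get 2 (nvar 7) (nvar 8) (.lit 0)

/-- Compute the size of the instance. -/
def computeSize : Cmd :=
  .seq (setN 6 (.add (.add (nvar 0) (nvar 1)) (.lit 2)))
    (forLoop 7 (nvar 1) (.seq (sumNat 17 8 (nvar 0) (.natLe (.lit 0) (.lit 0)) procExp)
      (setN 6 (.add (nvar 6) (nvar 17)))))

/-- Compute the essential weight of the instance. -/
def computeWeight : Cmd :=
  .seq (setR 1 (.cast (.lit 0)))
    (forLoop 8 (nvar 0) (.seq (sumNat 17 7 (nvar 1) (.natLe procExp (.lit 0)) (.lit 1))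
      (.ite (.natLe (nvar 17) (.lit 0))
        (setR 1 (.add (rvar 1) (.get 0 (nvar 8) (.lit 0) (.lit 0)))) skipCmd)))

/-- The power `size ^ e`. -/
def sizePow : ℕ → RealExp
  | 0 => .cast (.lit 1)
  | e + 1 => .mul (sizePow e) (.cast (nvar 6))

theorem sizePow_eval {I : Instance n m} (h : Ready I s) (e : ℕ) :
    (sizePow e).eval p s = (I.size : ℝ) ^ e := by
  induction e with
  | zero => simp [sizePow, RealExp.eval, NatExp.eval]
  | succ e ih => simp [sizePow, RealExp.eval, ih, h.size, pow_succ]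

variable (I : Instance n m)

theorem Instance.jobs_le_size : n ≤ I.size := by unfold Instance.size; omega

theorem Instance.machines_le_size : m ≤ I.size := by unfold Instance.size; omega

theorem Instance.three_le_size [NeZero m] : 3 ≤ I.size := by
  have := NeZero.pos m
  unfold Instance.size; omega

variable [NeZero m]

theorem runs_computeSize (h : Holds I s) :
    Runs p computeSize (I.size ^ 10) s fun s' => s'.nat 6 0 0 0 = I.size := by
  have hX := I.three_le_size
  refine Runs.seq_pow hX (R := fun s' => s'.nat 6 0 0 0 = n + m + 2) (Runs.setNat_pow hX ?_) ?_
  · simp [NatExp.eval, h.jobs, h.machines]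
  intro s₁ hf₁ h₁
  have hh₁ := h.frame hf₁ rfl
  refine (Runs.forLoop_pow (e := 6) hX I.machines_le_size (fun i s' => s'.nat 6 0 0 0 = n + m + 2 +
    ∑ l ∈ Finset.range i, if h : l < m then ∑ j, I.proc ⟨l, h⟩ j else 0) rfl
    (fun s' hf => by exact (hh₁.frame hf rfl).machines) ?_ ?_).mono le_rfl fun s' _ h => ?_
  · simp [h₁]
  · intro i hi s₂ hf₂ hi₂ hinv
    have hh₂ := hh₁.frame hf₂ rfl
    refine Runs.seq_pow hX (runs_sumNat hX I.jobs_le_size (by norm_num) (by norm_num) (by norm_num)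
      (fun s' hf => by exact (hh₂.frame hf rfl).jobs) (fun j => I.proc ⟨i, hi⟩ j) ?_) ?_
    · intro s' hf j hj
      have hh := hh₂.frame hf rfl
      have h7 : s'.nat 7 0 0 0 = i := by rw [hf.nat 7 rfl, hi₂]
      refine ⟨fun _ => ?_, fun h => absurd le_rfl h⟩
      simp only [procExp, NatExp.eval, nvar_eval, h7, hj]
      exact hh.proc ⟨i, hi⟩ j
    · intro s₃ hf₃ h₃
      refine Runs.setNat_pow hX ?_
      rw [sum_range_succ_dite (fun i => ∑ j, I.proc i j) hi]
      simp [NatExp.eval, h₃, hf₃.nat 6 rfl, hinv, add_assoc]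
  · rw [h, sum_range_dite (fun i => ∑ j, I.proc i j)]
    unfold Instance.size Instance.horizon
    ring

open Classical in
theorem runs_computeWeight (h : Holds I s) :
    Runs p computeWeight (I.size ^ 10) s fun s' => s'.real 1 0 0 0 = I.essentialWeight := by
  have hX := I.three_le_size
  refine Runs.seq_pow hX (R := fun s' => s'.real 1 0 0 0 = 0) (Runs.setReal_pow hX ?_) ?_
  · simp [NatExp.eval, RealExp.eval]
  intro s₁ hf₁ h₁
  have hh₁ := h.frame hf₁ rfl
  refine (Runs.forLoop_pow (e := 6) hX I.jobs_le_size (fun i s' => s'.real 1 0 0 0 =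
    ∑ l ∈ Finset.range i, if h : l < n then
      (fun j => if ∀ i, I.proc i j ≠ 0 then I.weight j else 0) ⟨l, h⟩ else 0) rfl
    (fun s' hf => by exact (hh₁.frame hf rfl).jobs) ?_ ?_).mono le_rfl fun s' _ h => ?_
  · simp [h₁]
  · intro j hj s₂ hf₂ hj₂ hinv
    have hh₂ := hh₁.frame hf₂ rfl
    refine Runs.seq_pow hX (runs_sumNat hX I.machines_le_size (by norm_num) (by norm_num)
      (by norm_num) (fun s' hf => by exact (hh₂.frame hf rfl).machines)
      (fun i => if I.proc i ⟨j, hj⟩ = 0 then 1 else 0) ?_) ?_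
    · intro s' hf i hi
      have hh := hh₂.frame hf rfl
      have h8 : s'.nat 8 0 0 0 = j := by rw [hf.nat 8 rfl, hj₂]
      have hp : procExp.eval s' = I.proc i ⟨j, hj⟩ := by
        simp only [procExp, NatExp.eval, nvar_eval, h8, hi]
        exact hh.proc i ⟨j, hj⟩
      simp only [Test.Holds, NatExp.eval, hp, Nat.le_zero]
      exact ⟨fun h => by rw [if_pos h], fun h => by rw [if_neg h]⟩
    · intro s₃ hf₃ h₃
      have hh₃ := hh₂.frame hf₃ rfl
      have h8 : s₃.nat 8 0 0 0 = j := by rw [hf₃.nat 8 rfl, hj₂]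
      -- The sum counts the machines on which the job takes no time; the job is essential exactly if
      -- the count is zero.
      have hiff : s₃.nat 17 0 0 0 ≤ 0 ↔ ∀ i, I.proc i ⟨j, hj⟩ ≠ 0 := by
        rw [h₃, Nat.le_zero, Finset.sum_eq_zero_iff]
        simp
      have hw : (RealExp.get 0 (nvar 8) (.lit 0) (.lit 0)).eval p s₃ = I.weight ⟨j, hj⟩ := by
        simp only [RealExp.eval, NatExp.eval, nvar_eval, h8]
        exact hh₃.weight ⟨j, hj⟩
      refine Runs.ite_pow (e := 4) hX (fun ht => Runs.setReal_pow hX ?_)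
        fun ht => Runs.setNat_pow hX ?_
      · rw [sum_range_succ_dite (fun j => if ∀ i, I.proc i j ≠ 0 then I.weight j else 0) hj,
          if_pos (hiff.1 ht), ← hinv, ← hf₃.real 1 rfl, ← hw]
        simp [RealExp.eval, NatExp.eval]
      · rw [sum_range_succ_dite (fun j => if ∀ i, I.proc i j ≠ 0 then I.weight j else 0) hj,
          if_neg (fun h => ht (hiff.2 h)), ← hinv, ← hf₃.real 1 rfl]
        simp
  · rw [h, sum_range_dite (fun j => if ∀ i, I.proc i j ≠ 0 then I.weight j else 0)]
    rfl

/-! ### Partial derivatives -/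

/-- The load of the current machine at the summation index. -/
def loadExp : RealExp := .get 2 (nvar 7) (nvar 10) (.lit 0)

/-- Compute the partial derivative for the current machine, job and deadline. -/
def computeGradient (e : ℕ) : Cmd :=
  .seq (sumReal 3 10 (nvar 6) (.realLe (.cast (nvar 10)) loadExp)
      (.mul (.cast (.sub (.lit 1) (.sub (nvar 9) (nvar 10)))) (.sub loadExp (.cast (nvar 10)))))
    (setR 3 (.add (.mul (.get 0 (nvar 8) (.lit 0) (.lit 0)) (.pow (nvar 9)))
      (.mul (.mul (.cast (.lit 2)) (.mul (rvar 1) (sizePow e))) (.mul (.cast procExp) (rvar 3)))))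

theorem runs_computeGradient {I : Instance n m} (h : Ready I s) (e : ℕ) (L : Fin m → ℕ → ℝ)
    (hL : ∀ i C, C < I.size → s.real 2 (i : Fin m) C 0 = L i C) (j : Fin n) (q : I.Choice)
    (h7 : s.nat 7 0 0 0 = q.1) (h8 : s.nat 8 0 0 0 = j) (h9 : s.nat 9 0 0 0 = q.2) :
    Runs p (computeGradient e) (I.size ^ 6) s fun s' => s'.real 3 0 0 0 =
      I.gradient p (I.essentialWeight * (I.size : ℝ) ^ e) L j q := by
  have hX := I.three_le_size
  refine Runs.seq_pow hX (runs_sumReal hX le_rfl (by norm_num)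
    (fun s' hf => by exact (h.frame hf rfl).size)
    (fun C : Fin I.size => if (q.2 : ℕ) ≤ C then Instance.excess L q.1 C else 0) ?_) ?_
  · intro s' hf C hC
    have e7 : s'.nat 7 0 0 0 = q.1 := by rw [hf.nat 7 rfl, h7]
    have e9 : s'.nat 9 0 0 0 = q.2 := by rw [hf.nat 9 rfl, h9]
    have eL : loadExp.eval p s' = L q.1 C := by
      simp only [loadExp, RealExp.eval, NatExp.eval, nvar_eval, e7, hC]
      rw [hf.real 2 rfl, hL _ _ C.is_lt]
    simp only [Test.Holds, RealExp.eval, NatExp.eval, nvar_eval, eL, hC, e9]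
    constructor
    · intro hle
      have hex : Instance.excess L q.1 C = L q.1 C - (C : ℕ) := max_eq_right (sub_nonneg.2 hle)
      -- Tests have no conjunction, so the condition on the deadline is coded as the factor 1 - (q.2
      -- - C) in truncated subtraction, which is 1 if q.2 ≤ C and 0 otherwise.
      split_ifs with hq
      · rw [hex, Nat.sub_eq_zero_of_le hq]
        simp
      · rw [Nat.sub_eq_zero_of_le (show 1 ≤ (q.2 : ℕ) - C by omega)]
        simp
    · intro hle
      have hex : Instance.excess L q.1 C = 0 := max_eq_left (by linarith)
      simp [hex]
  · intro s₁ hf₁ h₁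
    have hr := h.frame hf₁ rfl
    refine Runs.setReal_pow hX ?_
    have e7 : s₁.nat 7 0 0 0 = q.1 := by rw [hf₁.nat 7 rfl, h7]
    have e8 : s₁.nat 8 0 0 0 = j := by rw [hf₁.nat 8 rfl, h8]
    have e9 : s₁.nat 9 0 0 0 = q.2 := by rw [hf₁.nat 9 rfl, h9]
    have hp : procExp.eval s₁ = I.proc q.1 j := by
      simp only [procExp, NatExp.eval, nvar_eval, e7, e8]
      exact hr.proc q.1 j
    simp only [RealExp.eval, NatExp.eval, nvar_eval, rvar_eval, hp, sizePow_eval hr,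
      hr.essentialWeight, e8, e9, hr.weight, h₁, Mem.setReal_real_self, Instance.gradient]
    rw [Finset.sum_range]
    norm_num

end Preparations

section ConditionalGradient

/-! ### The best choice of a job -/

/-- The entry of the array `a` for the current iteration and the job with number `j`. -/
def choiceExp (a j : ℕ) : NatExp := .get a (nvar 11) (nvar j) (.lit 0)

/-- Set the entry of the array `a` for the current iteration and job. -/
def setChoice (a : ℕ) (e : NatExp) : Cmd := .setNat a (nvar 11) (nvar 8) (.lit 0) e

/-- Record the current machine and deadline as the best choice so far. -/
def recordChoice : Cmd :=
  .seq (setR 4 (rvar 3)) (.seq (setChoice 12 (nvar 7)) (setChoice 13 (nvar 9)))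

/-- Compare the current machine and deadline with the best choice so far. -/
def tryChoice (e : ℕ) : Cmd :=
  .ite (.natLe procExp (nvar 9))
    (.seq (computeGradient e) (.ite (.realLe (rvar 4) (rvar 3)) skipCmd recordChoice)) skipCmd

/-- Find the machine and the deadline with the smallest partial derivative for the current job. -/
def chooseBest (e : ℕ) : Cmd :=
  .seq (.seq (setN 7 (.lit 0)) (.seq (setN 9 (.sub (nvar 6) (.lit 1)))
    (.seq (computeGradient e) recordChoice)))
    (forLoop 7 (nvar 1) (forLoop 9 (nvar 6) (tryChoice e)))

variable {n m : ℕ} {p : ℝ} {s s₀ s' : Mem} {I : Instance n m}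

/-- The memory contains the choice `q` for job `j` in iteration `k`. -/
def HasChoice (I : Instance n m) (s : Mem) (k j : ℕ) (q : I.Choice) : Prop :=
  s.nat 12 k j 0 = q.1 ∧ s.nat 13 k j 0 = q.2

/-- The recorded choices agree except for job `j` in iteration `k`. -/
def AgreeOff (k j : ℕ) (s s' : Mem) : Prop :=
  ∀ k' j', ¬ (k' = k ∧ j' = j) →
    s'.nat 12 k' j' 0 = s.nat 12 k' j' 0 ∧ s'.nat 13 k' j' 0 = s.nat 13 k' j' 0

/-- The memory contains the best admissible choice among those that satisfy `T`. -/
structure Best (I : Instance n m) (g : I.Choice → ℝ) (k : ℕ) (j : Fin n) (s₀ : Mem)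
    (T : I.Choice → Prop) (s : Mem) : Prop where
  best : ∃ q : I.Choice, I.Admissible j q ∧ s.real 4 0 0 0 = g q ∧ HasChoice I s k j q ∧
    ∀ q', T q' → I.Admissible j q' → g q ≤ g q'
  agree : AgreeOff k j s₀ s

theorem Best.congr {g : I.Choice → ℝ} {k : ℕ} {j : Fin n} {T : I.Choice → Prop}
    (h : Best I g k j s₀ T s) {T' : I.Choice → Prop} (hT : ∀ q, T' q → T q)
    (h12 : s'.nat 12 = s.nat 12) (h13 : s'.nat 13 = s.nat 13) (h4 : s'.real 4 = s.real 4) :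
    Best I g k j s₀ T' s' := by
  obtain ⟨⟨q, h1, h2, h3, h5⟩, h6⟩ := h
  refine ⟨⟨q, h1, by rw [h4, h2], ?_, fun q' hq' => h5 q' (hT q' hq')⟩, ?_⟩
  · unfold HasChoice at *
    rwa [h12, h13]
  · unfold AgreeOff at *
    rwa [h12, h13]

theorem HasChoice.congr {k : ℕ} {j : ℕ} {q : I.Choice} (h : HasChoice I s k j q)
    (h12 : s'.nat 12 k j 0 = s.nat 12 k j 0) (h13 : s'.nat 13 k j 0 = s.nat 13 k j 0) :
    HasChoice I s' k j q := by
  unfold HasChoice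
  rwa [h12, h13]

/-- The test whether the iteration counter is below `size ^ e`. -/
def iterTest (e : ℕ) : Test := .realLe (.cast (.add (nvar 11) (.lit 1))) (sizePow e)

theorem iterTest_holds {e : ℕ} (h : Ready I s) :
    (iterTest e).Holds p s ↔ s.nat 11 0 0 0 + 1 ≤ I.size ^ e := by
  simp only [iterTest, Test.Holds, RealExp.eval, NatExp.eval, nvar_eval, sizePow_eval h]
  rw [← Nat.cast_pow, Nat.cast_le]

theorem runs_recordChoice {X e : ℕ} (hX : 3 ≤ X) {g : I.Choice → ℝ} {k : ℕ} {j : Fin n}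
    {q : I.Choice} {T : I.Choice → Prop} (hk : s.nat 11 0 0 0 = k) (h7 : s.nat 7 0 0 0 = q.1)
    (h8 : s.nat 8 0 0 0 = j) (h9 : s.nat 9 0 0 0 = q.2) (h3 : s.real 3 0 0 0 = g q)
    (hq : I.Admissible j q) (hT : ∀ q', T q' → I.Admissible j q' → g q ≤ g q')
    (ha : AgreeOff k j s₀ s) :
    Runs p recordChoice (X ^ (e + 2)) s (Best I g k j s₀ T) := by
  refine Runs.seq_pow hX (Runs.setReal_pow (R := fun s' => s' = s.setReal 4 0 0 0 (g q)) hX ?_) ?_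
  · simp [NatExp.eval, h3]
  rintro s₁ - rfl
  refine Runs.seq_pow hX (Runs.setNat_pow
    (R := fun s' => s' = (s.setReal 4 0 0 0 (g q)).setNat 12 k j 0 q.1) hX ?_) ?_
  · simp [NatExp.eval, h7, hk, h8]
  rintro s₂ - rfl
  refine Runs.setNat_pow hX ⟨⟨q, hq, ?_, ?_, hT⟩, ?_⟩
  · simp
  · simp [HasChoice, NatExp.eval, hk, h8, h9]
  · intro k' j' hne
    have := ha k' j' hne
    have hne' : ¬ (k' = k ∧ j' = j ∧ True) := fun h => hne ⟨h.1, h.2.1⟩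
    simp only [NatExp.eval, nvar_eval, Mem.setNat_nat, Mem.setReal_nat, ne_eq,
      Nat.reduceEqDiff, not_false_eq_true, Mem.setNat_nat_ne, hk, h8, hne', if_false]
    exact this

variable [NeZero m]

theorem runs_tryChoice (h : Ready I s) (e : ℕ) {L : Fin m → ℕ → ℝ}
    (hL : ∀ i C, C < I.size → s.real 2 (i : Fin m) C 0 = L i C) {k : ℕ} {j : Fin n}
    {q : I.Choice} {T : I.Choice → Prop} (hk : s.nat 11 0 0 0 = k)
    (h7 : s.nat 7 0 0 0 = q.1) (h8 : s.nat 8 0 0 0 = j) (h9 : s.nat 9 0 0 0 = q.2)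
    (hbest : Best I (I.gradient p (I.essentialWeight * (I.size : ℝ) ^ e) L j) k j s₀ T s) :
    Runs p (tryChoice e) (I.size ^ 8) s
      (Best I (I.gradient p (I.essentialWeight * (I.size : ℝ) ^ e) L j) k j s₀
        fun q' => T q' ∨ q' = q) := by
  have hX := I.three_le_size
  set g := I.gradient p (I.essentialWeight * (I.size : ℝ) ^ e) L j with hg
  have hadm : (Test.natLe procExp (nvar 9)).Holds p s ↔ I.Admissible j q := by
    simp only [Test.Holds, procExp, NatExp.eval, nvar_eval, h7, h8, h9, h.proc]
    rfl
  refine Runs.ite_pow hX (fun ht => ?_) fun ht => Runs.setNat_pow hX ?_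
  · refine Runs.seq_pow hX (runs_computeGradient h e L hL j q h7 h8 h9) ?_
    intro s₁ hf₁ h₁
    have hb₁ : Best I g k j s₀ T s₁ :=
      hbest.congr (fun _ h => h) (hf₁.nat 12 rfl) (hf₁.nat 13 rfl) (hf₁.real 4 rfl)
    obtain ⟨⟨q₀, h0, h4, hc, hmin⟩, hagree⟩ := hb₁
    refine Runs.ite_pow (e := 5) hX (fun hle => Runs.setNat_pow hX ?_) fun hle => ?_
    · simp only [Test.Holds, rvar_eval, h₁, h4] at hle
      have hb₂ : Best I g k j s₀ (fun q' => T q' ∨ q' = q) s₁ := by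
        refine ⟨⟨q₀, h0, h4, hc, fun q' hq' ha => ?_⟩, hagree⟩
        rcases hq' with hq' | rfl
        · exact hmin q' hq' ha
        · exact hle
      exact hb₂.congr (fun _ h => h) (by simp) (by simp) (by simp)
    · simp only [Test.Holds, rvar_eval, h₁, h4, not_le] at hle
      refine runs_recordChoice (e := 3) hX (q := q) (by rw [hf₁.nat 11 rfl, hk])
        (by rw [hf₁.nat 7 rfl, h7]) (by rw [hf₁.nat 8 rfl, h8]) (by rw [hf₁.nat 9 rfl, h9]) h₁
        (hadm.1 ht) (fun q' hq' ha => ?_) hagree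
      rcases hq' with hq' | rfl
      · exact hle.le.trans (hmin q' hq' ha)
      · exact le_rfl
  · obtain ⟨⟨q₀, h0, h4, hc, hmin⟩, hagree⟩ := hbest
    have hb₂ : Best I g k j s₀ (fun q' => T q' ∨ q' = q) s := by
      refine ⟨⟨q₀, h0, h4, hc, fun q' hq' ha => ?_⟩, hagree⟩
      rcases hq' with hq' | rfl
      · exact hmin q' hq' ha
      · exact absurd (hadm.2 ha) ht
    exact hb₂.congr (fun _ h => h) (by simp) (by simp) (by simp)

theorem runs_chooseBest (h : Ready I s) (e : ℕ) {L : Fin m → ℕ → ℝ}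
    (hL : ∀ i C, C < I.size → s.real 2 (i : Fin m) C 0 = L i C) {k : ℕ} {j : Fin n}
    (hk : s.nat 11 0 0 0 = k) (h8 : s.nat 8 0 0 0 = j) :
    Runs p (chooseBest e) (I.size ^ 15) s
      (Best I (I.gradient p (I.essentialWeight * (I.size : ℝ) ^ e) L j) k j s fun _ => True) := by
  have hX := I.three_le_size
  set g := I.gradient p (I.essentialWeight * (I.size : ℝ) ^ e) L j with hg
  have hlt : I.size - 1 < I.size := by omega
  refine Runs.seq_pow hX (R := Best I g k j s fun _ => False) ?_ ?_
  · refine (Runs.seq_pow (e := 8) hX (Runs.setNat_pow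
      (R := fun s' => s' = s.setNat 7 0 0 0 0) hX ?_) ?_).weaken hX (by norm_num)
    · simp [NatExp.eval]
    rintro s₁ - rfl
    refine Runs.seq_pow hX (Runs.setNat_pow
      (R := fun s' => s' = (s.setNat 7 0 0 0 0).setNat 9 0 0 0 (I.size - 1)) hX ?_) ?_
    · simp [NatExp.eval, h.size]
    rintro s₂ - rfl
    set s₂ := (s.setNat 7 0 0 0 0).setNat 9 0 0 0 (I.size - 1) with hs₂
    have h₂ : Ready I s₂ := by
      refine ⟨⟨?_, ?_, ?_, ?_⟩, ?_, ?_⟩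
      · simp [hs₂, h.jobs]
      · simp [hs₂, h.machines]
      · simp [hs₂, h.proc]
      · simp [hs₂, h.weight]
      · simp [hs₂, h.size]
      · simp [hs₂, h.essentialWeight]
    refine Runs.seq_pow hX ((runs_computeGradient h₂ e L (by simpa [hs₂] using hL) j
      (0, ⟨I.size - 1, hlt⟩) (by simp [hs₂]) (by simp [hs₂, h8]) (by simp [hs₂])).weaken hX
      le_rfl) ?_
    intro s₃ hf₃ h₃
    refine runs_recordChoice (e := 4) hX (q := (0, ⟨I.size - 1, hlt⟩))
      (by rw [hf₃.nat 11 rfl]; simp [hs₂, hk]) (by rw [hf₃.nat 7 rfl]; simp [hs₂])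
      (by rw [hf₃.nat 8 rfl]; simp [hs₂, h8]) (by rw [hf₃.nat 9 rfl]; simp [hs₂]) h₃ ?_
      (fun q' hq' => hq'.elim) ?_
    -- The search starts from machine 0 with the last deadline, which is admissible for every job
    -- because it exceeds the horizon.
    · have h1 : I.proc 0 j ≤ ∑ j, I.proc 0 j :=
        Finset.single_le_sum (f := fun j => I.proc 0 j) (fun _ _ => Nat.zero_le _)
          (Finset.mem_univ j)
      have h2 := I.sum_proc_le_horizon fun _ => 0
      have h3 := I.horizon_add_two_le_size
      simp only [Instance.Admissible]
      omega
    · intro k' j' _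
      rw [hf₃.nat 12 rfl, hf₃.nat 13 rfl]
      simp [hs₂]
  · intro s₁ hf₁ hb₁
    have h₁ := h.frame hf₁ rfl
    have hL₁ : ∀ i C, C < I.size → s₁.real 2 (i : Fin m) C 0 = L i C := by
      rw [hf₁.real 2 rfl]; exact hL
    have hk₁ : s₁.nat 11 0 0 0 = k := by rw [hf₁.nat 11 rfl, hk]
    have h8₁ : s₁.nat 8 0 0 0 = j := by rw [hf₁.nat 8 rfl, h8]
    refine (Runs.forLoop_pow (e := 11) hX I.machines_le_size
      (fun i => Best I g k j s fun q => (q.1 : ℕ) < i) rfl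
      (fun s' hf => by exact (h₁.frame hf rfl).machines) ?_ ?_).mono le_rfl
      fun s' _ hb => hb.congr (fun q _ => q.1.is_lt) rfl rfl rfl
    · exact hb₁.congr (fun q hq => absurd hq (Nat.not_lt_zero _)) (by simp) (by simp) (by simp)
    · intro i hi s₂ hf₂ hi₂ hb₂
      have h₂ := h₁.frame hf₂ rfl
      refine (Runs.forLoop_pow (e := 8) hX le_rfl
        -- Invariant of the inner loop: the choices that are lexicographically before (i, C) have
        -- been tried.
        (fun C => Best I g k j s fun q => (q.1 : ℕ) < i ∨ ((q.1 : ℕ) = i ∧ (q.2 : ℕ) < C)) rfl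
        (fun s' hf => by exact (h₂.frame hf rfl).size) ?_ ?_).mono le_rfl
        fun s' _ hb => hb.congr (fun q hq => ?_) (by simp) (by simp) (by simp)
      · exact hb₂.congr (fun q hq => by omega) (by simp) (by simp) (by simp)
      · intro C hC s₃ hf₃ hC₃ hb₃
        have h₃ := h₂.frame hf₃ rfl
        refine (runs_tryChoice (q := (⟨i, hi⟩, ⟨C, hC⟩)) h₃ e
          (by rw [hf₃.real 2 rfl, hf₂.real 2 rfl]; exact hL₁)
          (by rw [hf₃.nat 11 rfl, hf₂.nat 11 rfl, hk₁]) (by rw [hf₃.nat 7 rfl, hi₂])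
          (by rw [hf₃.nat 8 rfl, hf₂.nat 8 rfl, h8₁]) hC₃ hb₃).mono le_rfl
          fun s' _ hb => hb.congr (fun q hq => ?_) (by simp) (by simp) (by simp)
        rcases hq with hq | hq
        · exact Or.inl (Or.inl hq)
        · rcases Nat.lt_succ_iff_lt_or_eq.1 hq.2 with h | h
          · exact Or.inl (Or.inr ⟨hq.1, h⟩)
          · exact Or.inr (Prod.ext (Fin.ext hq.1) (Fin.ext h))
      · have := q.2.is_lt
        omega

/-! ### The update of the loads -/

/-- The current step length. -/
def stepExp : RealExp := .div (.cast (.lit 2)) (.cast (.add (nvar 11) (.lit 2)))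

/-- The load of the current machine and deadline. -/
def currentLoad : RealExp := .get 2 (nvar 7) (nvar 9) (.lit 0)

/-- Move the loads towards the loads of the current choices. -/
def updateLoads : Cmd :=
  forLoop 7 (nvar 1) (forLoop 9 (nvar 6) (.seq
    (sumReal 5 8 (nvar 0) (.natLe (.add (.add (.sub (choiceExp 12 8) (nvar 7))
      (.sub (nvar 7) (choiceExp 12 8))) (.sub (choiceExp 13 8) (nvar 9))) (.lit 0))
      (.cast procExp))
    (.setReal 2 (nvar 7) (nvar 9) (.lit 0) (.add (.mul (.sub (.cast (.lit 1)) stepExp) currentLoad)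
      (.mul stepExp (rvar 5))))))

theorem stepExp_eval {k : ℕ} (hk : s.nat 11 0 0 0 = k) :
    stepExp.eval p s = Instance.stepLength k := by
  simp [stepExp, RealExp.eval, NatExp.eval, hk, Instance.stepLength]

theorem runs_updateLoads (h : Ready I s) {x : Fin n → I.Choice → ℝ} {u : Fin n → I.Choice}
    {k : ℕ} (hk : s.nat 11 0 0 0 = k)
    (hL : ∀ i C, C < I.size → s.real 2 (i : Fin m) C 0 = I.load x i C)
    (hu : ∀ j : Fin n, HasChoice I s k j (u j)) :
    Runs p updateLoads (I.size ^ 12) s fun s' => ∀ i C, C < I.size →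
      s'.real 2 (i : Fin m) C 0 = I.load (I.mix (Instance.stepLength k) x u) i C := by
  have hX := I.three_le_size
  set L' := I.load (I.mix (Instance.stepLength k) x u) with hL'
  refine (Runs.forLoop_pow (e := 9) hX I.machines_le_size (fun i₀ s' => ∀ (i : Fin m) C,
    C < I.size → s'.real 2 i C 0 = if (i : ℕ) < i₀ then L' i C else I.load x i C) rfl
    (fun s' hf => by exact (h.frame hf rfl).machines) ?_ ?_).mono le_rfl
    fun s' _ hs' i C hC => by rw [hs' i C hC, if_pos i.is_lt]
  · simpa using hL
  intro i₀ hi₀ s₁ hf₁ hi₁ hinv₁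
  have h₁ := h.frame hf₁ rfl
  refine (Runs.forLoop_pow (e := 6) hX le_rfl (fun C₀ s' => ∀ (i : Fin m) C,
    C < I.size → s'.real 2 i C 0 = if (i : ℕ) < i₀ ∨ ((i : ℕ) = i₀ ∧ C < C₀) then L' i C
      else I.load x i C) rfl
    (fun s' hf => by exact (h₁.frame hf rfl).size) ?_ ?_).mono le_rfl fun s' _ hs' i C hC => ?_
  · simpa using hinv₁
  · intro C₀ hC₀ s₂ hf₂ hC₂ hinv₂
    have h₂ := h₁.frame hf₂ rfl
    have h7 : s₂.nat 7 0 0 0 = i₀ := by rw [hf₂.nat 7 rfl, hi₁]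
    have hk₂ : s₂.nat 11 0 0 0 = k := by rw [hf₂.nat 11 rfl, hf₁.nat 11 rfl, hk]
    have hu₂ : ∀ j : Fin n, HasChoice I s₂ k j (u j) := by
      unfold HasChoice
      rw [hf₂.nat 12 rfl, hf₁.nat 12 rfl, hf₂.nat 13 rfl, hf₁.nat 13 rfl]
      exact hu
    refine Runs.seq_pow hX (runs_sumReal hX I.jobs_le_size (by norm_num)
      (fun s' hf => by exact (h₂.frame hf rfl).jobs)
      (fun j => if (u j).1 = ⟨i₀, hi₀⟩ ∧ ((u j).2 : ℕ) ≤ C₀ then (I.proc ⟨i₀, hi₀⟩ j : ℝ) else 0)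
      ?_) ?_
    · intro s' hf j hj
      have h' := h₂.frame hf rfl
      have e7 : s'.nat 7 0 0 0 = i₀ := by rw [hf.nat 7 rfl, h7]
      have e9 : s'.nat 9 0 0 0 = C₀ := by rw [hf.nat 9 rfl, hC₂]
      have e11 : s'.nat 11 0 0 0 = k := by rw [hf.nat 11 rfl, hk₂]
      have hc : HasChoice I s' k j (u j) := by
        unfold HasChoice
        rw [hf.nat 12 rfl, hf.nat 13 rfl]
        exact hu₂ j
      have hp : procExp.eval s' = I.proc ⟨i₀, hi₀⟩ j := by
        simp only [procExp, NatExp.eval, nvar_eval, e7, hj]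
        exact h'.proc ⟨i₀, hi₀⟩ j
      -- Equality of machines is coded as the vanishing of both truncated differences; adding the
      -- third one expresses the conjunction by a single comparison with 0.
      have hiff : ((u j).1 = ⟨i₀, hi₀⟩ ∧ ((u j).2 : ℕ) ≤ C₀) ↔
          ((u j).1 : ℕ) - i₀ + (i₀ - (u j).1) + ((u j).2 - C₀) ≤ 0 := by
        rw [Fin.ext_iff]
        simp only
        omega
      simp only [Test.Holds, RealExp.eval, hp, choiceExp, NatExp.eval, nvar_eval, e7, e9, e11, hj,
        hc.1, hc.2, ← hiff]
      exact ⟨fun h => by rw [if_pos h], fun h => by rw [if_neg h]⟩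
    · intro s₃ hf₃ h₃
      have e7 : s₃.nat 7 0 0 0 = i₀ := by rw [hf₃.nat 7 rfl, h7]
      have e9 : s₃.nat 9 0 0 0 = C₀ := by rw [hf₃.nat 9 rfl, hC₂]
      have e11 : s₃.nat 11 0 0 0 = k := by rw [hf₃.nat 11 rfl, hk₂]
      refine Runs.setReal_pow hX fun i C hC => ?_
      simp only [RealExp.eval, NatExp.eval, nvar_eval, rvar_eval, currentLoad, stepExp_eval e11, e7,
        e9, Mem.setNat_real, Mem.setReal_real, and_true, h₃, hf₃.real 2 rfl]
      have hnew : L' ⟨i₀, hi₀⟩ C₀ = (1 - Instance.stepLength k) * I.load x ⟨i₀, hi₀⟩ C₀ +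
          Instance.stepLength k * ∑ j, if (u j).1 = ⟨i₀, hi₀⟩ ∧ ((u j).2 : ℕ) ≤ C₀ then
            (I.proc ⟨i₀, hi₀⟩ j : ℝ) else 0 := by
        rw [hL', Instance.load_mix, Instance.load_point]
      have hold : s₂.real 2 i₀ C₀ 0 = I.load x ⟨i₀, hi₀⟩ C₀ := by
        have := hinv₂ ⟨i₀, hi₀⟩ C₀ hC₀
        simpa using this
      by_cases hiC : (i : ℕ) = i₀ ∧ C = C₀
      · obtain ⟨hi, rfl⟩ := hiC
        obtain rfl : i = ⟨i₀, hi₀⟩ := Fin.ext hi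
        rw [if_pos ⟨rfl, rfl⟩, if_pos (Or.inr ⟨rfl, Nat.lt_succ_self _⟩), hnew, hold]
        simp
      · rw [if_neg hiC, hinv₂ i C hC]
        congr 1
        exact propext ⟨fun h => by omega, fun h => by omega⟩
  · simp only [Mem.setNat_real]
    rw [hs' i C hC]
    congr 1
    exact propext ⟨fun h => by omega, fun h => by omega⟩

/-! ### The iterations -/

/-- The conditional gradient method with `size ^ e₂` iterations. -/
def conditionalGradient (e₁ e₂ : ℕ) : Cmd :=
  .seq (setN 11 (.lit 0))
    (countLoop (iterTest e₂) 11 (.seq (forLoop 8 (nvar 0) (chooseBest e₁)) updateLoads))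

/-- The choices that are in the memory minimize the partial derivatives. -/
def BestChoices (I : Instance n m) (p : ℝ) (e₁ : ℕ) (u : ℕ → Fin n → I.Choice) (K : ℕ) (s : Mem) :
    Prop :=
  ∀ k < K, ∀ j : Fin n, HasChoice I s k j (u k j) ∧ I.Admissible j (u k j) ∧
    ∀ q, I.Admissible j q →
      I.gradient p (I.essentialWeight * (I.size : ℝ) ^ e₁)
        (I.load (I.iterate (fun _ _ => 0) u k)) j (u k j) ≤
      I.gradient p (I.essentialWeight * (I.size : ℝ) ^ e₁)
        (I.load (I.iterate (fun _ _ => 0) u k)) j q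

/-- The new row of choices extends u at index k only; earlier iterates do not see it, so the
recorded optimality of earlier rows persists. The program keeps only loads and choices, never the
iterate itself. -/
theorem runs_iteration (e₁ : ℕ) (h : Ready I s) {u : ℕ → Fin n → I.Choice} {k : ℕ}
    (hk : s.nat 11 0 0 0 = k) (hbest : BestChoices I p e₁ u k s)
    (hL : ∀ i C, C < I.size →
      s.real 2 (i : Fin m) C 0 = I.load (I.iterate (fun _ _ => 0) u k) i C) :
    Runs p (.seq (forLoop 8 (nvar 0) (chooseBest e₁)) updateLoads) (I.size ^ 19) s fun s' =>
      ∃ u' : ℕ → Fin n → I.Choice, BestChoices I p e₁ u' (k + 1) s' ∧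
        ∀ i C, C < I.size →
          s'.real 2 (i : Fin m) C 0 = I.load (I.iterate (fun _ _ => 0) u' (k + 1)) i C := by
  have hX := I.three_le_size
  set L := I.load (I.iterate (fun _ _ => 0) u k) with hLdef
  set g := fun j => I.gradient p (I.essentialWeight * (I.size : ℝ) ^ e₁) L j with hg
  refine Runs.seq_pow hX (R := fun s' =>
    (∀ j : Fin n, (j : ℕ) < n → ∃ q, HasChoice I s' k j q ∧ I.Admissible j q ∧
      ∀ q', I.Admissible j q' → g j q ≤ g j q') ∧
    ∀ k' ≠ k, ∀ j', s'.nat 12 k' j' 0 = s.nat 12 k' j' 0 ∧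
      s'.nat 13 k' j' 0 = s.nat 13 k' j' 0) ?_ ?_
  · refine Runs.forLoop_pow (e := 15) hX I.jobs_le_size (fun j₀ s' =>
      (∀ j : Fin n, (j : ℕ) < j₀ → ∃ q, HasChoice I s' k j q ∧ I.Admissible j q ∧
        ∀ q', I.Admissible j q' → g j q ≤ g j q') ∧
      ∀ k' ≠ k, ∀ j', s'.nat 12 k' j' 0 = s.nat 12 k' j' 0 ∧
        s'.nat 13 k' j' 0 = s.nat 13 k' j' 0) rfl
      (fun s' hf => by exact (h.frame hf rfl).jobs) ?_ ?_
    · simp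
    · intro j₀ hj₀ s₁ hf₁ hj₁ hinv
      have h₁ := h.frame hf₁ rfl
      refine (runs_chooseBest (j := ⟨j₀, hj₀⟩) h₁ e₁ (by rw [hf₁.real 2 rfl]; exact hL)
        (by rw [hf₁.nat 11 rfl, hk]) hj₁).mono le_rfl ?_
      rintro s₂ - ⟨⟨q, hq, -, hc, hmin⟩, hagree⟩
      refine ⟨fun j hj => ?_, fun k' hk' j' => ?_⟩
      · rcases Nat.lt_succ_iff_lt_or_eq.1 hj with hlt | heq
        · obtain ⟨q', hq', h2⟩ := hinv.1 j hlt
          have h3 := hagree k j fun h => by simp at h; omega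
          exact ⟨q', hq'.congr (by simp [h3.1]) (by simp [h3.2]), h2⟩
        · obtain rfl : j = ⟨j₀, hj₀⟩ := Fin.ext heq
          exact ⟨q, hc.congr (by simp) (by simp), hq, fun q' hq' => hmin q' trivial hq'⟩
      · have h3 := hagree k' j' fun h => hk' h.1
        have h4 := hinv.2 k' hk' j'
        simp [h3, h4]
  · rintro s₁ hf₁ ⟨hrow, hoth⟩
    have h₁ := h.frame hf₁ rfl
    have hk₁ : s₁.nat 11 0 0 0 = k := by rw [hf₁.nat 11 rfl, hk]
    choose v hv1 hv2 hv3 using fun j : Fin n => hrow j j.is_lt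
    have hu' : ∀ l < k, Function.update u k v l = u l := fun l hl =>
      Function.update_of_ne hl.ne _ _
    have hit : ∀ l ≤ k, I.iterate (fun _ _ => 0) (Function.update u k v) l =
        I.iterate (fun _ _ => 0) u l := fun l hl =>
      Instance.iterate_congr _ _ fun l' hl' => hu' l' (by omega)
    refine ((runs_updateLoads (x := I.iterate (fun _ _ => 0) u k) (u := v) h₁ hk₁
      (by rw [hf₁.real 2 rfl]; exact hL) hv1).weaken hX (e' := 18) (by norm_num)).mono le_rfl ?_
    intro s₂ hf₂ h₂
    refine ⟨Function.update u k v, fun l hl j => ?_, fun i C hC => ?_⟩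
    · rw [hit l (by omega)]
      rcases Nat.lt_succ_iff_lt_or_eq.1 hl with hlt | rfl
      · rw [hu' l hlt]
        obtain ⟨h3, h4⟩ := hbest l hlt j
        have h5 := hoth l hlt.ne j
        exact ⟨h3.congr (by rw [hf₂.nat 12 rfl, h5.1]) (by rw [hf₂.nat 13 rfl, h5.2]), h4⟩
      · rw [Function.update_self]
        exact ⟨(hv1 j).congr (by rw [hf₂.nat 12 rfl]) (by rw [hf₂.nat 13 rfl]), hv2 j, hv3 j⟩
    · rw [h₂ i C hC, Instance.iterate, hit k le_rfl, Function.update_self]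

theorem runs_conditionalGradient (e₁ e₂ : ℕ) (h : Ready I s)
    (h0 : ∀ i C, C < I.size → s.real 2 (i : Fin m) C 0 = 0) :
    Runs p (conditionalGradient e₁ e₂) (I.size ^ (e₂ + 22)) s fun s' =>
      ∃ u : ℕ → Fin n → I.Choice, BestChoices I p e₁ u (I.size ^ e₂) s' := by
  have hX := I.three_le_size
  refine Runs.seq_pow hX (R := fun s' => s' = s.setNat 11 0 0 0 0) (Runs.setNat_pow hX rfl) ?_
  rintro s₁ hf₁ rfl
  set s₁ := s.setNat 11 0 0 0 0
  have h₁ : Ready I s₁ := h.frame hf₁ rfl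
  refine (Runs.countLoop (B := I.size ^ 19) (N := I.size ^ e₂) (s₀ := s₁)
    (Inv := fun k s' => ∃ u : ℕ → Fin n → I.Choice, BestChoices I p e₁ u k s' ∧
      ∀ i C, C < I.size →
        s'.real 2 (i : Fin m) C 0 = I.load (I.iterate (fun _ _ => 0) u k) i C) rfl
    (fun s' hf => iterTest_holds (h₁.frame hf rfl)) ?_ (I.size ^ e₂) 0 (by omega) s₁
    (Frame.refl _ _) (by simp [s₁]) ?_).mono ?_ ?_
  · rintro k hk s' hf hks ⟨u, hu, hL⟩
    refine (runs_iteration e₁ (h₁.frame hf rfl) hks hu hL).mono le_rfl ?_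
    rintro s'' - ⟨u', hu', hL'⟩
    refine ⟨u', fun l hl j => ⟨(hu' l hl j).1.congr (by simp) (by simp), (hu' l hl j).2⟩, ?_⟩
    simpa using hL'
  · have hm := I.machines_le_size
    -- Before the first round u is arbitrary, and the zero cells of the memory are the loads of the
    -- zero starting point.
    refine ⟨fun _ _ => (0, ⟨0, by omega⟩), fun l hl => absurd hl (Nat.not_lt_zero _), ?_⟩
    intro i C hC
    rw [show s₁.real 2 i C 0 = 0 from h0 i C hC]
    simp [Instance.iterate, Instance.load, fracLoad]
  · have := loop_steps_le (e := 19) hX (le_refl (I.size ^ e₂))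
    rw [show e₂ + 19 + 2 = e₂ + 21 by ring] at this
    omega
  · rintro s' - ⟨u, hu, -⟩
    exact ⟨u, hu⟩

end ConditionalGradient

/-! ### Sampling -/

section Sampling

/-- Moving one row of a product distribution towards a point mass amounts to overwriting that
coordinate with probability γ. Thus a coin per job realizes a conditional gradient step on the
distribution. -/
theorem prodExp_mix_row {ι Q : Type*} [Fintype ι] [DecidableEq ι] [Fintype Q] [DecidableEq Q]
    {y : ι → Q → ℝ} (j : ι) (hy : ∑ q, y j q = 1) (γ : ℝ) (q₀ : Q) (g : (ι → Q) → ℝ) :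
    prodExp (Function.update y j fun q => (1 - γ) * y j q + γ * if q = q₀ then 1 else 0) g =
      prodExp y fun a => γ * g (Function.update a j q₀) + (1 - γ) * g a := by
  rw [prodExp_update j hy, prodExp_add, prodExp_const_mul, prodExp_const_mul,
    prodExp_resample j hy g, ← prodExp_const_mul, ← prodExp_const_mul, ← prodExp_add]
  congr 1
  funext a
  rw [Finset.mul_sum]
  have h : ∀ q, ((1 - γ) * y j q + γ * if q = q₀ then 1 else 0) * g (Function.update a j q) =
      (if q = q₀ then γ * g (Function.update a j q) else 0) +
        (1 - γ) * (y j q * g (Function.update a j q)) := by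
    intro q
    split_ifs <;> ring
  simp only [h, Finset.sum_add_distrib, Finset.sum_ite_eq', Finset.mem_univ, if_true]

/-- Replace the tentative choice of the current job with the probability of the step length. -/
def sampleJob : Cmd :=
  .seq (.flip 16 (.lit 0) (.lit 0) (.lit 0) stepExp)
    (.ite (.natLe (.lit 1) (nvar 16))
      (.seq (.setNat 3 (nvar 8) (.lit 0) (.lit 0) (choiceExp 12 8))
        (.setNat 5 (nvar 8) (.lit 0) (.lit 0) (choiceExp 13 8))) skipCmd)

/-- The test whether the job counter is below the number of jobs. -/
def jobTest : Test := .natLe (.add (nvar 8) (.lit 1)) (nvar 0)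

/-- Replay the iterations of the conditional gradient method with coins. -/
def sampling (e : ℕ) : Cmd :=
  .seq (setN 11 (.lit 0)) (countLoop (iterTest e) 11 (forLoop 8 (nvar 0) sampleJob))

variable {n m : ℕ} {p : ℝ} {s s' : Mem} {I : Instance n m}

/-- The memory contains the choices `u` and the tentative assignment `a`. -/
structure Tentatively (I : Instance n m) (u : ℕ → Fin n → I.Choice) (K : ℕ) (s : Mem)
    (a : Fin n → I.Choice) : Prop extends Ready I s where
  choices : ∀ k < K, ∀ j : Fin n, HasChoice I s k j (u k j)
  machine : ∀ j : Fin n, s.nat 3 j 0 0 = (a j).1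
  deadline : ∀ j : Fin n, s.nat 5 j 0 0 = (a j).2

theorem Tentatively.frame {u : ℕ → Fin n → I.Choice} {K : ℕ} {a : Fin n → I.Choice} {c : Cmd}
    (h : Tentatively I u K s a) (hf : Frame c s s')
    (hc : (((c.natFree 0 && c.natFree 1 && c.natFree 2 && c.realFree 0) &&
      (c.natFree 6 && c.realFree 1)) && (c.natFree 12 && c.natFree 13 && c.natFree 3 &&
      c.natFree 5)) = true) : Tentatively I u K s' a := by
  rw [Bool.and_eq_true] at hc
  have h1 := h.toReady.frame hf hc.1
  simp only [Bool.and_eq_true] at hc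
  obtain ⟨-, ⟨⟨h12, h13⟩, h3⟩, h5⟩ := hc
  exact { h1 with
    choices := fun k hk j => (h.choices k hk j).congr (by rw [hf.nat 12 h12])
      (by rw [hf.nat 13 h13])
    machine := fun j => by rw [hf.nat 3 h3, h.machine]
    deadline := fun j => by rw [hf.nat 5 h5, h.deadline] }

theorem ExpectLe.mono_value {F : Config → ℝ≥0∞} {N : ℕ} {c : Config} {v w : ℝ≥0∞}
    (h : ExpectLe p F N c v) (hvw : v ≤ w) : ExpectLe p F N c w := fun k hk => (h k hk).trans hvw

theorem runs_replace {u : ℕ → Fin n → I.Choice} {K k : ℕ} {a : Fin n → I.Choice} {j : Fin n}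
    (h : Tentatively I u K s a) (hk : k < K) (h11 : s.nat 11 0 0 0 = k) (h8 : s.nat 8 0 0 0 = j)
    (h16 : s.nat 16 0 0 0 = 1) :
    Runs p (.ite (.natLe (.lit 1) (nvar 16))
      (.seq (.setNat 3 (nvar 8) (.lit 0) (.lit 0) (choiceExp 12 8))
        (.setNat 5 (nvar 8) (.lit 0) (.lit 0) (choiceExp 13 8))) skipCmd) 4 s
      fun s' => Tentatively I u K s' (Function.update a j (u k j)) := by
  refine Runs.ite (B := 3) (fun _ => ?_) fun ht => absurd (by simp [Test.Holds, NatExp.eval, h16]) ht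
  have hc := h.choices k hk j
  refine Runs.seq (B := 1) (B' := 1) (R := fun s' => s' = s.setNat 3 j 0 0 (u k j).1)
    (Runs.setNat ?_) ?_
  · simp [NatExp.eval, choiceExp, h11, h8, hc.1]
  rintro s₁ - rfl
  refine Runs.setNat ?_
  have he : (choiceExp 13 8).eval (s.setNat 3 j 0 0 (u k j).1) = (u k j).2 := by
    simp [NatExp.eval, choiceExp, h11, h8, hc.2]
  rw [he]
  have h8' : (nvar 8).eval (s.setNat 3 j 0 0 (u k j).1) = j := by simp [h8]
  rw [h8']
  simp only [NatExp.eval]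
  refine ⟨⟨⟨?_, ?_, ?_, ?_⟩, ?_, ?_⟩, ?_, ?_, ?_⟩
  · simp [h.jobs]
  · simp [h.machines]
  · simp [h.proc]
  · simp [h.weight]
  · simp [h.size]
  · simp [h.essentialWeight]
  · exact fun k hk j => (h.choices k hk j).congr (by simp) (by simp)
  · intro j'
    by_cases hj : j' = j
    · subst hj
      simp
    · have : ¬ ((j' : ℕ) = j) := fun h => hj (Fin.ext h)
      simp [Function.update_of_ne hj, Mem.setNat_nat, this, h.machine]
  · intro j'
    by_cases hj : j' = j
    · subst hj
      simp
    · have : ¬ ((j' : ℕ) = j) := fun h => hj (Fin.ext h)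
      simp [Function.update_of_ne hj, Mem.setNat_nat, this, h.deadline]

theorem runs_keep (h16 : s.nat 16 0 0 0 = 0) {c : Cmd} :
    Runs p (.ite (.natLe (.lit 1) (nvar 16)) c skipCmd) 4 s fun s' => s' = s.setNat 18 0 0 0 0 := by
  refine Runs.ite (B := 3) (fun ht => ?_) fun _ =>
    (Runs.setNat (by simp [NatExp.eval])).mono (by norm_num) fun _ _ h => h
  simp [Test.Holds, NatExp.eval, h16] at ht

/-- The rows of the jobs below `j₀` are moved towards `u`. -/
def mixBelow (I : Instance n m) (γ : ℝ) (x : Fin n → I.Choice → ℝ) (u : Fin n → I.Choice) (j₀ : ℕ)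
    (j : Fin n) : I.Choice → ℝ :=
  if (j : ℕ) < j₀ then I.mix γ x u j else x j

theorem mixBelow_succ (γ : ℝ) (x : Fin n → I.Choice → ℝ) (u : Fin n → I.Choice) (j₀ : Fin n) :
    mixBelow I γ x u (j₀ + 1) = Function.update (mixBelow I γ x u j₀) j₀
      fun q => (1 - γ) * mixBelow I γ x u j₀ j₀ q + γ * if q = u j₀ then 1 else 0 := by
  funext j
  by_cases hj : j = j₀
  · subst hj
    rw [Function.update_self]
    funext q
    simp [mixBelow, Instance.mix, Instance.point]
  · rw [Function.update_of_ne hj]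
    have : (j : ℕ) ≠ j₀ := fun h => hj (Fin.ext h)
    unfold mixBelow
    congr 1
    exact propext ⟨fun h => by omega, fun h => by omega⟩

/-- The expectation over the coins of one round for the jobs from `j₀` on. -/
theorem sampleRound_expectLe {u : ℕ → Fin n → I.Choice} {K k : ℕ} (hk : k < K)
    {x : Fin n → I.Choice → ℝ} (hx : ∀ j, ∑ q, x j q = 1) (r j₀ : ℕ) (hr : j₀ + r = n)
    (G : (Fin n → I.Choice) → ℝ) (hG : ∀ a, 0 ≤ G a) :
    ∃ H : (Fin n → I.Choice) → ℝ, (∀ a, 0 ≤ H a) ∧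
      prodExp (mixBelow I (Instance.stepLength k) x (u k) j₀) H =
        prodExp (I.mix (Instance.stepLength k) x (u k)) G ∧
      ∀ (F : Config → ℝ≥0∞) (N : ℕ) (S : List Cmd),
        (∀ s' a', Tentatively I u K s' a' → s'.nat 11 0 0 0 = k →
          ExpectLe p F N (S, s') (ENNReal.ofReal (G a'))) →
        ∀ s a, Tentatively I u K s a → s.nat 11 0 0 0 = k → s.nat 8 0 0 0 = j₀ →
          ExpectLe p F (N + (r * 9 + 1)) (countLoop jobTest 8 sampleJob :: S, s)
            (ENNReal.ofReal (H a)) := by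
  set γ := Instance.stepLength k with hγ
  have hγ0 := Instance.stepLength_nonneg k
  have hγ1 := Instance.stepLength_le_one k
  induction r generalizing j₀ with
  | zero =>
    refine ⟨G, hG, ?_, fun F N S hS s a h h11 h8 => ?_⟩
    · congr 1
      funext j
      have := j.is_lt
      rw [mixBelow, if_pos (by omega)]
    · refine ExpectLe.runs (B := 1) (R := fun s' => s' = s) ⟨s, 1, .whileFalse ?_, le_rfl, rfl⟩ ?_
      · simp only [jobTest, Test.Holds, NatExp.eval, nvar_eval, h.jobs, h8]
        omega
      · rintro s' - rfl
        exact hS s' a h h11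
  | succ r ih =>
    obtain ⟨H, hH0, hHe, hH⟩ := ih (j₀ + 1) (by omega)
    let j : Fin n := ⟨j₀, by omega⟩
    -- The functions are built backwards: the expected final cost from assignment a is the average
    -- over the coin of the current job of the function for the jobs after it.
    refine ⟨fun a => γ * H (Function.update a j (u k j)) + (1 - γ) * H a, fun a =>
      add_nonneg (mul_nonneg hγ0 (hH0 _)) (mul_nonneg (sub_nonneg.2 hγ1) (hH0 _)), ?_, ?_⟩
    · rw [← hHe, show j₀ = (j : ℕ) from rfl, mixBelow_succ, prodExp_mix_row]
      simp [mixBelow, hx]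
    · intro F N S hS s a h h11 h8
      have hrest : ∀ s₁ a₁, Tentatively I u K s₁ a₁ → s₁.nat 11 0 0 0 = k →
          s₁.nat 8 0 0 0 = j₀ → ExpectLe p F (N + (r * 9 + 1) + 1)
            (setN 8 (.add (nvar 8) (.lit 1)) :: countLoop jobTest 8 sampleJob :: S, s₁)
            (ENNReal.ofReal (H a₁)) := by
        intro s₁ a₁ h₁ h11₁ h8₁
        refine ExpectLe.runs (R := fun s' => s'.nat 8 0 0 0 = j₀ + 1) (Runs.setNat ?_) ?_
        · simp [NatExp.eval, h8₁]
        · intro s₂ hf₂ h8₂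
          exact hH F N S hS s₂ a₁ (h₁.frame hf₂ rfl) (by rw [hf₂.nat 11 rfl, h11₁]) h8₂
      have heval : stepExp.eval p s = γ := stepExp_eval h11
      have hcoin : ∀ b : ℕ, Tentatively I u K (s.setNat 16 0 0 0 b) a := fun b =>
        h.frame (c := setN 16 (.lit b)) (Evaluates.setNat (p := p) 16 (.lit 0) (.lit 0) (.lit 0)
          (.lit b) s).frame rfl
      refine (ExpectLe.whileTrue (N := N + (r * 9 + 1) + 1 + 4 + 1 + 1 + 1) ?_
        (ExpectLe.seq (ExpectLe.seq ?_))).mono_steps (by omega)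
      · simp only [jobTest, Test.Holds, NatExp.eval, nvar_eval, h.jobs, h8]
        omega
      · have hflip := ExpectLe.flip (p := p) (F := F) (N := N + (r * 9 + 1) + 1 + 4) (arr := 16)
          (i := .lit 0) (j := .lit 0) (k := .lit 0) (q := stepExp) (s := s)
          (hH0 (Function.update a j (u k j))) (hH0 a) (by rw [heval]; exact hγ0)
          (by rw [heval]; exact hγ1)
          (K := .ite (.natLe (.lit 1) (nvar 16))
            (.seq (.setNat 3 (nvar 8) (.lit 0) (.lit 0) (choiceExp 12 8))
              (.setNat 5 (nvar 8) (.lit 0) (.lit 0) (choiceExp 13 8))) skipCmd ::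
            setN 8 (.add (nvar 8) (.lit 1)) :: countLoop jobTest 8 sampleJob :: S)
          (ExpectLe.runs (runs_replace (j := j) (hcoin 1) hk (by simp [NatExp.eval, h11])
            (by simp [NatExp.eval, h8, j]) (by simp [NatExp.eval])) fun s' hf' h' =>
            hrest s' _ h' (by rw [hf'.nat 11 rfl]; simp [h11]) (by rw [hf'.nat 8 rfl]; simp [h8]))
          (ExpectLe.runs (runs_keep (by simp [NatExp.eval])) fun s' _ h' => by
            subst h'
            exact hrest _ _ ((hcoin 0).frame (c := skipCmd) (Evaluates.setNat (p := p) 18 (.lit 0)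
              (.lit 0) (.lit 0) (.lit 0) _).frame rfl) (by simp [h11]) (by simp [h8]))
        rwa [heval] at hflip

theorem sum_iterate_of_sum {x : Fin n → I.Choice → ℝ} (hx : ∀ j, ∑ q, x j q = 1)
    (u : ℕ → Fin n → I.Choice) (k : ℕ) (j : Fin n) : ∑ q, I.iterate x u k j q = 1 := by
  induction k with
  | zero => exact hx j
  | succ k ih => rw [Instance.iterate, Instance.sum_mix, ih]; ring

/-- The expectation over the coins of all rounds from round `k` on. -/
theorem sampling_loop_expectLe {u : ℕ → Fin n → I.Choice} (e : ℕ)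
    {x : Fin n → I.Choice → ℝ} (hx : ∀ j, ∑ q, x j q = 1) (r k : ℕ) (hr : k + r = I.size ^ e)
    (G : (Fin n → I.Choice) → ℝ) (hG : ∀ a, 0 ≤ G a) :
    ∃ H : (Fin n → I.Choice) → ℝ, (∀ a, 0 ≤ H a) ∧
      prodExp (I.iterate x u k) H = prodExp (I.iterate x u (I.size ^ e)) G ∧
      ∀ (F : Config → ℝ≥0∞) (N : ℕ) (S : List Cmd),
        (∀ s' a', Tentatively I u (I.size ^ e) s' a' →
          ExpectLe p F N (S, s') (ENNReal.ofReal (G a'))) →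
        ∀ s a, Tentatively I u (I.size ^ e) s a → s.nat 11 0 0 0 = k →
          ExpectLe p F (N + (r * (n * 9 + 6) + 1))
            (countLoop (iterTest e) 11 (forLoop 8 (nvar 0) sampleJob) :: S, s)
            (ENNReal.ofReal (H a)) := by
  induction r generalizing k with
  | zero =>
    refine ⟨G, hG, by rw [show k = I.size ^ e by omega], fun F N S hS s a h h11 => ?_⟩
    refine (ExpectLe.runs (N := N) (B := 1) (R := fun s' => s' = s)
      ⟨s, 1, .whileFalse ?_, le_rfl, rfl⟩ ?_).mono_steps (by omega)
    · rw [iterTest_holds h.toReady]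
      omega
    · rintro s' - rfl
      exact hS s' a h
  | succ r ih =>
    obtain ⟨H₁, hH₁0, hH₁e, hH₁⟩ := ih (k + 1) (by omega)
    -- The function for the rounds after k serves as the final cost of round k.
    obtain ⟨H, hH0, hHe, hH⟩ := sampleRound_expectLe (p := p) (u := u)
      (show k < I.size ^ e by omega) (sum_iterate_of_sum hx u k) n 0 (by omega) H₁ hH₁0
    refine ⟨H, hH0, ?_, fun F N S hS s a h h11 => ?_⟩
    · rw [← hH₁e, Instance.iterate, ← hHe]
      congr 1
    · refine (ExpectLe.whileTrue (N := N + (r * (n * 9 + 6) + 1) + 1 + (n * 9 + 1) + 1 + 1 + 1) ?_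
        (ExpectLe.seq (ExpectLe.seq ?_))).mono_steps ?_
      · rw [iterTest_holds h.toReady]
        omega
      · refine ExpectLe.runs (R := fun s' => s'.nat 8 0 0 0 = 0) (Runs.setNat ?_) ?_
        · simp [NatExp.eval]
        · intro s₁ hf₁ h8₁
          refine hH F _ _ ?_ s₁ a (h.frame hf₁ rfl) (by rw [hf₁.nat 11 rfl, h11]) h8₁
          intro s₂ a₂ h₂ h11₂
          refine ExpectLe.runs (R := fun s' => s'.nat 11 0 0 0 = k + 1) (Runs.setNat ?_) ?_
          · simp [NatExp.eval, h11₂]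
          · intro s₃ hf₃ h11₃
            exact hH₁ F N S hS s₃ a₂ (h₂.frame hf₃ rfl) h11₃
      · rw [add_mul]
        omega

end Sampling

/-! ### The output -/

section Output

variable {n m : ℕ} {p : ℝ} {s s' : Mem} {I : Instance n m}

/-- Job `k` precedes job `j`: earlier deadline, ties being broken according to the index. -/
def Before (a : Fin n → I.Choice) (k j : Fin n) : Prop :=
  ((a k).2 : ℕ) < (a j).2 ∨ (((a k).2 : ℕ) = (a j).2 ∧ k < j)

instance (a : Fin n → I.Choice) : DecidableRel (Before a) := fun _ _ =>
  inferInstanceAs (Decidable (_ ∨ _))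

/-- The total processing time of the jobs that precede job `j` on its machine. -/
def startTime (a : Fin n → I.Choice) (j : Fin n) : ℕ :=
  ∑ k, if (a k).1 = (a j).1 ∧ Before a k j then I.proc (a j).1 k else 0

/-- The schedule that runs the jobs on every machine in the order of the deadlines. -/
def deadlineSchedule (a : Fin n → I.Choice) : Schedule n m where
  machine j := (a j).1
  start j := startTime a j

theorem feasible_deadlineSchedule (a : Fin n → I.Choice) : I.Feasible (deadlineSchedule a) := by
  refine I.feasible_of_order _ (Before a) ?_ ?_ ?_ fun j => ?_
  · intro i j k h h'
    simp only [Before] at *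
    omega
  · intro j h
    simp only [Before] at h
    omega
  · intro j k h
    have : (j : ℕ) ≠ k := fun h' => h (Fin.ext h')
    simp only [Before]
    omega
  · simp only [deadlineSchedule, startTime, Nat.cast_sum]
    refine Finset.sum_congr rfl fun k _ => ?_
    split_ifs with h
    · rw [h.1]
    · exact Nat.cast_zero

theorem completion_deadlineSchedule_le (a : Fin n → I.Choice) (j : Fin n) :
    I.completion (deadlineSchedule a) j ≤ (I.proc (a j).1 j : ℝ) + ∑ k ∈ Finset.univ.erase j,
      if (a k).1 = (a j).1 ∧ ((a k).2 : ℕ) ≤ (a j).2 then (I.proc (a j).1 k : ℝ) else 0 := by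
  rw [Instance.completion, Instance.duration, add_comm]
  simp only [deadlineSchedule, startTime, Nat.cast_sum]
  refine add_le_add le_rfl ?_
  rw [← Finset.add_sum_erase _ _ (Finset.mem_univ j), if_neg fun h => by
    have := h.2
    simp only [Before] at this
    omega, Nat.cast_zero, zero_add]
  refine Finset.sum_le_sum fun k _ => ?_
  by_cases h : (a k).1 = (a j).1 ∧ Before a k j
  · rw [if_pos h, if_pos ⟨h.1, by have := h.2; simp only [Before] at this; omega⟩]
  · rw [if_neg h, Nat.cast_zero]
    split_ifs
    · exact Nat.cast_nonneg _
    · exact le_rfl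

/-- The test whether the job of counter 10 precedes the job of counter 8 on its machine. -/
def beforeTest : Test :=
  let entry a v : NatExp := .get a (nvar v) (.lit 0) (.lit 0)
  .natLe (.add (.add (.sub (entry 3 10) (entry 3 8)) (.sub (entry 3 8) (entry 3 10)))
    (.sub (.add (entry 5 10) (.sub (.lit 1) (.sub (nvar 8) (nvar 10)))) (entry 5 8))) (.lit 0)

/-- Compute the start times. -/
def computeStarts : Cmd :=
  forLoop 8 (nvar 0) (.seq
    (sumNat 17 10 (nvar 0) beforeTest (.get 2 (.get 3 (nvar 8) (.lit 0) (.lit 0)) (nvar 10) (.lit 0)))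
    (.setNat 4 (nvar 8) (.lit 0) (.lit 0) (nvar 17)))

theorem runs_computeStarts [NeZero m] {u : ℕ → Fin n → I.Choice} {K : ℕ} {a : Fin n → I.Choice}
    (h : Tentatively I u K s a) :
    Runs p computeStarts (I.size ^ 9) s fun s' => ∀ j : Fin n, s'.nat 4 j 0 0 = startTime a j := by
  have hX := I.three_le_size
  refine (Runs.forLoop_pow (e := 6) hX I.jobs_le_size
    (fun i s' => ∀ j : Fin n, (j : ℕ) < i → s'.nat 4 j 0 0 = startTime a j) rfl
    (fun s' hf => by exact (h.frame hf rfl).jobs) (fun j hj => absurd hj (Nat.not_lt_zero _))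
    ?_).mono le_rfl fun s' _ h j => h j j.is_lt
  intro i hi s₁ hf₁ hi₁ hinv
  have h₁ := h.frame hf₁ rfl
  let j : Fin n := ⟨i, hi⟩
  refine Runs.seq_pow hX (runs_sumNat hX I.jobs_le_size (by norm_num) (by norm_num) (by norm_num)
    (fun s' hf => by exact (h₁.frame hf rfl).jobs)
    (fun k => if (a k).1 = (a j).1 ∧ Before a k j then I.proc (a j).1 k else 0) ?_) ?_
  · intro s' hf k hk
    have h' := h₁.frame hf rfl
    have h8 : s'.nat 8 0 0 0 = j := by rw [hf.nat 8 rfl, hi₁]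
    -- The summand 1 - (j - k) is 0 if k < j and 1 otherwise, so the deadline comparison is weak or
    -- strict according to the tie-breaking by index.
    have hiff : beforeTest.Holds p s' ↔ (a k).1 = (a j).1 ∧ Before a k j := by
      simp only [beforeTest, Test.Holds, NatExp.eval, nvar_eval, h8, hk, h'.machine, h'.deadline,
        Before, Fin.ext_iff, Fin.lt_def]
      omega
    rw [hiff]
    refine ⟨fun ht => ?_, fun ht => if_neg ht⟩
    rw [if_pos ht]
    simp only [NatExp.eval, nvar_eval, h8, hk, h'.machine, h'.proc]
  · intro s₂ hf₂ h₂
    have h8 : s₂.nat 8 0 0 0 = j := by rw [hf₂.nat 8 rfl, hi₁]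
    refine Runs.setNat_pow hX fun k hk => ?_
    rw [Mem.setNat_nat_ne _ (by norm_num)]
    simp only [NatExp.eval, nvar_eval, h8, h₂]
    rw [Mem.setNat_nat]
    by_cases hkj : k = j
    · subst hkj
      rw [if_pos ⟨rfl, rfl, rfl⟩]
      rfl
    · have hne : (k : ℕ) ≠ i := fun h => hkj (Fin.ext h)
      rw [if_neg fun h => hne h.1, hf₂.nat 4 rfl]
      exact hinv k (by omega)

theorem schedule_eq [NeZero m] {a : Fin n → I.Choice} (h3 : ∀ j : Fin n, s.nat 3 j 0 0 = (a j).1)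
    (h4 : ∀ j : Fin n, s.nat 4 j 0 0 = startTime a j) :
    (s.schedule : Schedule n m) = deadlineSchedule a := by
  simp only [Mem.schedule, deadlineSchedule, h3, h4, Fin.ofNat_val_eq_self]

/-! ### The whole program -/

/-- The program: conditional gradient method, sampling, list scheduling. -/
def program (e₁ e₂ : ℕ) : Cmd :=
  .seq computeSize (.seq computeWeight (.seq (conditionalGradient e₁ e₂)
    (.seq (sampling e₂) computeStarts)))

open Classical in
/-- The cost of the schedule in the memory, if the program has halted with a feasible schedule. -/
def Instance.outputCost [NeZero m] (I : Instance n m) (p : ℝ) (c : Config) : ℝ≥0∞ :=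
  if c.1 = [] ∧ I.WritesFeasible c.2 then ENNReal.ofReal (I.cost p c.2.schedule) else ⊤

theorem outputCost_eq [NeZero m] {a : Fin n → I.Choice}
    (h3 : ∀ j : Fin n, s.nat 3 j 0 0 = (a j).1)
    (h4 : ∀ j : Fin n, s.nat 4 j 0 0 = startTime a j) :
    I.outputCost p ([], s) =
      ENNReal.ofReal (∑ j, I.weight j * I.completion (deadlineSchedule a) j ^ p) := by
  have hs := schedule_eq (I := I) h3 h4
  rw [Instance.outputCost, if_pos, hs, Instance.cost]
  refine ⟨rfl, fun j => by rw [h3]; exact (a j).1.is_lt, ?_⟩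
  rw [hs]
  exact feasible_deadlineSchedule a

theorem holds_inputMem (I : Instance n m) : Holds I I.inputMem where
  jobs := by simp [Instance.inputMem]
  machines := by simp [Instance.inputMem]
  proc i j := by simp [Instance.inputMem]
  weight j := by simp [Instance.inputMem]

theorem program_steps_le {X : ℕ} (hX : 3 ≤ X) (e : ℕ) {n : ℕ} (hn : n ≤ X) :
    X ^ 9 + (X ^ e * (n * 9 + 6) + 1) + 1 + 1 + 1 + X ^ (e + 22) + 1 + X ^ 10 + 1 + X ^ 10 + 1 ≤
      X ^ (e + 30) := by
  have h0 : 1 ≤ X ^ (e + 22) := Nat.one_le_pow _ _ (by omega)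
  have h9 : X ^ 9 ≤ X ^ (e + 22) := Nat.pow_le_pow_right (by omega) (by omega)
  have h10 : X ^ 10 ≤ X ^ (e + 22) := Nat.pow_le_pow_right (by omega) (by omega)
  have hloop : X ^ e * (n * 9 + 6) ≤ X ^ (e + 22) := by
    have h1 : n * 9 + 6 ≤ X ^ 4 := by
      have h2 : 9 ≤ X ^ 2 := by nlinarith
      have h3 : X ^ 4 = X ^ 2 * X ^ 2 := by ring
      have h4 : X ^ 2 = X * X := by ring
      nlinarith
    calc X ^ e * (n * 9 + 6) ≤ X ^ e * X ^ 4 := Nat.mul_le_mul_left _ h1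
      _ = X ^ (e + 4) := (pow_add _ _ _).symm
      _ ≤ _ := Nat.pow_le_pow_right (by omega) (by omega)
  have h8 : 3 ^ 8 ≤ X ^ 8 := Nat.pow_le_pow_left hX 8
  have h30 : X ^ (e + 30) = X ^ (e + 22) * X ^ 8 := by rw [← pow_add]
  rw [h30]
  nlinarith

/-- Sampling and list scheduling attain the expectation under independent choices. -/
theorem sampling_expectLe [NeZero m] {u : ℕ → Fin n → I.Choice} (e : ℕ) {a : Fin n → I.Choice}
    (h : Tentatively I u (I.size ^ e) s a) {v : ℝ}
    (hv : prodExp (I.iterate (fun _ _ => 0) u (I.size ^ e))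
      (fun a => ∑ j, I.weight j * I.completion (deadlineSchedule a) j ^ p) ≤ v) :
    ExpectLe p (I.outputCost p) (I.size ^ 9 + (I.size ^ e * (n * 9 + 6) + 1) + 1 + 1 + 1)
      ([.seq (sampling e) computeStarts], s) (ENNReal.ofReal v) := by
  obtain ⟨H, -, hHe, hH⟩ := sampling_loop_expectLe (p := p) (u := u) e (I.sum_point a)
    (I.size ^ e) 0 (by omega) (fun a => ∑ j, I.weight j * I.completion (deadlineSchedule a) j ^ p)
    fun a => Finset.sum_nonneg fun j _ => mul_nonneg (I.weight_nonneg j)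
      (Real.rpow_nonneg (Instance.completion_nonneg (feasible_deadlineSchedule a) j) p)
  have hpos : I.size ^ e ≠ 0 := (pow_pos (by have := I.three_le_size; omega) e).ne'
  obtain ⟨k, hk⟩ := Nat.exists_eq_succ_of_ne_zero hpos
  -- Sampling starts from the point mass at whatever assignment a is in the memory, whereas the
  -- analysis starts from 0. The first step has length 1 and erases the difference.
  have hHa : H a ≤ v := by
    refine le_of_eq_of_le ?_ hv
    rw [hk, Nat.succ_eq_add_one, Instance.iterate_succ_eq (fun _ _ => 0) (I.point a),
      ← Nat.succ_eq_add_one, ← hk, ← hHe]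
    exact (prodExp_point a H).symm
  refine (ExpectLe.seq (ExpectLe.seq (ExpectLe.runs (B := 1) (R := fun s' => s'.nat 11 0 0 0 = 0)
    (Runs.setNat (by simp [NatExp.eval])) fun s₁ hf₁ h₁ => ?_))).mono_value
    (ENNReal.ofReal_le_ofReal hHa)
  refine hH _ _ _ (fun s₂ a₂ h₂ => ?_) s₁ a (h.frame hf₁ rfl) h₁
  refine (ExpectLe.runs (N := 0) (runs_computeStarts h₂) fun s₃ hf₃ h₃ => ?_).mono_steps (by omega)
  intro k _
  rw [expect_nil, outputCost_eq (fun j => by rw [hf₃.nat 3 rfl, h₂.machine]) h₃]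

theorem program_expectLe (hp : 1 ≤ p) : ∃ e₁ e₂ : ℕ, ∀ (n m : ℕ) [NeZero m] (I : Instance n m)
    (S : Schedule n m), I.Feasible S →
    ExpectLe p (I.outputCost p) (I.size ^ (e₂ + 30)) ([program e₁ e₂], I.inputMem)
      (ENNReal.ofReal (2 ^ p * fractionalBell p * I.cost p S)) := by
  obtain ⟨e₁, e₂, he⟩ := Instance.exists_exponents_prodExp_le hp
  refine ⟨e₁, e₂, fun n m _ I S hS => ?_⟩
  have hX := I.three_le_size
  refine (ExpectLe.seq (ExpectLe.runs (runs_computeSize I (holds_inputMem I)) fun s₁ hf₁ h₁ =>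
    ExpectLe.seq (ExpectLe.runs (runs_computeWeight I ((holds_inputMem I).frame hf₁ rfl))
      fun s₂ hf₂ h₂ => ExpectLe.seq (ExpectLe.runs (runs_conditionalGradient e₁ e₂ ?_ ?_)
        fun s₃ hf₃ h₃ => ?_)))).mono_steps (program_steps_le hX e₂ I.jobs_le_size)
  · exact { ((holds_inputMem I).frame hf₁ rfl).frame hf₂ rfl with
      size := by rw [hf₂.nat 6 rfl, h₁]
      essentialWeight := h₂ }
  · intro i C _
    rw [hf₂.real 2 rfl, hf₁.real 2 rfl]
    simp [Instance.inputMem]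
  · obtain ⟨u, hu⟩ := h₃
    -- The arrays of sampled machines and deadlines are still zero, which is a legitimate tentative
    -- assignment.
    refine sampling_expectLe (u := u) (a := fun _ => (0, ⟨0, by omega⟩)) e₂ ?_
      (he n m I u (fun k hk j => (hu k hk j).2.1) (fun k hk j q hq => (hu k hk j).2.2 q hq)
        (fun a j => I.completion (deadlineSchedule a) j)
        (fun a j => Instance.completion_nonneg (feasible_deadlineSchedule a) j)
        completion_deadlineSchedule_le S hS)
    have hh : Holds I s₃ := (((holds_inputMem I).frame hf₁ rfl).frame hf₂ rfl).frame hf₃ rfl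
    exact { hh with
      size := by rw [hf₃.nat 6 rfl, hf₂.nat 6 rfl, h₁]
      essentialWeight := by rw [hf₃.real 1 rfl, h₂]
      choices := fun k hk j => (hu k hk j).1
      machine := fun j => by
        rw [hf₃.nat 3 rfl, hf₂.nat 3 rfl, hf₁.nat 3 rfl]
        simp [Instance.inputMem]
      deadline := fun j => by
        rw [hf₃.nat 5 rfl, hf₂.nat 5 rfl, hf₁.nat 5 rfl]
        simp [Instance.inputMem] }

/-- Feasible schedules exist, so the expectation of `outputCost` is finite. As `outputCost` is
infinite on bad configurations, none of them has positive probability, which gives halting and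
feasibility for all coin outcomes along with the cost bound. -/
theorem exists_isPolyTimeApprox (hp : 1 ≤ p) :
    ∃ P : Cmd, IsPolyTimeApprox p (2 ^ p * fractionalBell p) P := by
  obtain ⟨e₁, e₂, he⟩ := program_expectLe hp
  refine ⟨program e₁ e₂, e₂ + 30, fun n m _ I => ?_⟩
  have hexp := fun S hS => he n m I S hS (I.size ^ (e₂ + 30)) le_rfl
  change (∀ c ∈ (I.runOn p (program e₁ e₂) (I.size ^ (e₂ + 30))).support, _) ∧
    ∀ S, _ → I.expectedCost p (program e₁ e₂) (I.size ^ (e₂ + 30)) ≤ _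
  refine ⟨fun c hc => ?_, fun S hS => le_trans ?_ (hexp S hS)⟩
  · obtain ⟨S, hS⟩ := I.exists_feasible
    by_contra hbad
    have h1 := ENNReal.ne_top_of_tsum_ne_top (ne_top_of_le_ne_top ENNReal.ofReal_ne_top (hexp S hS)) c
    rw [Instance.outputCost, if_neg hbad] at h1
    exact h1 (ENNReal.mul_top ((PMF.mem_support_iff _ _).1 hc))
  · have hle : ∀ c : Config, ENNReal.ofReal (I.cost p c.2.schedule) ≤ I.outputCost p c := by
      intro c
      rw [Instance.outputCost]
      split_ifs
      · exact le_rfl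
      · exact le_top
    unfold Instance.expectedCost Instance.runOn expect
    generalize run p (I.size ^ (e₂ + 30)) ([program e₁ e₂], I.inputMem) = μ
    exact ENNReal.tsum_le_tsum fun c => mul_le_mul_right (hle c) _

end Output

end UnrelatedScheduling

end

theorem mainTheorem10 (p : ℝ) (hp : 1 ≤ p) :
    (∃ P : UnrelatedScheduling.Cmd,
      UnrelatedScheduling.IsPolyTimeApprox p (2 ^ p * UnrelatedScheduling.fractionalBell p) P) ∧
    ∀ (n m : ℕ) [NeZero m] (I : UnrelatedScheduling.Instance n m),
      (∃ x : I.Point, I.LPOptimal p x) ∧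
      (∀ x : I.Point, I.LPOptimal p x →
        ∀ S : UnrelatedScheduling.Schedule n m, I.Feasible S → I.lpCost p x ≤ I.cost p S) ∧
      (∀ (tie : Equiv.Perm (Fin n)) (a : I.Tentative), I.Feasible (I.listSchedule tie a)) ∧
      (∀ x : I.Point, I.LPFeasible x → ∀ tie : Equiv.Perm (Fin n),
        I.roundingExpectedCost p tie x ≤
          2 ^ p * UnrelatedScheduling.fractionalBell p * I.lpCost p x) ∧
      (∀ x : I.Point, I.LPOptimal p x → ∀ tie : Equiv.Perm (Fin n),
        ∀ S : UnrelatedScheduling.Schedule n m, I.Feasible S →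
          I.roundingExpectedCost p tie x ≤
            2 ^ p * UnrelatedScheduling.fractionalBell p * I.cost p S) := by
  have hp0 : 0 ≤ p := zero_le_one.trans hp
  refine ⟨UnrelatedScheduling.exists_isPolyTimeApprox hp, fun n m _ I => ?_⟩
  have hle : ∀ x : I.Point, I.LPOptimal p x → ∀ S : UnrelatedScheduling.Schedule n m,
      I.Feasible S → I.lpCost p x ≤ I.cost p S := by
    intro x hx S hS
    obtain ⟨y, hy, hyS⟩ := UnrelatedScheduling.Instance.exists_lpFeasible_le hS hp0
    exact (hx.2 y hy).trans hyS
  refine ⟨I.exists_lpOptimal hp0, hle, I.feasible_listSchedule,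
    fun x hx tie => UnrelatedScheduling.Instance.roundingExpectedCost_le hp hx tie,
    fun x hx tie S hS =>
      (UnrelatedScheduling.Instance.roundingExpectedCost_le hp hx.1 tie).trans ?_⟩
  have hA := zero_le_one.trans (UnrelatedScheduling.one_le_fractionalBell hp)
  exact mul_le_mul_of_nonneg_left (hle x hx S hS) (mul_nonneg (by positivity) hA)
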